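/- For a graph $G$, let $\alpha(G)$ be the maximum size of an independent set of $G$; a set $S\subseteq V(G)$ is a $\rho$-approximate solution of Maximum Independent Set in $G$ if $S$ is independent and $\alpha(G)\le\rho\,|S|$. All graphs are finite and simple, and $G$ is $H$-free if no induced subgraph of $G$ is isomorphic to $H$. A graph $H$ has the improved approximation property if there are a constant $\varepsilon>0$, a randomized algorithm $A$ that tosses fair coins, a polynomial $T$ and a function $f\colon\mathbb N\to[0,\infty]$ with $f(n)\to1$ as $n\to\infty$, such that for every $n$ and every $H$-free graph $G$ with $n$ vertices, $A$ on input $G$ always halts within $T(n)$ steps, and with probability at least $f(n)$ it outputs an $n^{1-\varepsilon}$-approximate solution of Maximum Independent Set in $G$. For graphs $H_1,H_2$ with disjoint vertex sets and $v_0\in V(H_1)$, the graph obtained from $H_1$ by substituting $H_2$ at $v_0$ has vertex set $(V(H_1)\setminus\{v_0\})\cup V(H_2)$; two vertices of $V(H_1)\setminus\{v_0\}$ are adjacent if and only if they are adjacent in $H_1$, two vertices of $V(H_2)$ are adjacent if and only if they are adjacent in $H_2$, and $v\in V(H_1)\setminus\{v_0\}$ is adjacent to $v'\in V(H_2)$ if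 and only if $vv_0$ is an edge of $H_1$. Theorem. If $H_1$ and $H_2$ have the improved approximation property, then for every $v_0\in V(H_1)$, the graph obtained from $H_1$ by substituting $H_2$ at $v_0$ has the improved approximation property. -/

import Mathlib

open Filter Topology

/-! ### Randomized programs with a step count

The machine model is the imperative language WHILE on binary trees (N. D. Jones, *Computability and
Complexity from a Programming Perspective*), together with an instruction that tosses a fair coin.
A program uses finitely many variables, each of which holds a pointer to a binary tree (a LISP list
structure).  Each step changes a bounded number of pointers: the only operations are the empty
tree, pairing, the two projections and the test for the empty tree.  In particular a
probabilistic Turing machine, which stores its work tapes as lists, can be simulated with a constant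
number of steps per step, and conversely `T` steps are simulated by a probabilistic Turing machine
in time polynomial in `T` and the input length, by means of a pointer structure with one new cell
for each pairing. -/

/-- Binary trees, the values of the variables. -/
inductive Data : Type
  | nil : Data
  | cons : Data → Data → Data

namespace Data

/-- First component. -/
def hd : Data → Data
  | nil => nil
  | cons a _ => a

/-- Second component. -/
def tl : Data → Data
  | nil => nil
  | cons _ b => b

/-- `nil` stands for `false`, `cons nil nil` for `true`. -/
def ofBool : Bool → Data
  | false => nil
  | true => cons nil nil

/-- A list as nested pairs. -/
def ofList : List Data → Data
  | [] => nil
  | a :: l => cons a (ofList l)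

/-- The `k`-th entry of a list of truth values; every non-empty tree counts as `true`, and positions
beyond the end of the list count as `false`. -/
def bit (d : Data) (k : ℕ) : Prop := (tl^[k] d).hd ≠ nil

end Data

/-- Expressions over the variables, which are numbered by `ℕ`. -/
inductive Expr : Type
  | var : ℕ → Expr
  | nil : Expr
  | cons : Expr → Expr → Expr
  | hd : Expr → Expr
  | tl : Expr → Expr

/-- The values of all variables. -/
abbrev Store : Type := ℕ → Data

/-- The value of an expression. -/
def Expr.eval (s : Store) : Expr → Data
  | var x => s x
  | nil => Data.nil
  | cons a b => Data.cons (a.eval s) (b.eval s)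
  | hd a => (a.eval s).hd
  | tl a => (a.eval s).tl

/-- Programs: assignment, fair coin toss, sequential composition, branching, loop.  The
tests of `ite x c d` and `while x c` ask whether variable `x` is different from `nil`. -/
inductive Prog : Type
  | assign : ℕ → Expr → Prog
  | toss : ℕ → Prog
  | seq : Prog → Prog → Prog
  | ite : ℕ → Prog → Prog → Prog
  | while : ℕ → Prog → Prog

/-- A configuration of a running program: the programs that are still to be executed, in this order,
and the current values of the variables. -/
structure Config : Type where
  /-- what remains to be executed -/
  todo : List Prog
  /-- the values of the variables -/
  store : Store

namespace Config

/-- The execution is over. -/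
def Halted (c : Config) : Prop := c.todo = []

open Classical in
/-- One step of computation: the distribution of the next configuration.  A halted
configuration does not change. -/
noncomputable def step : Config → PMF Config
  | ⟨[], s⟩ => PMF.pure ⟨[], s⟩
  | ⟨.assign x e :: k, s⟩ => PMF.pure ⟨k, Function.update s x (e.eval s)⟩
  | ⟨.toss x :: k, s⟩ =>
      (PMF.uniformOfFintype Bool).map fun b => ⟨k, Function.update s x (Data.ofBool b)⟩
  | ⟨.seq p q :: k, s⟩ => PMF.pure ⟨p :: q :: k, s⟩
  | ⟨.ite x p q :: k, s⟩ =>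
      PMF.pure (if s x ≠ Data.nil then ⟨p :: k, s⟩ else ⟨q :: k, s⟩)
  | ⟨.while x p :: k, s⟩ =>
      PMF.pure (if s x ≠ Data.nil then ⟨p :: .while x p :: k, s⟩ else ⟨k, s⟩)

/-- The distribution of the configuration after `t` steps. -/
noncomputable def run : ℕ → Config → PMF Config
  | 0, c => PMF.pure c
  | t + 1, c => (step c).bind (run t)

end Config

/-! ### Graphs as inputs, vertex sets as outputs -/

open Classical in
/-- The adjacency matrix of a graph on `n` vertices, as a list of `n` rows of `n` truth values. -/
noncomputable def encodeGraph {n : ℕ} (G : SimpleGraph (Fin n)) : Data :=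
  Data.ofList (List.ofFn fun i =>
    Data.ofList (List.ofFn fun j => Data.ofBool (decide (G.Adj i j))))

/-- The start of program `p` on input `d`: variable `0` holds the input, all others are empty. -/
def Prog.start (p : Prog) (d : Data) : Config :=
  ⟨[p], Function.update (fun _ => Data.nil) 0 d⟩

open Classical in
/-- The output, a set of vertices: variable `0` read as a list of `n` truth values. -/
noncomputable def Config.output (n : ℕ) (c : Config) : Finset (Fin n) :=
  Finset.univ.filter fun v => (c.store 0).bit v

/-! ### Approximation of Maximum Independent Set in `H`-free graphs -/

namespace SimpleGraph

/-- `S` is a `ρ`-approximate solution of Maximum Independent Set in `G`. -/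
def IsApproxMIS {n : ℕ} (G : SimpleGraph (Fin n)) (ρ : ℝ) (S : Finset (Fin n)) : Prop :=
  G.IsIndepSet (S : Set (Fin n)) ∧ (G.indepNum : ℝ) ≤ ρ * (S.card : ℝ)

/-- `G` has no induced subgraph isomorphic to `H`. -/
def IsFreeOf {V W : Type*} (G : SimpleGraph W) (H : SimpleGraph V) : Prop :=
  ¬ H.IsIndContained G

/-- On every `H`-free graph with `n` vertices, `p` halts within a number of steps that is polynomial
in `n`, whatever the coin tosses are. -/
def PolyTimeOnFree {V : Type*} (H : SimpleGraph V) (p : Prog) : Prop :=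
  ∃ T : Polynomial ℕ, ∀ (n : ℕ) (G : SimpleGraph (Fin n)), G.IsFreeOf H →
    ∀ c ∈ (Config.run (T.eval n) (p.start (encodeGraph G))).support, c.Halted

/-- On `H`-free graphs with `n` vertices, `p` halts with a `ρ n`-approximate solution of
Maximum Independent Set with high probability: with a probability that is at least a function
of `n` which tends to `1`. -/
def ApproximatesOnFree {V : Type*} (H : SimpleGraph V) (ρ : ℕ → ℝ) (p : Prog) : Prop :=
  ∃ f : ℕ → ENNReal, Tendsto f atTop (𝓝 1) ∧
    ∀ (n : ℕ) (G : SimpleGraph (Fin n)), G.IsFreeOf H → ∃ t : ℕ,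
      f n ≤ (Config.run t (p.start (encodeGraph G))).toOuterMeasure
        {c | c.Halted ∧ G.IsApproxMIS (ρ n) (c.output n)}

/-- The improved approximation property of `H`: for some `ε > 0`, Maximum Independent Set in
`H`-free graphs with `n` vertices has a randomized polynomial-time `n ^ (1 - ε)`-approximation
algorithm. -/
def ImprovedApproximationProperty {V : Type*} (H : SimpleGraph V) : Prop :=
  ∃ ε : ℝ, 0 < ε ∧ ∃ p : Prog,
    H.PolyTimeOnFree p ∧ H.ApproximatesOnFree (fun n => (n : ℝ) ^ (1 - ε)) p

/-- The graph obtained from `H₁` by substituting `H₂` at `v₀`. -/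
def substitute {V₁ V₂ : Type*} (H₁ : SimpleGraph V₁) (v₀ : V₁) (H₂ : SimpleGraph V₂) :
    SimpleGraph ({v : V₁ // v ≠ v₀} ⊕ V₂) where
  Adj
    | .inl v, .inl v' => H₁.Adj v v'
    | .inr v, .inr v' => H₂.Adj v v'
    | .inl v, .inr _ => H₁.Adj v v₀
    | .inr _, .inl v => H₁.Adj v v₀
  symm := ⟨by
    rintro (v | v) (v' | v') h
    · exact H₁.adj_symm h
    · exact h
    · exact h
    · exact H₂.adj_symm h⟩
  loopless := ⟨by
    rintro (v | v) h
    · exact H₁.irrefl h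
    · exact H₂.irrefl h⟩

/-- `H` is (up to isomorphism) obtained from `H₁` and `H₂` by substitution. -/
def IsSubstitution {V V₁ V₂ : Type*} (H : SimpleGraph V) (H₁ : SimpleGraph V₁)
    (H₂ : SimpleGraph V₂) : Prop :=
  ∃ v₀ : V₁, Nonempty (H ≃g H₁.substitute v₀ H₂)

end SimpleGraph

/-! ### Probability mass functions -/

namespace PMF

/-! Let `G` be an `H`-free graph with `n` vertices, let `H₁` have `m + 1` vertices, and let `α` be
the independence number of `G`. Put `γ = ε₂ / 2`, `δ = γ / (2 (m + 1))`, `ε = δ ε₁ / 4`. A tuple of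
`m` vertices is a candidate for the position of `H₁ - v₀`. If every vertex of a nonempty set `W`
extends the same tuple to an induced copy of `H₁`, in the role of `v₀`, then an induced `H₂` inside
`W` would form an induced `H` together with the tuple. Hence `W` induces an `H₂`-free graph
(`isFreeOf_of_copy`), and the algorithm for `H₂` applies to it.

Run through all tuples and remove the set of extensions whenever at least `k ≈ n ^ (1 - γ)` of them
remain. At most `n ^ γ` sets are removed, and the remaining set `U` contains at most `n ^ m * k`
copies of `H₁` (`stripped`, `card_copies_le`). If `α ≤ n ^ (1 - ε)`, a single vertex is good enough.
If some removed `W` has an independent set of size at least `n ^ (ε - ε₂) α`, the algorithm for `H₂`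
on `W` is good enough. Otherwise the removed sets contain at most `n ^ (γ + ε - ε₂) α ≤ α / 2`
vertices of a maximum independent set, so half of it survives in `U`; call this half `I`.

In the last case every vertex of `U` is kept with probability `q ≈ n ^ (δ - 1)`. The expected number
of surviving copies is of order `n ^ (-γ / 2)`. By Markov and Chebyshev (`one_sub_le_sum_weight`)
the sample is, with high probability, `H₁`-free, has at most about `n ^ (δ + ε)` vertices, and
contains at least `q |I| / 2` vertices of `I`. On so small a graph the algorithm for `H₁` saves a
factor of about `n ^ (δ ε₁)` over the trivial ratio, which outweighs the loss from sampling.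

Neither `k` nor `q` has to be computed: `search` tries all thresholds up to `n` and all rates `2⁻¹ ^
i` with `1 ≤ i ≤ n`, checks the candidates for independence and keeps the best. Since the given
algorithms are only known to halt on free graphs, every call has to be legitimate, even for useless
`k` and `q`: removed sets are always `H₂`-free, and a sample is passed on only after an exhaustive
test for copies of `H₁`.

Polynomial time is obtained by writing the algorithm in the language `Kl`, whose compiler comes with
a polynomial step count (`correct`, `exists_prog`), and by closure properties of `PolyFun` and
`PolyRand`. Loops treat only the first `n ^ e` entries of a list; for the lists that occur on
genuine inputs, this cuts off nothing. -/

theorem bind_congr_support {α β : Type*} {p : PMF α} {f g : α → PMF β}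
    (h : ∀ a ∈ p.support, f a = g a) : p.bind f = p.bind g := by
  ext b
  rw [bind_apply, bind_apply]
  refine tsum_congr fun a => ?_
  by_cases ha : a ∈ p.support
  · rw [h a ha]
  · simp [(p.apply_eq_zero_iff a).2 ha]

theorem toOuterMeasure_le_one {α : Type*} (p : PMF α) (s : Set α) : p.toOuterMeasure s ≤ 1 := by
  exact (p.toOuterMeasure.mono (Set.subset_univ s)).trans
    ((p.toOuterMeasure_apply_eq_one_iff _).2 (Set.subset_univ _)).le

/-- If `q a` gives `s` probability at least `c` for every possible `a` in `t`, then `p.bind q` gives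
`s` probability at least `c` times the probability of `t`. -/
theorem mul_le_toOuterMeasure_bind {α β : Type*} (p : PMF α) (q : α → PMF β) (t : Set α) (s : Set β)
    (c : ENNReal) (h : ∀ a ∈ p.support, a ∈ t → c ≤ (q a).toOuterMeasure s) :
    p.toOuterMeasure t * c ≤ (p.bind q).toOuterMeasure s := by
  classical
  rw [toOuterMeasure_bind_apply, toOuterMeasure_apply, ← ENNReal.tsum_mul_right]
  refine ENNReal.tsum_le_tsum fun a => ?_
  by_cases hat : a ∈ t
  · rw [Set.indicator_of_mem hat]
    by_cases ha : a ∈ p.support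
    · exact mul_le_mul_right (h a ha hat) _
    · simp [(p.apply_eq_zero_iff a).2 ha]
  · simp [Set.indicator_of_notMem hat]

theorem le_toOuterMeasure_bind {α β : Type*} (p : PMF α) (q : α → PMF β) (s : Set β)
    (c : ENNReal) (h : ∀ a ∈ p.support, c ≤ (q a).toOuterMeasure s) :
    c ≤ (p.bind q).toOuterMeasure s := by
  have := mul_le_toOuterMeasure_bind p q Set.univ s c fun a ha _ => h a ha
  rwa [(p.toOuterMeasure_apply_eq_one_iff _).2 (Set.subset_univ _), one_mul] at this

theorem toOuterMeasure_eq_one {α : Type*} (p : PMF α) (s : Set α) (h : ∀ a ∈ p.support, a ∈ s) :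
    p.toOuterMeasure s = 1 :=
  (p.toOuterMeasure_apply_eq_one_iff s).2 h

end PMF

/-! ### Runs of programs -/

namespace Config

theorem run_succ (t : ℕ) (c : Config) : run (t + 1) c = (step c).bind (run t) := rfl

theorem run_halted (t : ℕ) (s : Store) : run t ⟨[], s⟩ = PMF.pure ⟨[], s⟩ := by
  induction t with
  | zero => rfl
  | succ t ih => rw [run_succ, step, PMF.pure_bind, ih]

theorem run_of_halted (t : ℕ) {c : Config} (h : c.Halted) : run t c = PMF.pure c := by
  obtain ⟨l, s⟩ := c
  obtain rfl : l = [] := h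
  exact run_halted t s

theorem run_add (a b : ℕ) (c : Config) : run (a + b) c = (run a c).bind (run b) := by
  induction a generalizing c with
  | zero => rw [Nat.zero_add, run, PMF.pure_bind]
  | succ a ih =>
    rw [Nat.succ_add, run_succ, run_succ, PMF.bind_bind]
    congr 1
    funext d
    exact ih d

theorem run_eq_of_halted {a b : ℕ} (hab : a ≤ b) {c : Config}
    (h : ∀ d ∈ (run a c).support, d.Halted) : run b c = run a c := by
  obtain ⟨k, rfl⟩ := Nat.exists_eq_add_of_le hab
  rw [run_add, PMF.bind_congr_support (g := PMF.pure) fun d hd => run_of_halted k (h d hd),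
    PMF.bind_pure]

/-- Halted configurations are fixed by every step, so probability that has reached `s` never leaves
it. -/
theorem toOuterMeasure_run_mono {a b : ℕ} (hab : a ≤ b) (c : Config) (s : Set Config)
    (hs : ∀ d ∈ s, d.Halted) : (run a c).toOuterMeasure s ≤ (run b c).toOuterMeasure s := by
  obtain ⟨k, rfl⟩ := Nat.exists_eq_add_of_le hab
  rw [run_add]
  have := PMF.mul_le_toOuterMeasure_bind (run a c) (run k) s s 1 fun d _ hd => by
    rw [run_of_halted k (hs d hd), PMF.toOuterMeasure_eq_one]
    intro x hx
    rw [PMF.support_pure, Set.mem_singleton_iff] at hx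
    exact hx ▸ hd
  rwa [mul_one] at this

/-- The approximation guarantee refers to an unspecified time `t`; this moves it to the time bound
of the program. -/
theorem toOuterMeasure_run_le_of_halted {a : ℕ} (t : ℕ) {c : Config}
    (h : ∀ d ∈ (run a c).support, d.Halted) (s : Set Config) (hs : ∀ d ∈ s, d.Halted) :
    (run t c).toOuterMeasure s ≤ (run a c).toOuterMeasure s := by
  rcases le_total t a with hta | hat
  · exact toOuterMeasure_run_mono hta c s hs
  · rw [run_eq_of_halted hat h]

/-- The visible result: variable `0` of a halted configuration. -/
def result (c : Config) : Option Data :=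
  match c.todo with
  | [] => some (c.store 0)
  | _ :: _ => none

/-- From time `T` on, the visible result of a run from `c` has the distribution `ν`. -/
def Eventually (c : Config) (T : ℕ) (ν : PMF (Option Data)) : Prop :=
  ∀ t, T ≤ t → (run t c).map result = ν

/-! ### Backward execution rules for programs -/

namespace Eventually

variable {k : List Prog} {s : Store} {T : ℕ} {ν : PMF (Option Data)}

theorem mono {c : Config} {T' : ℕ} (h : Eventually c T ν) (hT : T ≤ T') : Eventually c T' ν :=
  fun t ht => h t (hT.trans ht)

/-- Programs are verified backwards, with an arbitrary rest of the stack as continuation: a time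
bound and a final distribution after an instruction yield those before it. Intermediate
distributions never have to be described. -/
theorem of_step {c : Config} {α : Type} {p : PMF α} {f : α → Config}
    {μ : α → PMF (Option Data)} (hc : step c = p.map f) (h : ∀ a, Eventually (f a) T (μ a)) :
    Eventually c (T + 1) (p.bind μ) := by
  intro t ht
  obtain ⟨t, rfl⟩ : ∃ u, t = u + 1 := ⟨t - 1, by omega⟩
  rw [run_succ, PMF.map_bind, hc, PMF.bind_map]
  congr 1
  funext a
  exact h a t (by omega)

theorem of_step_pure {c c' : Config} (hc : step c = PMF.pure c') (h : Eventually c' T ν) :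
    Eventually c (T + 1) ν := by
  intro t ht
  obtain ⟨t, rfl⟩ : ∃ u, t = u + 1 := ⟨t - 1, by omega⟩
  rw [run_succ, hc, PMF.pure_bind]
  exact h t (by omega)

theorem halted : Eventually ⟨[], s⟩ 0 (PMF.pure (some (s 0))) := by
  intro t _
  rw [run_halted, PMF.pure_map]
  rfl

theorem assign {x : ℕ} {e : Expr} (h : Eventually ⟨k, Function.update s x (e.eval s)⟩ T ν) :
    Eventually ⟨.assign x e :: k, s⟩ (T + 1) ν :=
  of_step_pure rfl h

theorem toss {x : ℕ} {μ : Bool → PMF (Option Data)}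
    (h : ∀ b, Eventually ⟨k, Function.update s x (Data.ofBool b)⟩ T (μ b)) :
    Eventually ⟨.toss x :: k, s⟩ (T + 1) ((PMF.uniformOfFintype Bool).bind μ) :=
  of_step rfl h

theorem seq {p q : Prog} (h : Eventually ⟨p :: q :: k, s⟩ T ν) :
    Eventually ⟨.seq p q :: k, s⟩ (T + 1) ν :=
  of_step_pure rfl h

theorem ite_true {x : ℕ} {p q : Prog} (hx : s x ≠ Data.nil) (h : Eventually ⟨p :: k, s⟩ T ν) :
    Eventually ⟨.ite x p q :: k, s⟩ (T + 1) ν :=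
  of_step_pure (by rw [step, if_pos hx]) h

theorem ite_false {x : ℕ} {p q : Prog} (hx : s x = Data.nil) (h : Eventually ⟨q :: k, s⟩ T ν) :
    Eventually ⟨.ite x p q :: k, s⟩ (T + 1) ν :=
  of_step_pure (by rw [step, if_neg (not_not.2 hx)]) h

theorem while_true {x : ℕ} {p : Prog} (hx : s x ≠ Data.nil)
    (h : Eventually ⟨p :: .while x p :: k, s⟩ T ν) :
    Eventually ⟨.while x p :: k, s⟩ (T + 1) ν :=
  of_step_pure (by rw [step, if_pos hx]) h

theorem while_false {x : ℕ} {p : Prog} (hx : s x = Data.nil) (h : Eventually ⟨k, s⟩ T ν) :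
    Eventually ⟨.while x p :: k, s⟩ (T + 1) ν :=
  of_step_pure (by rw [step, if_neg (not_not.2 hx)]) h

/-- The visible result determines that all runs have halted, and the distribution of variable `0`. -/
theorem halted_of_eq_map_some {c : Config} {D : PMF Data} (h : Eventually c T (D.map some)) :
    ∀ d ∈ (run T c).support, d.Halted := by
  intro d hd
  have h1 : result d ∈ ((run T c).map result).support :=
    (PMF.mem_support_map_iff _ _ _).2 ⟨d, hd, rfl⟩
  rw [h T le_rfl] at h1
  obtain ⟨x, -, hx⟩ := (PMF.mem_support_map_iff _ _ _).1 h1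
  obtain ⟨l, s⟩ := d
  cases l with
  | nil => rfl
  | cons p l => simp [result] at hx

theorem toOuterMeasure_eq {c : Config} {D : PMF Data} (h : Eventually c T (D.map some))
    (A : Set Data) :
    (run T c).toOuterMeasure {d | d.Halted ∧ d.store 0 ∈ A} = D.toOuterMeasure A := by
  have h1 := h T le_rfl
  have h2 : ((run T c).map result).toOuterMeasure (some '' A) = D.toOuterMeasure A := by
    rw [h1, PMF.toOuterMeasure_map_apply, Set.preimage_image_eq _ (Option.some_injective _)]
  rw [← h2, PMF.toOuterMeasure_map_apply]
  congr 1
  ext ⟨l, s⟩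
  cases l with
  | nil => simp [result, Halted]
  | cons p l => simp [result, Halted]

end Eventually

end Config

/-! ### Running a program on the odd variables -/

/-- The expression with its variables renumbered to the odd numbers. -/
def Expr.odd : Expr → Expr
  | var x => var (2 * x + 1)
  | nil => nil
  | cons a b => cons a.odd b.odd
  | hd a => hd a.odd
  | tl a => tl a.odd

theorem Expr.eval_odd {s σ : Store} (h : ∀ x, s (2 * x + 1) = σ x) (e : Expr) :
    e.odd.eval s = e.eval σ := by
  induction e with
  | var x => exact h x
  | nil => rfl
  | cons a b iha ihb => rw [odd, eval, eval, iha, ihb]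
  | hd a ih => rw [odd, eval, eval, ih]
  | tl a ih => rw [odd, eval, eval, ih]

namespace Prog

/-- The program with its variables renumbered to the odd numbers. -/
def odd : Prog → Prog
  | assign x e => assign (2 * x + 1) e.odd
  | toss x => toss (2 * x + 1)
  | seq p q => seq p.odd q.odd
  | ite x p q => ite (2 * x + 1) p.odd q.odd
  | .while x p => .while (2 * x + 1) p.odd

/-- All variables to which the program writes are less than `N`. -/
def WritesBelow (N : ℕ) : Prog → Prop
  | assign x _ => x < N
  | toss x => x < N
  | seq p q => p.WritesBelow N ∧ q.WritesBelow N
  | ite _ p q => p.WritesBelow N ∧ q.WritesBelow N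
  | .while _ p => p.WritesBelow N

theorem WritesBelow.mono {M N : ℕ} (h : M ≤ N) {p : Prog} (hp : p.WritesBelow M) :
    p.WritesBelow N := by
  induction p with
  | assign x e => exact lt_of_lt_of_le hp h
  | toss x => exact lt_of_lt_of_le hp h
  | seq p q ihp ihq => exact ⟨ihp hp.1, ihq hp.2⟩
  | ite x p q ihp ihq => exact ⟨ihp hp.1, ihq hp.2⟩
  | _ x p ih => exact ih hp

theorem exists_writesBelow (p : Prog) : ∃ N, 0 < N ∧ p.WritesBelow N := by
  induction p with
  | assign x e => exact ⟨x + 1, x.succ_pos, x.lt_succ_self⟩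
  | toss x => exact ⟨x + 1, x.succ_pos, x.lt_succ_self⟩
  | seq p q ihp ihq =>
    obtain ⟨M, hM, hp⟩ := ihp
    obtain ⟨N, hN, hq⟩ := ihq
    exact ⟨max M N, lt_max_of_lt_left hM, hp.mono (le_max_left _ _), hq.mono (le_max_right _ _)⟩
  | ite x p q ihp ihq =>
    obtain ⟨M, hM, hp⟩ := ihp
    obtain ⟨N, hN, hq⟩ := ihq
    exact ⟨max M N, lt_max_of_lt_left hM, hp.mono (le_max_left _ _), hq.mono (le_max_right _ _)⟩
  | _ x p ih => exact ih

end Prog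

/-- Beyond the first `N` odd variables, all odd variables are empty. -/
def Store.OddEmptyFrom (N : ℕ) (s : Store) : Prop := ∀ x, N ≤ x → s (2 * x + 1) = Data.nil

theorem odd_update {s σ : Store} (h : ∀ x, s (2 * x + 1) = σ x) (y : ℕ) (d : Data) (x : ℕ) :
    Function.update s (2 * y + 1) d (2 * x + 1) = Function.update σ y d x := by
  by_cases hxy : x = y
  · subst hxy; simp
  · rw [Function.update_of_ne (by omega), Function.update_of_ne hxy, h]

/-- The renamed program on the odd variables and the original on `σ` run in lockstep, one step for
one step. The bound `N` on the variables written ensures that finitely many assignments clean up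
before the next call. Through `A` the continuation learns that the output is a possible one. -/
theorem Config.Eventually.odd {N : ℕ} {e : ℕ → Data} {k : List Prog} {T₂ : ℕ}
    {ν : Data → PMF (Option Data)} {A : Set Data}
    (hk : ∀ s : Store, (∀ x, s (2 * x) = e x) → s.OddEmptyFrom N → s 1 ∈ A →
      Eventually ⟨k, s⟩ T₂ (ν (s 1)))
    (T : ℕ) : ∀ (l : List Prog) (σ s : Store), (∀ p ∈ l, p.WritesBelow N) →
      (∀ c ∈ (run T ⟨l, σ⟩).support, c.Halted ∧ c.store 0 ∈ A) → (∀ x, s (2 * x + 1) = σ x) →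
      (∀ x, s (2 * x) = e x) → s.OddEmptyFrom N →
      Eventually ⟨l.map Prog.odd ++ k, s⟩ (T + T₂) ((run T ⟨l, σ⟩).bind fun c => ν (c.store 0)) := by
  induction T with
  | zero =>
    intro l σ s hl hT hσ he hN
    obtain ⟨hl0, hA⟩ := hT ⟨l, σ⟩ (by simp [run])
    obtain rfl : l = [] := hl0
    rw [run, PMF.pure_bind]
    have := hk s he hN (by rw [show s 1 = σ 0 from hσ 0]; exact hA)
    rw [show s 1 = σ 0 from hσ 0] at this
    simpa using this
  | succ T ih =>
    intro l σ s hl hT hσ he hN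
    have key : ∀ x d, x < N → (∀ y, Function.update s (2 * x + 1) d (2 * y) = e y) ∧
        Store.OddEmptyFrom N (Function.update s (2 * x + 1) d) := by
      intro x d hx
      refine ⟨fun y => ?_, fun y hy => ?_⟩
      · rw [Function.update_of_ne (by omega), he]
      · rw [Function.update_of_ne (by omega), hN y hy]
    cases l with
    | nil =>
      rw [run_halted] at hT ⊢
      rw [PMF.pure_bind]
      have := hk s he hN (by rw [show s 1 = σ 0 from hσ 0]; exact (hT ⟨[], σ⟩ (by simp)).2)
      rw [show s 1 = σ 0 from hσ 0] at this
      -- The simulated run has stopped early; the unused steps are slack in the time bound.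
      exact this.mono (by omega)
    | cons p l =>
      have hp := hl p (by simp)
      have hl' : ∀ p ∈ l, p.WritesBelow N := fun p hp => hl p (by simp [hp])
      rw [run_succ] at hT ⊢
      rw [show T + 1 + T₂ = T + T₂ + 1 by omega]
      cases p with
      | assign x e =>
        rw [step, PMF.pure_bind] at hT ⊢
        refine Eventually.assign (ih _ _ _ hl' hT ?_ (key _ _ hp).1 (key _ _ hp).2)
        rw [Expr.eval_odd hσ]
        exact odd_update hσ _ _
      | toss x =>
        rw [step, PMF.bind_map] at hT ⊢
        rw [PMF.bind_bind]
        refine Eventually.toss fun b => ih _ _ _ hl' ?_ (odd_update hσ _ _) (key _ _ hp).1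
          (key _ _ hp).2
        intro c hc
        exact hT c ((PMF.mem_support_bind_iff _ _ _).2 ⟨b, by simp, hc⟩)
      | seq p q =>
        rw [step, PMF.pure_bind] at hT ⊢
        refine Eventually.seq (ih (p :: q :: l) _ _ ?_ hT hσ he hN)
        intro r hr
        rcases List.mem_cons.1 hr with rfl | hr
        · exact hp.1
        rcases List.mem_cons.1 hr with rfl | hr
        · exact hp.2
        · exact hl' r hr
      | ite x p q =>
        rw [step, PMF.pure_bind] at hT ⊢
        by_cases hx : σ x = Data.nil
        · rw [if_neg (not_not.2 hx)] at hT ⊢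
          refine Eventually.ite_false ((hσ x).trans hx) (ih (q :: l) _ _ ?_ hT hσ he hN)
          intro r hr
          rcases List.mem_cons.1 hr with rfl | hr
          · exact hp.2
          · exact hl' r hr
        · rw [if_pos hx] at hT ⊢
          refine Eventually.ite_true (by rwa [hσ x]) (ih (p :: l) _ _ ?_ hT hσ he hN)
          intro r hr
          rcases List.mem_cons.1 hr with rfl | hr
          · exact hp.1
          · exact hl' r hr
      | _ x p =>
        rw [step, PMF.pure_bind] at hT ⊢
        by_cases hx : σ x = Data.nil
        · rw [if_neg (not_not.2 hx)] at hT ⊢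
          exact Eventually.while_false ((hσ x).trans hx) (ih l _ _ hl' hT hσ he hN)
        · rw [if_pos hx] at hT ⊢
          refine Eventually.while_true (by rwa [hσ x]) (ih (p :: .while x p :: l) _ _ ?_ hT hσ he hN)
          intro r hr
          rcases List.mem_cons.1 hr with rfl | hr
          · exact hp
          · exact hl r hr

/-! ### A point-free language for randomized functions on trees

Every function of this language is computed in a number of steps that is polynomial in the length
`n` of a ruler, since the only loop is the `n`-fold iteration. -/

/-- `m`-fold iteration of a randomized function. -/
noncomputable def PMF.iter {α : Type*} (f : α → PMF α) : ℕ → α → PMF α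
  | 0, a => PMF.pure a
  | m + 1, a => (f a).bind (PMF.iter f m)

/-- Randomized functions on trees: identity, constant `nil`, pairing, projections, composition,
branching on the first component, iteration as often as the ruler is long, coin toss,
and call of a program with a polynomial time bound. -/
inductive Kl : Type
  | id : Kl
  | nil : Kl
  | pair : Kl → Kl → Kl
  | hd : Kl
  | tl : Kl
  | comp : Kl → Kl → Kl
  | ite : Kl → Kl → Kl
  | iter : Kl → Kl
  | toss : Kl
  | call : Prog → Polynomial ℕ → Kl

namespace Kl

open Classical in
/-- The value, for a ruler of length `n`. -/
noncomputable def eval (n : ℕ) : Kl → Data → PMF Data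
  | id, d => PMF.pure d
  | nil, _ => PMF.pure Data.nil
  | pair f g, d => (f.eval n d).bind fun a => (g.eval n d).bind fun b => PMF.pure (Data.cons a b)
  | hd, d => PMF.pure d.hd
  | tl, d => PMF.pure d.tl
  | comp g f, d => (f.eval n d).bind (g.eval n)
  | ite f g, d => if d.hd ≠ Data.nil then f.eval n d.tl else g.eval n d.tl
  | iter f, d => PMF.iter (f.eval n) n d
  | toss, _ => (PMF.uniformOfFintype Bool).map Data.ofBool
  | call p T, d => (Config.run (T.eval n) (p.start d)).map fun c => c.store 0

/-- All calls that can occur in the evaluation halt within their time bounds. -/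
def Valid (n : ℕ) : Kl → Data → Prop
  | id, _ => True
  | nil, _ => True
  | pair f g, d => f.Valid n d ∧ g.Valid n d
  | hd, _ => True
  | tl, _ => True
  | comp g f, d => f.Valid n d ∧ ∀ a ∈ (f.eval n d).support, g.Valid n a
  | ite f g, d => (d.hd ≠ Data.nil → f.Valid n d.tl) ∧ (d.hd = Data.nil → g.Valid n d.tl)
  | iter f, d => ∀ m < n, ∀ a ∈ (PMF.iter (f.eval n) m d).support, f.Valid n a
  | toss, _ => True
  | call p T, d => ∀ c ∈ (Config.run (T.eval n) (p.start d)).support, c.Halted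

/-- All called programs write to variables below `N` only. -/
def CallsBelow (N : ℕ) : Kl → Prop
  | pair f g => f.CallsBelow N ∧ g.CallsBelow N
  | comp g f => g.CallsBelow N ∧ f.CallsBelow N
  | ite f g => f.CallsBelow N ∧ g.CallsBelow N
  | iter f => f.CallsBelow N
  | call p _ => 0 < N ∧ p.WritesBelow N
  | _ => True

theorem CallsBelow.mono {M N : ℕ} (h : M ≤ N) {c : Kl} (hc : c.CallsBelow M) : c.CallsBelow N := by
  induction c with
  | pair f g ihf ihg => exact ⟨ihf hc.1, ihg hc.2⟩
  | comp g f ihg ihf => exact ⟨ihg hc.1, ihf hc.2⟩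
  | ite f g ihf ihg => exact ⟨ihf hc.1, ihg hc.2⟩
  | iter f ih => exact ih hc
  | call p T => exact ⟨hc.1.trans_le h, hc.2.mono h⟩
  | _ => trivial

theorem exists_callsBelow (c : Kl) : ∃ N, c.CallsBelow N := by
  have two : ∀ f g : Kl, (∃ N, f.CallsBelow N) → (∃ N, g.CallsBelow N) →
      ∃ N, f.CallsBelow N ∧ g.CallsBelow N := by
    rintro f g ⟨M, hM⟩ ⟨N, hN⟩
    exact ⟨max M N, hM.mono (le_max_left _ _), hN.mono (le_max_right _ _)⟩
  induction c with
  | pair f g ihf ihg => exact two f g ihf ihg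
  | comp g f ihg ihf => exact two g f ihg ihf
  | ite f g ihf ihg => exact two f g ihf ihg
  | iter f ih => exact ih
  | call p T => exact p.exists_writesBelow
  | _ => exact ⟨0, trivial⟩

/-- Emptying the first `N` odd variables. -/
def clear : ℕ → Prog
  | 0 => .assign 1 .nil
  | N + 1 => .seq (.assign (2 * N + 1) .nil) (clear N)

/-- The program that replaces the value of variable `2 * r` by the value of the function. It does not
change the even variables below `2 * r`; the ruler is variable `2`. -/
def compile (N : ℕ) : Kl → ℕ → Prog
  | id, r => .assign (2 * r) (.var (2 * r))
  | nil, r => .assign (2 * r) .nil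
  | pair f g, r =>
      .seq (.assign (2 * (r + 1)) (.var (2 * r))) (.seq (f.compile N (r + 1))
        (.seq (.assign (2 * (r + 2)) (.var (2 * r))) (.seq (g.compile N (r + 2))
          (.assign (2 * r) (.cons (.var (2 * (r + 1))) (.var (2 * (r + 2))))))))
  | hd, r => .assign (2 * r) (.hd (.var (2 * r)))
  | tl, r => .assign (2 * r) (.tl (.var (2 * r)))
  | comp g f, r => .seq (f.compile N r) (g.compile N r)
  | ite f g, r =>
      .seq (.assign (2 * (r + 1)) (.hd (.var (2 * r)))) (.seq (.assign (2 * r) (.tl (.var (2 * r))))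
        (.ite (2 * (r + 1)) (f.compile N r) (g.compile N r)))
  | iter f, r =>
      .seq (.assign (2 * (r + 1)) (.var 2)) (.while (2 * (r + 1))
        (.seq (.assign (2 * (r + 1)) (.tl (.var (2 * (r + 1)))))
          (.seq (.assign (2 * (r + 2)) (.var (2 * r))) (.seq (f.compile N (r + 2))
            (.assign (2 * r) (.var (2 * (r + 2))))))))
  | toss, r => .toss (2 * r)
  | call p _, r =>
      .seq (clear N) (.seq (.assign 1 (.var (2 * r))) (.seq p.odd (.assign (2 * r) (.var 1))))

/-- A bound on the number of steps of the compiled program. -/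
noncomputable def cost (N : ℕ) : Kl → Polynomial ℕ
  | id => 1
  | nil => 1
  | pair f g => f.cost N + g.cost N + 7
  | hd => 1
  | tl => 1
  | comp g f => f.cost N + g.cost N + 1
  | ite f g => f.cost N + g.cost N + 5
  | iter f => Polynomial.X * (f.cost N + 7) + 3
  | toss => 1
  | call _ T => T + 2 * (N : Polynomial ℕ) + 6

/-- An earlier call may have left values in odd variables, but only in the first `N` of them.
Emptying one variable takes two steps, for `seq` and `assign`. -/
theorem eventually_clear {k : List Prog} {T : ℕ} {ν : PMF (Option Data)} (N : ℕ) :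
    ∀ s : Store, s.OddEmptyFrom N →
    (∀ s' : Store, (∀ x, s' (2 * x) = s (2 * x)) → (∀ x, s' (2 * x + 1) = Data.nil) →
      Config.Eventually ⟨k, s'⟩ T ν) →
    Config.Eventually ⟨clear N :: k, s⟩ (T + (2 * N + 1)) ν := by
  induction N with
  | zero =>
    intro s hs hk
    refine Config.Eventually.assign (hk _ (fun x => ?_) fun x => ?_)
    · rw [Function.update_of_ne (by omega)]
    · by_cases hx : 2 * x + 1 = 1
      · rw [hx, Function.update_self]; rfl
      · rw [Function.update_of_ne hx, hs x (Nat.zero_le _)]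
  | succ N ih =>
    intro s hs hk
    refine Config.Eventually.mono (Config.Eventually.seq (Config.Eventually.assign
      (ih _ (fun x hx => ?_) (fun s' h1 h2 => hk s' (fun x => ?_) h2)))) (by omega)
    · by_cases hxN : 2 * x + 1 = 2 * N + 1
      · rw [hxN, Function.update_self]; rfl
      · rw [Function.update_of_ne hxN]; exact hs x (by omega)
    · rw [h1, Function.update_of_ne (by omega)]

/-- A list structure with exactly `n` entries. -/
def IsRuler : ℕ → Data → Prop
  | 0, d => d = Data.nil
  | n + 1, d => d ≠ Data.nil ∧ IsRuler n d.tl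

theorem isRuler_ofList (l : List Data) : IsRuler l.length (Data.ofList l) := by
  induction l with
  | nil => rfl
  | cons a l ih => exact ⟨by simp [Data.ofList], ih⟩

/-- The two stores agree on the even variables below `2 * r`, and the second one has no values in odd
variables beyond the first `N`. -/
def Frame (N r : ℕ) (s s' : Store) : Prop :=
  (∀ j < r, s' (2 * j) = s (2 * j)) ∧ s'.OddEmptyFrom N

theorem Frame.trans {N r : ℕ} {s s' s'' : Store} (h : Frame N r s s') (h' : Frame N r s' s'') :
    Frame N r s s'' :=
  ⟨fun j hj => (h'.1 j hj).trans (h.1 j hj), h'.2⟩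

theorem Frame.weaken {N r r' : ℕ} {s s' : Store} (h : Frame N r' s s') (hr : r ≤ r') :
    Frame N r s s' :=
  ⟨fun j hj => h.1 j (hj.trans_le hr), h.2⟩

theorem Frame.update {N r x : ℕ} {s s' : Store} (h : Frame N r s s') (hx : r ≤ x) (d : Data) :
    Frame N r s (Function.update s' (2 * x) d) := by
  refine ⟨fun j hj => ?_, fun y hy => ?_⟩
  · rw [Function.update_of_ne (by omega), h.1 j hj]
  · rw [Function.update_of_ne (by omega), h.2 y hy]

theorem Frame.refl {N : ℕ} {s : Store} (h : s.OddEmptyFrom N) (r : ℕ) : Frame N r s s :=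
  ⟨fun _ _ => rfl, h⟩

/-- The compiled program, started in the store `s`, computes the function. -/
def Correct (N n : ℕ) (c : Kl) : Prop :=
  ∀ (r : ℕ) (s : Store), 2 ≤ r → IsRuler n (s 2) → s.OddEmptyFrom N → c.Valid n (s (2 * r)) →
    ∀ (k : List Prog) (T : ℕ) (ν : Data → PMF (Option Data)),
      (∀ s', Frame N r s s' → s' (2 * r) ∈ (c.eval n (s (2 * r))).support →
        Config.Eventually ⟨k, s'⟩ T (ν (s' (2 * r)))) →
      Config.Eventually ⟨c.compile N r :: k, s⟩ ((c.cost N).eval n + T)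
        ((c.eval n (s (2 * r))).bind ν)

theorem correct_assign {N n r : ℕ} {e : Expr} {s : Store} (hs : s.OddEmptyFrom N) {d : Data}
    (hd : e.eval s = d) {k : List Prog} {T : ℕ} {ν : Data → PMF (Option Data)}
    (hk : ∀ s', Frame N r s s' → s' (2 * r) ∈ (PMF.pure d).support →
        Config.Eventually ⟨k, s'⟩ T (ν (s' (2 * r)))) :
    Config.Eventually ⟨.assign (2 * r) e :: k, s⟩ (((1 : Polynomial ℕ).eval n) + T)
      ((PMF.pure d).bind ν) := by
  rw [Polynomial.eval_one, Nat.add_comm, PMF.pure_bind]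
  refine Config.Eventually.assign ?_
  have := hk (Function.update s (2 * r) d) ((Frame.refl hs r).update le_rfl d) (by simp)
  rw [Function.update_self] at this
  rwa [hd]

theorem correct_pair {N n : ℕ} {f g : Kl} (hf : f.Correct N n) (hg : g.Correct N n) :
    (pair f g).Correct N n := by
  intro r s hr hR hs hV k T ν hk
  rw [compile, cost, eval, PMF.bind_bind]
  simp only [PMF.bind_bind, PMF.pure_bind]
  simp only [Polynomial.eval_add, Polynomial.eval_ofNat]
  set s₁ := Function.update s (2 * (r + 1)) (s (2 * r)) with hs₁
  have e₁ : s₁ (2 * (r + 1)) = s (2 * r) := Function.update_self _ _ _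
  have F₁ : Frame N (r + 1) s s₁ := (Frame.refl hs _).update le_rfl _
  have h := hf (r + 1) s₁ (by omega) (by rw [F₁.1 1 (by omega)]; exact hR) F₁.2
    (by rw [e₁]; exact hV.1)
    (.seq (.assign (2 * (r + 2)) (.var (2 * r))) (.seq (g.compile N (r + 2))
          (.assign (2 * r) (.cons (.var (2 * (r + 1))) (.var (2 * (r + 2)))))) :: k)
    ((g.cost N).eval n + (T + 4))
    -- Once the first component has the value `a`, the remaining distribution still depends on the
    -- original argument, which stays in slot `r`.
    (fun a => (g.eval n (s (2 * r))).bind fun b => ν (Data.cons a b)) ?_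
  · rw [e₁] at h
    exact (Config.Eventually.seq (Config.Eventually.assign (Config.Eventually.seq h))).mono (by omega)
  intro s₂ F₂ m₂
  rw [e₁] at m₂
  have F₂' := F₁.trans F₂
  have e₂ : s₂ (2 * r) = s (2 * r) := F₂'.1 r (by omega)
  set s₃ := Function.update s₂ (2 * (r + 2)) (s₂ (2 * r)) with hs₃
  have F₃ : Frame N (r + 2) s₂ s₃ := (Frame.refl F₂.2 _).update le_rfl _
  have e₃ : s₃ (2 * (r + 2)) = s (2 * r) := by rw [hs₃, Function.update_self, e₂]
  have h := hg (r + 2) s₃ (by omega) (by rw [F₃.1 1 (by omega), F₂'.1 1 (by omega)]; exact hR)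
    F₃.2 (by rw [e₃]; exact hV.2)
    (.assign (2 * r) (.cons (.var (2 * (r + 1))) (.var (2 * (r + 2)))) :: k) (T + 1)
    (fun b => ν (Data.cons (s₂ (2 * (r + 1))) b)) ?_
  · rw [e₃] at h
    exact (Config.Eventually.seq (Config.Eventually.assign (Config.Eventually.seq h))).mono (by omega)
  intro s₄ F₄ m₄
  rw [e₃] at m₄
  refine Config.Eventually.assign ?_
  have F₄' := F₃.trans F₄
  have := hk (Function.update s₄ (2 * r) ((Expr.cons (.var (2 * (r + 1))) (.var (2 * (r + 2)))).eval s₄))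
    (((F₂'.weaken (by omega)).trans (F₄'.weaken (by omega))).update le_rfl _) ?_
  · rw [Function.update_self, Expr.eval, Expr.eval, Expr.eval, F₄'.1 (r + 1) (by omega)] at this
    rwa [Expr.eval, Expr.eval, Expr.eval, F₄'.1 (r + 1) (by omega)]
  · rw [Function.update_self, eval, PMF.mem_support_bind_iff]
    refine ⟨_, m₂, ?_⟩
    rw [PMF.mem_support_bind_iff]
    refine ⟨_, m₄, ?_⟩
    rw [Expr.eval, Expr.eval, Expr.eval, F₄'.1 (r + 1) (by omega)]
    simp

theorem correct_comp {N n : ℕ} {f g : Kl} (hf : f.Correct N n) (hg : g.Correct N n) :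
    (comp g f).Correct N n := by
  intro r s hr hR hs hV k T ν hk
  rw [compile, cost, eval, PMF.bind_bind]
  simp only [Polynomial.eval_add, Polynomial.eval_one]
  have h := hf r s hr hR hs hV.1 (g.compile N r :: k) ((g.cost N).eval n + T)
    (fun a => (g.eval n a).bind ν) ?_
  · exact (Config.Eventually.seq h).mono (by omega)
  intro s' F m
  refine hg r s' hr (by rw [F.1 1 (by omega)]; exact hR) F.2 (hV.2 _ m) k T ν fun s'' F' m' => ?_
  refine hk s'' (F.trans F') ?_
  rw [eval, PMF.mem_support_bind_iff]
  exact ⟨_, m, m'⟩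

theorem correct_ite {N n : ℕ} {f g : Kl} (hf : f.Correct N n) (hg : g.Correct N n) :
    (ite f g).Correct N n := by
  intro r s hr hR hs hV k T ν hk
  rw [compile, cost, eval]
  simp only [Polynomial.eval_add, Polynomial.eval_ofNat]
  set s₁ := Function.update s (2 * (r + 1)) (s (2 * r)).hd with hs₁
  set s₂ := Function.update s₁ (2 * r) (s (2 * r)).tl with hs₂
  have F₁ : Frame N (r + 1) s s₁ := (Frame.refl hs _).update le_rfl _
  have F₂ : Frame N r s s₂ := (F₁.weaken (by omega)).update le_rfl _
  have e₂ : s₂ (2 * r) = (s (2 * r)).tl := Function.update_self _ _ _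
  have e₂' : s₂ (2 * (r + 1)) = (s (2 * r)).hd := by
    rw [hs₂, Function.update_of_ne (by omega), hs₁, Function.update_self]
  have hR₂ : IsRuler n (s₂ 2) := by rw [F₂.1 1 (by omega)]; exact hR
  have e₁ : (Expr.tl (.var (2 * r))).eval s₁ = (s (2 * r)).tl := by
    rw [Expr.eval, Expr.eval, F₁.1 r (by omega)]
  by_cases hd : (s (2 * r)).hd = Data.nil
  · rw [if_neg (not_not.2 hd)]
    have h := hg r s₂ hr hR₂ F₂.2 (by rw [e₂]; exact hV.2 hd) k T ν fun s' F m =>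
      hk s' (F₂.trans F) (by rw [eval, if_neg (not_not.2 hd), ← e₂]; exact m)
    rw [e₂] at h
    refine (Config.Eventually.seq (Config.Eventually.assign (Config.Eventually.seq
      (Config.Eventually.assign (Config.Eventually.ite_false ?_ ?_))))).mono
      (T := (g.cost N).eval n + T + 1 + 1 + 1 + 1 + 1) (by omega)
    · change Function.update s₁ _ ((Expr.tl (.var (2 * r))).eval s₁) _ = _
      rw [e₁, ← hd]; exact e₂'
    · change Config.Eventually ⟨_, Function.update s₁ _ ((Expr.tl (.var (2 * r))).eval s₁)⟩ _ _
      rw [e₁]; exact h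
  · rw [if_pos hd]
    have h := hf r s₂ hr hR₂ F₂.2 (by rw [e₂]; exact hV.1 hd) k T ν fun s' F m =>
      hk s' (F₂.trans F) (by rw [eval, if_pos hd, ← e₂]; exact m)
    rw [e₂] at h
    refine (Config.Eventually.seq (Config.Eventually.assign (Config.Eventually.seq
      (Config.Eventually.assign (Config.Eventually.ite_true ?_ ?_))))).mono
      (T := (f.cost N).eval n + T + 1 + 1 + 1 + 1 + 1) (by omega)
    · change Function.update s₁ _ ((Expr.tl (.var (2 * r))).eval s₁) _ ≠ _
      rw [e₁]; exact e₂'.trans_ne hd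
    · change Config.Eventually ⟨_, Function.update s₁ _ ((Expr.tl (.var (2 * r))).eval s₁)⟩ _ _
      rw [e₁]; exact h

theorem correct_iter {N n : ℕ} {f : Kl} (hf : f.Correct N n) : (iter f).Correct N n := by
  intro r s hr hR hs hV k T ν hk
  rw [compile, cost, eval]
  simp only [Polynomial.eval_add, Polynomial.eval_mul, Polynomial.eval_X, Polynomial.eval_ofNat]
  -- Loop invariant: `m` is the number of entries left on the counter. A round costs seven steps
  -- besides the body, and the last, failing test costs one.
  suffices H : ∀ (m : ℕ) (s₁ : Store), Frame N r s s₁ → IsRuler m (s₁ (2 * (r + 1))) →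
      (∀ i < m, ∀ a ∈ (PMF.iter (f.eval n) i (s₁ (2 * r))).support, f.Valid n a) →
      (∀ s', Frame N r s s' → s' (2 * r) ∈ (PMF.iter (f.eval n) m (s₁ (2 * r))).support →
        Config.Eventually ⟨k, s'⟩ T (ν (s' (2 * r)))) →
      Config.Eventually ⟨.while (2 * (r + 1))
        (.seq (.assign (2 * (r + 1)) (.tl (.var (2 * (r + 1)))))
          (.seq (.assign (2 * (r + 2)) (.var (2 * r))) (.seq (f.compile N (r + 2))
            (.assign (2 * r) (.var (2 * (r + 2))))))) :: k, s₁⟩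
        (m * ((f.cost N).eval n + 7) + (T + 1))
        ((PMF.iter (f.eval n) m (s₁ (2 * r))).bind ν) by
    have F₁ : Frame N (r + 1) s (Function.update s (2 * (r + 1)) (s 2)) :=
      (Frame.refl hs _).update le_rfl _
    have e₁ := F₁.1 r (by omega)
    have h := H n _ (F₁.weaken (by omega)) (by rw [Function.update_self]; exact hR)
      (by rw [e₁]; exact hV) (by rw [e₁]; exact hk)
    rw [e₁] at h
    exact (Config.Eventually.seq (Config.Eventually.assign h)).mono (by omega)
  intro m
  induction m with
  | zero =>
    intro s₁ F₁ hz _ hk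
    rw [PMF.iter, PMF.pure_bind]
    exact (Config.Eventually.while_false hz (hk s₁ F₁ (by simp [PMF.iter]))).mono (by omega)
  | succ m ih =>
    intro s₁ F₁ hz hV' hk
    rw [PMF.iter, PMF.bind_bind]
    set s₂ := Function.update s₁ (2 * (r + 1)) (s₁ (2 * (r + 1))).tl with hs₂
    have F₂ : Frame N (r + 1) s₁ s₂ := (Frame.refl F₁.2 _).update le_rfl _
    set s₃ := Function.update s₂ (2 * (r + 2)) (s₂ (2 * r)) with hs₃
    have F₃ : Frame N (r + 2) s₂ s₃ := (Frame.refl F₂.2 _).update le_rfl _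
    have e₃ : s₃ (2 * (r + 2)) = s₁ (2 * r) := by
      rw [hs₃, Function.update_self, F₂.1 r (by omega)]
    have hR₃ : IsRuler n (s₃ 2) := by
      rw [F₃.1 1 (by omega), F₂.1 1 (by omega), F₁.1 1 (by omega)]; exact hR
    have h := hf (r + 2) s₃ (by omega) hR₃ F₃.2
      (by rw [e₃]; exact hV' 0 (by omega) _ (by simp [PMF.iter]))
      (.assign (2 * r) (.var (2 * (r + 2))) :: .while (2 * (r + 1))
        (.seq (.assign (2 * (r + 1)) (.tl (.var (2 * (r + 1)))))
          (.seq (.assign (2 * (r + 2)) (.var (2 * r))) (.seq (f.compile N (r + 2))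
            (.assign (2 * r) (.var (2 * (r + 2))))))) :: k)
      (m * ((f.cost N).eval n + 7) + (T + 1) + 1)
      (fun a => (PMF.iter (f.eval n) m a).bind ν) ?_
    · rw [e₃] at h
      refine (Config.Eventually.while_true hz.1 (Config.Eventually.seq (Config.Eventually.assign
        (Config.Eventually.seq (Config.Eventually.assign (Config.Eventually.seq h)))))).mono ?_
      rw [Nat.succ_mul]
      omega
    intro s₄ F₄ m₄
    rw [e₃] at m₄
    refine Config.Eventually.assign ?_
    set s₅ := Function.update s₄ (2 * r) (s₄ (2 * (r + 2))) with hs₅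
    have F₄' : Frame N (r + 2) s₂ s₄ := F₃.trans F₄
    have F₅ : Frame N r s s₅ := ((F₁.trans (F₂.weaken (by omega))).trans
      (F₄'.weaken (by omega))).update le_rfl _
    have e₅ : s₅ (2 * r) = s₄ (2 * (r + 2)) := Function.update_self _ _ _
    have e₅' : s₅ (2 * (r + 1)) = (s₁ (2 * (r + 1))).tl := by
      rw [hs₅, Function.update_of_ne (by omega), F₄'.1 (r + 1) (by omega), hs₂,
        Function.update_self]
    have := ih s₅ F₅ (by rw [e₅']; exact hz.2) (fun i hi a ha => hV' (i + 1) (by omega) a ?_)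
      fun s' F' m' => hk s' F' ?_
    · rw [e₅] at this
      exact this
    · rw [PMF.iter, PMF.mem_support_bind_iff]
      exact ⟨_, m₄, e₅ ▸ ha⟩
    · rw [PMF.iter, PMF.mem_support_bind_iff]
      exact ⟨_, m₄, e₅ ▸ m'⟩

theorem correct_toss {N n : ℕ} : toss.Correct N n := by
  intro r s hr hR hs hV k T ν hk
  rw [compile, cost, eval, PMF.bind_map, Polynomial.eval_one, Nat.add_comm]
  refine Config.Eventually.toss fun b => ?_
  have := hk (Function.update s (2 * r) (Data.ofBool b)) ((Frame.refl hs r).update le_rfl _)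
    (by rw [Function.update_self, eval, PMF.mem_support_map_iff]; exact ⟨b, by simp, rfl⟩)
  rwa [Function.update_self] at this

/-- A called program expects the store of `Prog.start`. Clearing the odd variables and copying the
argument to variable `1` provides this store in renamed form. -/
theorem correct_call {N n : ℕ} {p : Prog} {P : Polynomial ℕ} (hN : 0 < N) (hp : p.WritesBelow N) :
    (call p P).Correct N n := by
  intro r s hr hR hs hV k T ν hk
  rw [compile, cost, eval, PMF.bind_map]
  simp only [Polynomial.eval_add, Polynomial.eval_mul, Polynomial.eval_ofNat,
    Polynomial.eval_natCast]
  refine (Config.Eventually.seq (T := P.eval n + T + 4 + (2 * N + 1))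
    (eventually_clear N s hs fun s₁ h₁ h₁' => ?_)).mono (by simp only [Nat.cast_id]; omega)
  refine (Config.Eventually.seq (T := P.eval n + T + 3) (Config.Eventually.assign
    (T := P.eval n + T + 2) (Config.Eventually.seq (T := P.eval n + (T + 1)) ?_)))
  have key := Config.Eventually.odd (N := N) (e := fun x => s (2 * x))
    (k := .assign (2 * r) (.var 1) :: k) (T₂ := T + 1) (ν := ν)
    -- Later calls have to be valid only for outputs of positive probability, so membership in the
    -- support is carried along.
    (A := {d | d ∈ ((call p P).eval n (s (2 * r))).support}) ?_ (P.eval n) [p]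
    (Function.update (fun _ => Data.nil) 0 (s (2 * r))) (Function.update s₁ 1 (s (2 * r)))
    (by simpa using hp) ?_ ?_ ?_ ?_
  · rw [← h₁ r] at key ⊢
    exact key
  · intro s' he hN' hA
    refine Config.Eventually.assign ?_
    have F : Frame N r s s' := ⟨fun j _ => he j, hN'⟩
    have := hk _ (F.update le_rfl (s' 1)) (by rw [Function.update_self]; exact hA)
    rwa [Function.update_self] at this
  · intro c hc
    refine ⟨hV c hc, ?_⟩
    rw [Set.mem_ofPred_eq, eval, PMF.mem_support_map_iff]
    exact ⟨c, hc, rfl⟩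
  · exact odd_update (s := s₁) (σ := fun _ => Data.nil) h₁' 0 _
  · intro x
    rw [Function.update_of_ne (by omega), h₁]
  · intro x hx
    rw [Function.update_of_ne (by omega), h₁']

theorem correct {N n : ℕ} {c : Kl} (hc : c.CallsBelow N) : c.Correct N n := by
  induction c with
  | id => exact fun r s _ _ hs _ k T ν hk => correct_assign hs rfl hk
  | nil => exact fun r s _ _ hs _ k T ν hk => correct_assign hs rfl hk
  | pair f g ihf ihg => exact correct_pair (ihf hc.1) (ihg hc.2)
  | hd => exact fun r s _ _ hs _ k T ν hk => correct_assign hs rfl hk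
  | tl => exact fun r s _ _ hs _ k T ν hk => correct_assign hs rfl hk
  | comp g f ihg ihf => exact correct_comp (ihf hc.2) (ihg hc.1)
  | ite f g ihf ihg => exact correct_ite (ihf hc.1) (ihg hc.2)
  | iter f ih => exact correct_iter (ih hc)
  | toss => exact correct_toss
  | call p T => exact correct_call hc.1 hc.2

/-- Every function of the language is computed, on lists, by a program that runs in polynomial time in the
length of the list, which also serves as the ruler. -/
theorem exists_prog (c : Kl) : ∃ (p : Prog) (T : Polynomial ℕ), ∀ (l : List Data),
    c.Valid l.length (Data.ofList l) →
    Config.Eventually (p.start (Data.ofList l)) (T.eval l.length)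
      ((c.eval l.length (Data.ofList l)).map some) := by
  obtain ⟨N, hN⟩ := c.exists_callsBelow
  -- Variable `2` keeps the input as the ruler, variable `4` is the argument slot for `r = 2`, and
  -- the answer is copied back to variable `0`.
  refine ⟨.seq (.assign 2 (.var 0)) (.seq (.assign 4 (.var 0)) (.seq (c.compile N 2)
    (.assign 0 (.var 4)))), c.cost N + 6, fun l hl => ?_⟩
  set n := l.length
  set d := Data.ofList l
  simp only [Polynomial.eval_add, Polynomial.eval_ofNat]
  let s : Store := Function.update (Function.update (Function.update (fun _ => Data.nil) 0 d) 2 d) 4 d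
  have e4 : s (2 * 2) = d := Function.update_self _ _ _
  have e2 : s 2 = d := by simp [s]
  have h := correct (n := n) hN 2 s le_rfl (by rw [e2]; exact isRuler_ofList l) ?_
    (by rw [e4]; exact hl) [.assign 0 (.var 4)] 1 (fun d => PMF.pure (some d)) ?_
  · rw [e4] at h
    exact (Config.Eventually.seq (Config.Eventually.assign (Config.Eventually.seq
      (Config.Eventually.assign (Config.Eventually.seq h))))).mono (by omega)
  · intro x _
    simp only [s]
    rw [Function.update_of_ne (by omega), Function.update_of_ne (by omega),
      Function.update_of_ne (by omega)]
  · intro s' _ _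
    refine Config.Eventually.assign ?_
    have := Config.Eventually.halted (s := Function.update s' 0 (s' 4))
    rwa [Function.update_self] at this

end Kl

/-! ### Polynomial-time functions between coded types -/

/-- Types whose elements are coded by trees. -/
class Coded (α : Type) where
  /-- the tree that represents an element -/
  code : α → Data

open Coded

namespace Coded

instance : Coded Data := ⟨fun d => d⟩

instance : Coded Bool := ⟨Data.ofBool⟩

/-- Numbers are coded in unary. -/
def ofNat : ℕ → Data
  | 0 => Data.nil
  | k + 1 => Data.cons Data.nil (ofNat k)

instance : Coded ℕ := ⟨ofNat⟩

variable {α β : Type} [Coded α] [Coded β]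

instance : Coded (List α) := ⟨fun l => Data.ofList (l.map code)⟩

instance : Coded (α × β) := ⟨fun x => Data.cons (code x.1) (code x.2)⟩

theorem code_nil : code ([] : List α) = Data.nil := rfl

theorem code_cons (a : α) (l : List α) : code (a :: l) = Data.cons (code a) (code l) := rfl

end Coded

section

variable {α β γ κ σ : Type} [Coded α] [Coded β] [Coded γ] [Coded κ] [Coded σ]

/-- On the domain `P`, the randomized function `F n` is computed in polynomial time in `n`. -/
def PolyRand (P : ℕ → α → Prop) (F : ℕ → α → PMF β) : Prop :=
  ∃ c : Kl, ∀ n a, P n a → c.Valid n (code a) ∧ c.eval n (code a) = (F n a).map code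

/-- The function `F n` is computed in polynomial time in `n`. -/
def PolyFun (F : ℕ → α → β) : Prop := PolyRand (fun _ _ => True) fun n a => PMF.pure (F n a)

theorem PolyFun.of_kl {F : ℕ → α → β} (c : Kl)
    (h : ∀ n a, c.Valid n (code a) ∧ c.eval n (code a) = PMF.pure (code (F n a))) : PolyFun F :=
  ⟨c, fun n a _ => ⟨(h n a).1, by rw [(h n a).2, PMF.pure_map]⟩⟩

theorem PolyFun.exists_kl {F : ℕ → α → β} (h : PolyFun F) :
    ∃ c : Kl, ∀ n a, c.Valid n (code a) ∧ c.eval n (code a) = PMF.pure (code (F n a)) := by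
  obtain ⟨c, hc⟩ := h
  exact ⟨c, fun n a => ⟨(hc n a trivial).1, by rw [(hc n a trivial).2, PMF.pure_map]⟩⟩

namespace PolyRand

variable {P : ℕ → α → Prop}

theorem pure {f : ℕ → α → β} (hf : PolyFun f) : PolyRand P fun n a => PMF.pure (f n a) := by
  obtain ⟨c, hc⟩ := hf
  exact ⟨c, fun n a _ => hc n a trivial⟩

theorem comp {Q : ℕ → β → Prop} {G : ℕ → β → PMF γ} {f : ℕ → α → β} (hG : PolyRand Q G)
    (hf : PolyFun f) (hPQ : ∀ n a, P n a → Q n (f n a)) : PolyRand P fun n a => G n (f n a) := by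
  obtain ⟨c, hc⟩ := hG
  obtain ⟨d, hd⟩ := hf.exists_kl
  refine ⟨.comp c d, fun n a ha => ⟨⟨(hd n a).1, fun b hb => ?_⟩, ?_⟩⟩
  · rw [(hd n a).2, PMF.support_pure, Set.mem_singleton_iff] at hb
    exact hb ▸ (hc n _ (hPQ n a ha)).1
  · rw [Kl.eval, (hd n a).2, PMF.pure_bind, (hc n _ (hPQ n a ha)).2]

theorem bind {Q : ℕ → α × β → Prop} {F : ℕ → α → PMF β} {G : ℕ → α × β → PMF γ}
    (hF : PolyRand P F) (hG : PolyRand Q G) (hPQ : ∀ n a, P n a → ∀ b ∈ (F n a).support, Q n (a, b)) :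
    PolyRand P fun n a => (F n a).bind fun b => G n (a, b) := by
  obtain ⟨c, hc⟩ := hF
  obtain ⟨d, hd⟩ := hG
  have key : ∀ n a, P n a → (Kl.pair .id c).eval n (code a) =
      (F n a).map fun b => code (a, b) := by
    intro n a ha
    rw [Kl.eval, Kl.eval, PMF.pure_bind, (hc n a ha).2, PMF.bind_map]
    rfl
  refine ⟨.comp d (.pair .id c), fun n a ha => ⟨⟨⟨trivial, (hc n a ha).1⟩, fun b hb => ?_⟩, ?_⟩⟩
  · rw [key n a ha, PMF.mem_support_map_iff] at hb
    obtain ⟨b, hb, rfl⟩ := hb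
    exact (hd n _ (hPQ n a ha b hb)).1
  · rw [Kl.eval, key n a ha, PMF.bind_map, PMF.map_bind]
    exact PMF.bind_congr_support fun b hb => (hd n _ (hPQ n a ha b hb)).2

/-- Each branch has to be computable only where its test comes out accordingly. This is how a
checked property becomes the promise of a guarded call. -/
theorem ite {b : ℕ → α → Bool} {F G : ℕ → α → PMF β} (hb : PolyFun b)
    (hF : PolyRand (fun n a => P n a ∧ b n a = true) F)
    (hG : PolyRand (fun n a => P n a ∧ b n a = false) G) :
    PolyRand P fun n a => if b n a then F n a else G n a := by
  obtain ⟨e, he⟩ := hb.exists_kl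
  obtain ⟨c, hc⟩ := hF
  obtain ⟨d, hd⟩ := hG
  have key : ∀ n a, (Kl.pair e .id).eval n (code a) =
      PMF.pure (Data.cons (code (b n a)) (code a)) := by
    intro n a
    rw [Kl.eval, (he n a).2, PMF.pure_bind, Kl.eval, PMF.pure_bind]
  refine ⟨.comp (.ite c d) (.pair e .id), fun n a ha => ⟨⟨⟨(he n a).1, trivial⟩, fun x hx => ?_⟩, ?_⟩⟩
  · rw [key, PMF.support_pure, Set.mem_singleton_iff] at hx
    subst hx
    refine ⟨fun h => ?_, fun h => ?_⟩
    · cases hba : b n a with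
      | false => rw [hba] at h; exact absurd rfl h
      | true => exact (hc n a ⟨ha, hba⟩).1
    · cases hba : b n a with
      | false => exact (hd n a ⟨ha, hba⟩).1
      | true => rw [hba] at h; cases h
  · rw [Kl.eval, key, PMF.pure_bind, Kl.eval]
    cases hba : b n a with
    | false =>
      refine (if_neg (not_not.2 rfl)).trans ?_
      simp only [hba, Bool.false_eq_true, if_false]
      exact (hd n a ⟨ha, hba⟩).2
    | true =>
      refine (if_pos (by intro h; cases h)).trans ?_
      simp only [hba, if_true]
      exact (hc n a ⟨ha, hba⟩).2

theorem mono {Q : ℕ → α → Prop} {F : ℕ → α → PMF β} (hF : PolyRand Q F)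
    (hPQ : ∀ n a, P n a → Q n a) : PolyRand P F := by
  obtain ⟨c, hc⟩ := hF
  exact ⟨c, fun n a ha => hc n a (hPQ n a ha)⟩

theorem toss : PolyRand P fun _ _ => PMF.uniformOfFintype Bool :=
  ⟨.toss, fun _ _ _ => ⟨trivial, rfl⟩⟩

/-- The output, after `T n` steps, of the program `p` on input `d`. -/
noncomputable def _root_.Prog.output (p : Prog) (T : Polynomial ℕ) (n : ℕ) (d : Data) : PMF Data :=
  (Config.run (T.eval n) (p.start d)).map fun c => c.store 0

theorem call (p : Prog) (T : Polynomial ℕ) :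
    PolyRand (fun n d => ∀ c ∈ (Config.run (T.eval n) (p.start d)).support, c.Halted)
      (p.output T) :=
  ⟨.call p T, fun _ _ h => ⟨h, (PMF.map_id _).symm⟩⟩

end PolyRand

namespace PolyFun

theorem comp {g : ℕ → β → γ} {f : ℕ → α → β} (hg : PolyFun g) (hf : PolyFun f) :
    PolyFun fun n a => g n (f n a) :=
  PolyRand.comp (Q := fun _ _ => True) (G := fun n b => PMF.pure (g n b)) hg hf fun _ _ _ => trivial

theorem id : PolyFun fun _ (a : α) => a :=
  of_kl .id fun _ _ => ⟨trivial, rfl⟩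

theorem of_code_eq_nil {b : β} (hb : code b = Data.nil) : PolyFun fun _ (_ : α) => b :=
  of_kl .nil fun _ _ => ⟨trivial, by rw [Kl.eval, hb]⟩

theorem fst : PolyFun fun _ (x : α × β) => x.1 :=
  of_kl .hd fun _ _ => ⟨trivial, rfl⟩

theorem snd : PolyFun fun _ (x : α × β) => x.2 :=
  of_kl .tl fun _ _ => ⟨trivial, rfl⟩

theorem pair {f : ℕ → α → β} {g : ℕ → α → γ} (hf : PolyFun f) (hg : PolyFun g) :
    PolyFun fun n a => (f n a, g n a) := by
  obtain ⟨c, hc⟩ := hf.exists_kl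
  obtain ⟨d, hd⟩ := hg.exists_kl
  refine of_kl (.pair c d) fun n a => ⟨⟨(hc n a).1, (hd n a).1⟩, ?_⟩
  rw [Kl.eval, (hc n a).2, (hd n a).2, PMF.pure_bind, PMF.pure_bind]
  rfl

theorem ite {b : ℕ → α → Bool} {f g : ℕ → α → β} (hb : PolyFun b) (hf : PolyFun f) (hg : PolyFun g) :
    PolyFun fun n a => if b n a then f n a else g n a := by
  have := PolyRand.ite (P := fun _ _ => True) hb (PolyRand.pure hf) (PolyRand.pure hg)
  unfold PolyFun
  convert this using 3
  split <;> simp [*]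

theorem false : PolyFun fun _ (_ : α) => false := of_code_eq_nil rfl

theorem nil : PolyFun fun _ (_ : α) => ([] : List β) := of_code_eq_nil rfl

theorem zero : PolyFun fun _ (_ : α) => 0 := of_code_eq_nil rfl

theorem dnil : PolyFun fun _ (_ : α) => Data.nil := of_code_eq_nil rfl

theorem true : PolyFun fun _ (_ : α) => true :=
  of_kl (.pair .nil .nil) fun _ _ => ⟨⟨trivial, trivial⟩, by
    rw [Kl.eval, Kl.eval, PMF.pure_bind, PMF.pure_bind]; rfl⟩

theorem bool : ∀ b : Bool, PolyFun fun _ (_ : α) => b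
  | .false => false
  | .true => true

theorem cons {f : ℕ → α → β} {g : ℕ → α → List β} (hf : PolyFun f) (hg : PolyFun g) :
    PolyFun fun n a => f n a :: g n a := by
  obtain ⟨c, hc⟩ := (hf.pair hg).exists_kl
  exact of_kl c hc

theorem succ {f : ℕ → α → ℕ} (hf : PolyFun f) : PolyFun fun n a => f n a + 1 := by
  obtain ⟨c, hc⟩ := (dnil.pair hf).exists_kl
  exact of_kl c hc

theorem not {b : ℕ → α → Bool} (hb : PolyFun b) : PolyFun fun n a => !b n a := by
  have := ite hb false true
  convert this using 3 with n a
  cases b n a <;> rfl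

theorem and {b c : ℕ → α → Bool} (hb : PolyFun b) (hc : PolyFun c) : PolyFun fun n a => b n a && c n a := by
  have := ite hb hc false
  convert this using 3 with n a
  cases b n a <;> rfl

theorem beq_bool {b c : ℕ → α → Bool} (hb : PolyFun b) (hc : PolyFun c) :
    PolyFun fun n a => b n a == c n a := by
  have := ite hb hc hc.not
  convert this using 3 with n a
  cases b n a <;> cases c n a <;> rfl

/-- The branching of `Kl` looks at the head of its argument only, so the tree is paired with `nil`
to become a head. -/
theorem data_isNil_aux : PolyFun fun _ (d : Data) => match d with
    | .nil => Bool.false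
    | .cons _ _ => Bool.true := by
  obtain ⟨t, ht⟩ := (true (α := Data)).exists_kl
  refine of_kl (.comp (.ite t .nil) (.pair .id .nil)) fun n d => ⟨⟨⟨trivial, trivial⟩, ?_⟩, ?_⟩
  · intro x _
    exact ⟨fun _ => (ht n _).1, fun _ => trivial⟩
  · rw [Kl.eval, Kl.eval, Kl.eval, PMF.pure_bind, Kl.eval, PMF.pure_bind, PMF.pure_bind, Kl.eval]
    cases d with
    | nil => exact if_neg (not_not.2 rfl)
    | cons x y => exact (if_pos (by intro h; cases h)).trans (ht n _).2

/-- Only codes matter for computability. Hence lists and numbers can be handled as raw trees and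
read back in their own type. -/
theorem recode {f : ℕ → α → β} {γ : Type} [Coded γ] {g : ℕ → α → γ} (hf : PolyFun f)
    (h : ∀ n a, code (f n a) = code (g n a)) : PolyFun g := by
  obtain ⟨c, hc⟩ := hf.exists_kl
  exact of_kl c fun n a => ⟨(hc n a).1, by rw [(hc n a).2, h]⟩

theorem to_data {f : ℕ → α → β} (hf : PolyFun f) : PolyFun fun n a => code (f n a) :=
  recode hf fun _ _ => rfl

theorem data_hd {f : ℕ → α → Data} (hf : PolyFun f) : PolyFun fun n a => (f n a).hd :=
  comp (g := fun _ d => d.hd) (of_kl .hd fun _ _ => ⟨trivial, rfl⟩) hf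

theorem data_tl {f : ℕ → α → Data} (hf : PolyFun f) : PolyFun fun n a => (f n a).tl :=
  comp (g := fun _ d => d.tl) (of_kl .tl fun _ _ => ⟨trivial, rfl⟩) hf

open Classical in
theorem data_ne_nil {f : ℕ → α → Data} (hf : PolyFun f) :
    PolyFun fun n a => decide (f n a ≠ Data.nil) := by
  have := data_isNil_aux.comp hf
  convert this using 3 with n a
  cases f n a <;> simp

theorem tail {f : ℕ → α → List β} (hf : PolyFun f) : PolyFun fun n a => (f n a).tail :=
  recode (data_tl hf.to_data) fun n a => by cases f n a <;> rfl

theorem headD {f : ℕ → α → List β} (hf : PolyFun f) {b : β} (hb : code b = Data.nil) :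
    PolyFun fun n a => (f n a).headD b :=
  recode (data_hd hf.to_data) fun n a => by
    cases f n a with
    | nil => exact hb.symm
    | cons x l => rfl

theorem pred {f : ℕ → α → ℕ} (hf : PolyFun f) : PolyFun fun n a => f n a - 1 :=
  recode (data_tl hf.to_data) fun n a => by cases f n a <;> rfl

theorem list_isEmpty {f : ℕ → α → List β} (hf : PolyFun f) : PolyFun fun n a => (f n a).isEmpty := by
  have := (data_ne_nil hf.to_data).not
  convert this using 3 with n a
  cases f n a with
  | nil => simp [code_nil]
  | cons x l => simp [code_cons]

theorem nat_eq_zero {f : ℕ → α → ℕ} (hf : PolyFun f) : PolyFun fun n a => decide (f n a = 0) := by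
  have := (data_ne_nil hf.to_data).not
  convert this using 3 with n a
  cases f n a with
  | zero => simp [code, ofNat]
  | succ m => simp [code, ofNat]

end PolyFun

end

/-! ### Loops -/

/-- Randomized left fold. -/
noncomputable def PMF.fold {σ κ : Type*} (g : σ → κ → PMF σ) : List κ → σ → PMF σ
  | [], s => PMF.pure s
  | x :: l, s => (g s x).bind (PMF.fold g l)

theorem PMF.fold_pure {σ κ : Type*} (g : σ → κ → σ) (l : List κ) (s : σ) :
    PMF.fold (fun s x => PMF.pure (g s x)) l s = PMF.pure (l.foldl g s) := by
  induction l generalizing s with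
  | nil => rfl
  | cons x l ih => rw [fold, pure_bind, ih, List.foldl_cons]

theorem PMF.iter_add {α : Type*} (f : α → PMF α) (a b : ℕ) (x : α) :
    PMF.iter f (a + b) x = (PMF.iter f a x).bind (PMF.iter f b) := by
  induction a generalizing x with
  | zero => rw [Nat.zero_add, iter, pure_bind]
  | succ a ih =>
    rw [Nat.succ_add, iter, iter, bind_bind]
    congr 1
    funext y
    exact ih y

theorem PMF.iter_iter {α : Type*} (f : α → PMF α) (a b : ℕ) (x : α) :
    PMF.iter (PMF.iter f a) b x = PMF.iter f (b * a) x := by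
  induction b generalizing x with
  | zero => rw [Nat.zero_mul, iter, iter]
  | succ b ih =>
    rw [Nat.succ_mul, Nat.add_comm (b * a) a, iter_add f a, iter.eq_2]
    congr 1
    funext y
    exact ih y

theorem PMF.iter_mem {α : Type*} {f : α → PMF α} {I : α → Prop}
    (h : ∀ x, I x → ∀ y ∈ (f x).support, I y) (m : ℕ) {x : α} (hx : I x) :
    ∀ y ∈ (PMF.iter f m x).support, I y := by
  induction m generalizing x with
  | zero =>
    intro y hy
    rw [iter, support_pure, Set.mem_singleton_iff] at hy
    exact hy ▸ hx
  | succ m ih =>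
    intro y hy
    rw [iter, mem_support_bind_iff] at hy
    obtain ⟨z, hz, hy⟩ := hy
    exact ih (h x hx z hz) y hy

theorem PMF.fold_mem {σ κ : Type*} {g : σ → κ → PMF σ} {I : σ → Prop} {l : List κ}
    (h : ∀ x ∈ l, ∀ s, I s → ∀ y ∈ (g s x).support, I y) {s : σ} (hs : I s) :
    ∀ y ∈ (PMF.fold g l s).support, I y := by
  induction l generalizing s with
  | nil =>
    intro y hy
    rw [fold, support_pure, Set.mem_singleton_iff] at hy
    exact hy ▸ hs
  | cons x l ih =>
    intro y hy
    rw [fold, mem_support_bind_iff] at hy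
    obtain ⟨z, hz, hy⟩ := hy
    exact ih (fun x hx => h x (List.mem_cons_of_mem _ hx)) (h x List.mem_cons_self s hs z hz) y hy

/-- If a step of the fold reaches a good state with probability at least `c`, and good states stay
good, then so does the whole fold. -/
theorem PMF.le_fold {σ κ : Type*} {g : σ → κ → PMF σ} {I J : σ → Prop} {l : List κ} {c : ENNReal}
    (hI : ∀ x ∈ l, ∀ s, I s → ∀ y ∈ (g s x).support, I y)
    (hJ : ∀ x ∈ l, ∀ s, I s → J s → ∀ y ∈ (g s x).support, J y) {x : κ} (hx : x ∈ l)
    (hc : ∀ s, I s → c ≤ (g s x).toOuterMeasure {y | J y}) {s : σ} (hs : I s) :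
    c ≤ (PMF.fold g l s).toOuterMeasure {y | J y} := by
  induction l generalizing s with
  | nil => simp at hx
  | cons z l ih =>
    rw [fold]
    rcases List.mem_cons.1 hx with rfl | hx
    · refine (hc s hs).trans ?_
      have := mul_le_toOuterMeasure_bind (g s x) (PMF.fold g l) {y | J y} {y | J y} 1 ?_
      · rwa [mul_one] at this
      · intro a ha haJ
        rw [toOuterMeasure_eq_one]
        intro y hy
        have := PMF.fold_mem (I := fun y => I y ∧ J y) (g := g) (l := l) ?_
          ⟨hI x List.mem_cons_self s hs a ha, haJ⟩ y hy
        · exact this.2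
        · exact fun x hx s hs y hy => ⟨hI x (List.mem_cons_of_mem _ hx) s hs.1 y hy,
            hJ x (List.mem_cons_of_mem _ hx) s hs.1 hs.2 y hy⟩
    · refine le_toOuterMeasure_bind _ _ _ _ fun a ha => ?_
      exact ih (fun x hx => hI x (List.mem_cons_of_mem _ hx))
        (fun x hx => hJ x (List.mem_cons_of_mem _ hx)) hx (hI z List.mem_cons_self s hs a ha)

/-- The loop state consists of a parameter, an accumulator and the pending entries. On an empty list
the step does nothing, so rounds in excess of the length are harmless. -/
theorem PMF.iter_eq_fold {α κ σ : Type*} {f : α × σ × List κ → PMF (α × σ × List κ)} {a : α} {g : σ → κ → PMF σ}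
    (hnil : ∀ s, f (a, s, []) = PMF.pure (a, s, []))
    {L : List κ}
    (hcons : ∀ s x l, x ∈ L → f (a, s, x :: l) = (g s x).map fun s' => (a, s', l)) (m : ℕ) (l : List κ)
    (hl : ∀ x ∈ l, x ∈ L) (s : σ) :
    PMF.iter f m (a, s, l) = (PMF.fold g (l.take m) s).map fun s' => (a, s', l.drop m) := by
  induction m generalizing l s with
  | zero => rw [iter, List.take_zero, fold, pure_map, List.drop_zero]
  | succ m ih =>
    cases l with
    | nil =>
      have := ih [] (by simp) s
      rw [List.take_nil, fold, pure_map, List.drop_nil] at this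
      rw [iter, hnil, pure_bind, this, List.take_nil, fold, pure_map, List.drop_nil]
    | cons x l =>
      rw [iter, hcons _ _ _ (hl x List.mem_cons_self), bind_map, List.take_succ_cons,
        List.drop_succ_cons, fold, map_bind]
      congr 1
      funext s'
      exact ih l (fun y hy => hl y (List.mem_cons_of_mem _ hy)) s'

namespace Kl

/-- Iteration `n ^ e` times, for a ruler of length `n`. -/
def iterPow : ℕ → Kl → Kl
  | 0, c => c
  | e + 1, c => .iter (iterPow e c)

theorem eval_iterPow (n e : ℕ) (c : Kl) (d : Data) :
    (iterPow e c).eval n d = PMF.iter (c.eval n) (n ^ e) d := by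
  induction e generalizing d with
  | zero => exact (PMF.bind_pure _).symm
  | succ e ih =>
    rw [iterPow, eval, show (iterPow e c).eval n = PMF.iter (c.eval n) (n ^ e) from funext ih,
      PMF.iter_iter, pow_succ, mul_comm]

theorem valid_iterPow {n : ℕ} {c : Kl} {I : Data → Prop} (hI : ∀ d, I d → c.Valid n d)
    (hI' : ∀ d, I d → ∀ x ∈ (c.eval n d).support, I x) (e : ℕ) :
    ∀ d, I d → (iterPow e c).Valid n d := by
  induction e with
  | zero => exact hI
  | succ e ih =>
    intro d hd m _ a ha
    refine ih a (PMF.iter_mem (fun x hx y hy => ?_) m hd a ha)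
    rw [eval_iterPow] at hy
    exact PMF.iter_mem hI' _ hx y hy

end Kl

section

variable {α β γ κ σ : Type} [Coded α] [Coded β] [Coded γ] [Coded κ] [Coded σ]

theorem PMF.iter_map {f : α → PMF α} {F : Data → PMF Data} {I : α → Prop}
    (hI : ∀ a, I a → ∀ b ∈ (f a).support, I b)
    (h : ∀ a, I a → F (code a) = (f a).map code) (m : ℕ) (a : α) (ha : I a) :
    PMF.iter F m (code a) = (PMF.iter f m a).map code := by
  induction m generalizing a with
  | zero => rw [iter, iter, pure_map]
  | succ m ih =>
    rw [iter, iter, h a ha, bind_map, map_bind]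
    exact bind_congr_support fun b hb => ih b (hI a ha b hb)

/-- Randomized loops over lists. Only the first `n ^ e` entries are treated. -/
theorem PolyRand.fold {P : ℕ → α → Prop} {Q : ℕ → α × σ × κ → Prop} {L : ℕ → α → List κ}
    {i : ℕ → α → σ} {g : ℕ → α × σ × κ → PMF σ} [Inhabited κ] (hdef : code (default : κ) = Data.nil)
    (hL : PolyFun L) (hi : PolyFun i)
    (hg : PolyRand Q g) (hPQ : ∀ n a, P n a → ∀ s, ∀ x ∈ L n a, Q n (a, s, x)) (e : ℕ) :
    PolyRand P fun n a => PMF.fold (fun s x => g n (a, s, x)) ((L n a).take (n ^ e)) (i n a) := by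
  let f : ℕ → α × σ × List κ → PMF (α × σ × List κ) := fun n x =>
    if x.2.2.isEmpty then PMF.pure x else
      (g n (x.1, x.2.1, x.2.2.headD default)).bind fun s => PMF.pure (x.1, s, x.2.2.tail)
  -- The domain records that the pending entries come from `L`; this makes the promise `Q` available
  -- in every round.
  have hf : PolyRand (fun n x => P n x.1 ∧ ∀ y ∈ x.2.2, y ∈ L n x.1) f := by
    refine PolyRand.ite (PolyFun.snd.comp PolyFun.snd).list_isEmpty (PolyRand.pure .id) ?_
    refine PolyRand.bind (Q := fun _ _ => True)
      (G := fun _ (y : (α × σ × List κ) × σ) => PMF.pure (y.1.1, y.2, y.1.2.2.tail))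
      (PolyRand.comp (f := fun n (x : α × σ × List κ) => (x.1, x.2.1, x.2.2.headD default)) hg ?_ ?_) ?_ ?_
    · exact PolyFun.fst.pair ((PolyFun.fst.comp PolyFun.snd).pair
        ((PolyFun.snd.comp PolyFun.snd).headD hdef))
    · rintro n ⟨a, s, l⟩ ⟨⟨ha, hl⟩, hne⟩
      cases l with
      | nil => simp at hne
      | cons y l => exact hPQ n a ha s y (hl y List.mem_cons_self)
    · exact (PolyFun.fst.comp PolyFun.fst).pair (PolyFun.snd.pair
        (PolyFun.snd.comp (PolyFun.snd.comp PolyFun.fst)).tail)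
    · exact fun _ _ _ _ _ => trivial
  have hcons : ∀ n a, ∀ s x l, x ∈ L n a → f n (a, s, x :: l) =
      (g n (a, s, x)).map fun s' => (a, s', l) := by
    intro n a s x l _
    simp [f, PMF.map, Function.comp_def]
  obtain ⟨c, hc⟩ := hf
  obtain ⟨d, hd⟩ := (PolyFun.id.pair (hi.pair hL)).exists_kl
  have hI' : ∀ n, ∀ x : α × σ × List κ, (P n x.1 ∧ ∀ y ∈ x.2.2, y ∈ L n x.1) →
      ∀ z ∈ (f n x).support, (P n z.1 ∧ ∀ y ∈ z.2.2, y ∈ L n z.1) := by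
    rintro n ⟨a, s, l⟩ ⟨ha, hl⟩ z hz
    cases l with
    | nil =>
      simp only [f, List.isEmpty_nil, if_true, PMF.support_pure, Set.mem_singleton_iff] at hz
      subst hz
      exact ⟨ha, hl⟩
    | cons x l =>
      rw [hcons n a s x l (hl x List.mem_cons_self), PMF.mem_support_map_iff] at hz
      obtain ⟨s', -, rfl⟩ := hz
      exact ⟨ha, fun y hy => hl y (List.mem_cons_of_mem _ hy)⟩
  refine ⟨.comp (.comp .hd .tl) (.comp (Kl.iterPow e c) d), fun n a ha => ?_⟩
  have h1 : (Kl.comp (Kl.iterPow e c) d).eval n (code a) =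
      ((PMF.fold (fun s x => g n (a, s, x)) ((L n a).take (n ^ e)) (i n a)).map
        fun s' => (a, s', (L n a).drop (n ^ e))).map code := by
    rw [Kl.eval, (hd n a).2, PMF.pure_bind, Kl.eval_iterPow, PMF.iter_map (hI' n) (fun x hx => (hc n x hx).2) _ _
      ⟨ha, fun y hy => hy⟩, PMF.iter_eq_fold (fun s => by simp [f]) (hcons n a) _ _ (fun y hy => hy)]
  refine ⟨⟨⟨(hd n a).1, fun b hb => ?_⟩, fun b _ => ⟨trivial, fun _ _ => trivial⟩⟩, ?_⟩
  · rw [(hd n a).2, PMF.support_pure, Set.mem_singleton_iff] at hb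
    subst hb
    refine Kl.valid_iterPow (I := fun d => ∃ x : α × σ × List κ,
      (P n x.1 ∧ ∀ y ∈ x.2.2, y ∈ L n x.1) ∧ code x = d) ?_ ?_ e _ ⟨_, ⟨ha, fun y hy => hy⟩, rfl⟩
    · rintro _ ⟨x, hx, rfl⟩
      exact (hc n x hx).1
    · rintro _ ⟨x, hx, rfl⟩ z hz
      rw [(hc n x hx).2, PMF.mem_support_map_iff] at hz
      obtain ⟨z, hz, rfl⟩ := hz
      exact ⟨z, hI' n x hx z hz, rfl⟩
  · rw [Kl.eval, h1, PMF.bind_map, PMF.bind_map]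
    simp only [Function.comp_def, Kl.eval, PMF.pure_bind, PMF.map]
    rfl

namespace PolyFun

theorem iterate {f : ℕ → α → α} (hf : PolyFun f) : PolyFun fun n a => (f n)^[n] a := by
  obtain ⟨c, hc⟩ := hf.exists_kl
  have h : ∀ n m a, PMF.iter (c.eval n) m (code a) = PMF.pure (code ((f n)^[m] a)) := by
    intro n m
    induction m with
    | zero => intro a; rfl
    | succ m ih =>
      intro a
      rw [PMF.iter, (hc n a).2, PMF.pure_bind, ih, Function.iterate_succ_apply]
  refine of_kl (.iter c) fun n a => ⟨fun m _ x hx => ?_, h n n a⟩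
  rw [h, PMF.support_pure, Set.mem_singleton_iff] at hx
  exact hx ▸ (hc n _).1

theorem fold [Inhabited κ] (hdef : code (default : κ) = Data.nil) {L : ℕ → α → List κ}
    {i : ℕ → α → σ} {g : ℕ → α × σ × κ → σ} (hL : PolyFun L) (hi : PolyFun i) (hg : PolyFun g) (e : ℕ) :
    PolyFun fun n a => ((L n a).take (n ^ e)).foldl (fun s x => g n (a, s, x)) (i n a) := by
  have := PolyRand.fold (P := fun _ _ => True) hdef hL hi hg (fun _ _ _ _ _ _ => trivial) e
  simp only [PMF.fold_pure] at this
  exact this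

end PolyFun

end

/-! ### Basic polynomial-time functions on lists and numbers -/

section

variable {α β γ κ σ : Type} [Coded α] [Coded β] [Coded γ] [Coded κ] [Coded σ]

namespace PolyFun

theorem fold' [Inhabited κ] (hdef : code (default : κ) = Data.nil) {L : ℕ → α → List κ}
    {i : ℕ → α → σ} {g : ℕ → α → σ → κ → σ} (hL : PolyFun L) (hi : PolyFun i)
    (hg : PolyFun fun n (x : α × σ × κ) => g n x.1 x.2.1 x.2.2) (e : ℕ) :
    PolyFun fun n a => ((L n a).take (n ^ e)).foldl (g n a) (i n a) :=
  fold hdef hL hi hg e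

theorem range : PolyFun fun n (_ : α) => List.range n := by
  -- Counting up for `n` rounds pushes the numbers in decreasing order; a second fold turns the list
  -- around.
  have h1 : PolyFun fun n (_ : α) => (List.range n).reverse := by
    have h := ((iterate (α := ℕ × List ℕ) (f := fun _ x => (x.1 + 1, x.1 :: x.2))
      (fst.succ.pair (fst.cons snd))).comp (zero.pair nil : PolyFun fun _ (_ : α) => (0, []))).comp id
    have key : ∀ m, (fun x : ℕ × List ℕ => (x.1 + 1, x.1 :: x.2))^[m] (0, []) =
        (m, (List.range m).reverse) := by
      intro m
      induction m with
      | zero => rfl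
      | succ m ih => rw [Function.iterate_succ_apply', ih, List.range_succ]; simp
    simp only [key] at h
    exact snd.comp h
  have h2 := fold' (κ := ℕ) rfl h1 (nil (β := ℕ)) (g := fun _ _ s x => x :: s)
    ((snd.comp snd).cons (fst.comp snd)) 1
  convert h2 using 3 with n a
  rw [List.take_of_length_le (by simp), List.foldl_flip_cons_eq_append]
  simp

theorem length [Inhabited κ] (hdef : code (default : κ) = Data.nil) {L : ℕ → α → List κ}
    (hL : PolyFun L) (e : ℕ) : PolyFun fun n a => ((L n a).take (n ^ e)).length := by
  have h := fold' hdef hL zero (g := fun _ _ s _ => s + 1) (fst.comp snd).succ e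
  convert h using 3 with n a
  generalize (L n a).take (n ^ e) = l
  have : ∀ (l : List κ) (s : ℕ), l.foldl (fun s _ => s + 1) s = s + l.length := by
    intro l
    induction l with
    | nil => simp
    | cons x l ih => intro s; rw [List.foldl_cons, ih, List.length_cons]; omega
  rw [this, Nat.zero_add]

theorem all [Inhabited κ] (hdef : code (default : κ) = Data.nil) {L : ℕ → α → List κ}
    {p : ℕ → α → κ → Bool} (hL : PolyFun L) (hp : PolyFun fun n (x : α × κ) => p n x.1 x.2) (e : ℕ) :
    PolyFun fun n a => ((L n a).take (n ^ e)).all (p n a) := by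
  have h := fold' hdef hL true (g := fun n a s x => s && p n a x)
    ((fst.comp snd).and (hp.comp (fst.pair (snd.comp snd)))) e
  convert h using 3 with n a
  generalize (L n a).take (n ^ e) = l
  have : ∀ (l : List κ) (s : Bool), l.foldl (fun s x => s && p n a x) s = (s && l.all (p n a)) := by
    intro l
    induction l with
    | nil => simp
    | cons x l ih => intro s; rw [List.foldl_cons, ih, List.all_cons, Bool.and_assoc]
  rw [this, Bool.true_and]

theorem filter_map [Inhabited κ] [Inhabited γ] (hdef : code (default : κ) = Data.nil)
    (hdef' : code (default : γ) = Data.nil) {L : ℕ → α → List κ}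
    {p : ℕ → α → κ → Bool} {f : ℕ → α → κ → γ} (hL : PolyFun L)
    (hp : PolyFun fun n (x : α × κ) => p n x.1 x.2)
    (hf : PolyFun fun n (x : α × κ) => f n x.1 x.2) (e : ℕ) :
    PolyFun fun n a => (((L n a).take (n ^ e)).filter (p n a)).map (f n a) := by
  have h1 := fold' hdef hL (nil (β := γ)) (g := fun n a s x => if p n a x then f n a x :: s else s)
    ((hp.comp (fst.pair (snd.comp snd))).ite ((hf.comp (fst.pair (snd.comp snd))).cons (fst.comp snd))
      (fst.comp snd)) e
  have h2 := fold' (κ := γ) hdef' h1 (nil (β := γ)) (g := fun _ _ s x => x :: s)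
    ((snd.comp snd).cons (fst.comp snd)) e
  convert h2 using 3 with n a
  have key : ∀ (l : List κ) (s : List γ),
      l.foldl (fun s x => if p n a x then f n a x :: s else s) s =
        ((l.filter (p n a)).map (f n a)).reverse ++ s := by
    intro l
    induction l with
    | nil => simp
    | cons x l ih =>
      intro s
      rw [List.foldl_cons, ih, List.filter_cons]
      split <;> simp
  -- The intermediate list has at most `n ^ e` entries, so the fold that reverses it cuts off
  -- nothing.
  have hlen : ((((L n a).take (n ^ e)).filter (p n a)).map (f n a)).reverse.length ≤ n ^ e := by
    rw [List.length_reverse, List.length_map]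
    exact (List.length_filter_le _ _).trans (by rw [List.length_take]; exact min_le_left _ _)
  rw [key, List.append_nil, List.take_of_length_le hlen, List.foldl_flip_cons_eq_append]
  simp

theorem filter [Inhabited κ] (hdef : code (default : κ) = Data.nil) {L : ℕ → α → List κ}
    {p : ℕ → α → κ → Bool} (hL : PolyFun L)
    (hp : PolyFun fun n (x : α × κ) => p n x.1 x.2) (e : ℕ) :
    PolyFun fun n a => ((L n a).take (n ^ e)).filter (p n a) := by
  have := filter_map hdef hdef hL hp (f := fun _ _ x => x) snd e
  simpa using this

theorem map [Inhabited κ] [Inhabited γ] (hdef : code (default : κ) = Data.nil)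
    (hdef' : code (default : γ) = Data.nil) {L : ℕ → α → List κ} {f : ℕ → α → κ → γ} (hL : PolyFun L)
    (hf : PolyFun fun n (x : α × κ) => f n x.1 x.2) (e : ℕ) :
    PolyFun fun n a => ((L n a).take (n ^ e)).map (f n a) := by
  have := filter_map hdef hdef' hL (p := fun _ _ _ => Bool.true) true hf e
  simpa using this

theorem all_const {ι : Type} {p : ι → ℕ → α → Bool} (hp : ∀ i, PolyFun (p i)) (l : List ι) :
    PolyFun fun n a => l.all fun i => p i n a := by
  induction l with
  | nil => exact true
  | cons i l ih => exact (hp i).and ih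

/-- One entry is dropped per round until the counter is zero. There are only `n` rounds, hence the
minimum, which is immaterial for positions up to `n`. -/
theorem drop {k : ℕ → α → ℕ} {l : ℕ → α → List β} (hk : PolyFun k) (hl : PolyFun l) :
    PolyFun fun n a => (l n a).drop (min (k n a) n) := by
  have h := (iterate (α := ℕ × List β) (f := fun _ x => if decide (x.1 = 0) then x else
    (x.1 - 1, x.2.tail)) (fst.nat_eq_zero.ite id (fst.pred.pair snd.tail))).comp (hk.pair hl)
  have key : ∀ m (x : ℕ × List β), (fun x : ℕ × List β => if decide (x.1 = 0) then x else
      (x.1 - 1, x.2.tail))^[m] x = (x.1 - m, x.2.drop (min x.1 m)) := by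
    intro m
    induction m with
    | zero => simp
    | succ m ih =>
      rintro ⟨k, l⟩
      rw [Function.iterate_succ_apply, ih]
      cases k with
      | zero => simp
      | succ k => simp
  simp only [key] at h
  exact snd.comp h

theorem sub {k m : ℕ → α → ℕ} (hm : PolyFun m) (hk : PolyFun k) :
    PolyFun fun n a => m n a - min (k n a) n := by
  have h := (iterate (α := ℕ × ℕ) (f := fun _ x => if decide (x.1 = 0) then x else
    (x.1 - 1, x.2 - 1)) (fst.nat_eq_zero.ite id (fst.pred.pair snd.pred))).comp (hk.pair hm)
  have key : ∀ m (x : ℕ × ℕ), (fun x : ℕ × ℕ => if decide (x.1 = 0) then x else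
      (x.1 - 1, x.2 - 1))^[m] x = (x.1 - m, x.2 - min x.1 m) := by
    intro m
    induction m with
    | zero => simp
    | succ m ih =>
      rintro ⟨k, l⟩
      rw [Function.iterate_succ_apply, ih]
      cases k with
      | zero => simp
      | succ k => simp; omega
  simp only [key] at h
  exact snd.comp h

end PolyFun

end

/-! ### The deterministic parts of the algorithm

Vertices are natural numbers, sets of vertices are lists, and `M` is the adjacency matrix. -/

namespace Alg

section

variable {α : Type} [Coded α]

/-- Comparison of `u` with `v ≤ n`. -/
def le (n u v : ℕ) : Bool := decide (u - min v n = 0)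

/-- Equality of numbers that are at most `n`. -/
def eq (n u v : ℕ) : Bool := le n u v && le n v u

/-- Adjacency of the vertices `u` and `v`. -/
def adj (n : ℕ) (M : List (List Bool)) (u v : ℕ) : Bool :=
  (((M.drop (min u n)).headD []).drop (min v n)).headD false

/-- The vertices of the list `t` form a copy of the graph with adjacency matrix `F`, of which
the vertices `0, …, m` are considered. -/
def copy (F : ℕ → ℕ → Bool) (m n : ℕ) (M : List (List Bool)) (t : List ℕ) : Bool :=
  (List.range (m + 1)).all fun a => (List.range (m + 1)).all fun b =>
    (eq n ((t.drop a).headD 0) ((t.drop b).headD 0) == (a == b)) &&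
      (adj n M ((t.drop a).headD 0) ((t.drop b).headD 0) == F a b)

/-- All `m`-tuples of elements of `U`. -/
def tuples (n : ℕ) (U : List ℕ) : ℕ → List (List ℕ)
  | 0 => [[]]
  | m + 1 => ((tuples n U m).take (n ^ m)).foldl
      (fun s t => (U.take (n ^ 1)).foldl (fun s u => (u :: t) :: s) s) []

/-- The vertices in `U` that extend the tuple `t` to a copy. -/
def ext (F : ℕ → ℕ → Bool) (m n : ℕ) (M : List (List Bool)) (U t : List ℕ) : List ℕ :=
  (U.take (n ^ 1)).filter fun v => copy F m n M (v :: t)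

/-- The vertices in `U` that do not extend the tuple `t` to a copy. -/
def coext (F : ℕ → ℕ → Bool) (m n : ℕ) (M : List (List Bool)) (U t : List ℕ) : List ℕ :=
  (U.take (n ^ 1)).filter fun v => !copy F m n M (v :: t)

/-- Removal of the vertices that extend the tuple `t` to a copy, if there are at least `k` of them. The
removed sets are collected. -/
def strip (F : ℕ → ℕ → Bool) (m n : ℕ) (M : List (List Bool)) (k : ℕ) (x : List ℕ × List (List ℕ))
    (t : List ℕ) : List ℕ × List (List ℕ) :=
  if le n k ((ext F m n M x.1 t).take (n ^ 1)).length then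
    (coext F m n M x.1 t, ext F m n M x.1 t :: x.2) else x

/-- The vertices that remain, and the sets that were removed, after removal for all tuples. -/
def strips (F : ℕ → ℕ → Bool) (m n : ℕ) (M : List (List Bool)) (k : ℕ) :
    List ℕ × List (List ℕ) :=
  ((tuples n (List.range n) m).take (n ^ m)).foldl (strip F m n M k) (List.range n, [])

/-- The set `S` contains no copy. -/
def free (F : ℕ → ℕ → Bool) (m n : ℕ) (M : List (List Bool)) (S : List ℕ) : Bool :=
  ((tuples n S m).take (n ^ m)).all fun t => (ext F m n M S t).isEmpty

/-- The adjacency matrix of the subgraph induced on `W`. -/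
def induced (n : ℕ) (M : List (List Bool)) (W : List ℕ) : List (List Bool) :=
  (W.take (n ^ 1)).map fun u => (W.take (n ^ 1)).map fun v => adj n M u v

open Classical in
/-- The subset of `W` that is described by the output `d`. -/
noncomputable def select (n : ℕ) (W : List ℕ) (d : Data) : List ℕ :=
  ((W.take (n ^ 1)).foldl (fun (x : List ℕ × Data) w =>
    (if decide (x.2.hd ≠ Data.nil) then w :: x.1 else x.1, x.2.tl)) ([], d)).1

/-- The set `C` is independent. -/
def indep (n : ℕ) (M : List (List Bool)) (C : List ℕ) : Bool :=
  (C.take (n ^ 1)).all fun u => (C.take (n ^ 1)).all fun v => !adj n M u v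

/-- The better one of the two sets. -/
def better (n : ℕ) (M : List (List Bool)) (B C : List ℕ) : List ℕ :=
  if indep n M C && le n (B.take (n ^ 1)).length (C.take (n ^ 1)).length then C else B

/-- The set `B` as a list of truth values. -/
def mask (n : ℕ) (B : List ℕ) : List Bool :=
  ((List.range n).take (n ^ 1)).map fun v => !((B.take (n ^ 1)).all fun u => !eq n u v)

end

end Alg

/-! ### Polynomial-time computability of the deterministic parts -/

namespace PolyFun

variable {α : Type} [Coded α]

theorem le {u v : ℕ → α → ℕ} (hu : PolyFun u) (hv : PolyFun v) :
    PolyFun fun n a => Alg.le n (u n a) (v n a) :=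
  (hu.sub hv).nat_eq_zero

theorem eq {u v : ℕ → α → ℕ} (hu : PolyFun u) (hv : PolyFun v) :
    PolyFun fun n a => Alg.eq n (u n a) (v n a) :=
  (hu.le hv).and (hv.le hu)

theorem adj {M : ℕ → α → List (List Bool)} {u v : ℕ → α → ℕ} (hM : PolyFun M) (hu : PolyFun u)
    (hv : PolyFun v) : PolyFun fun n a => Alg.adj n (M n a) (u n a) (v n a) :=
  (drop hv ((drop hu hM).headD rfl)).headD rfl

theorem getD {t : ℕ → α → List ℕ} (ht : PolyFun t) (a : ℕ) :
    PolyFun fun n x => ((t n x).drop a).headD 0 := by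
  refine headD ?_ rfl
  induction a with
  | zero => simpa using ht
  | succ a ih => simpa using ih.tail

/-- The pattern and its size are fixed, so the test is a finite conjunction that is written out in
the program. -/
theorem copy (F : ℕ → ℕ → Bool) (m : ℕ) {M : ℕ → α → List (List Bool)} {t : ℕ → α → List ℕ}
    (hM : PolyFun M) (ht : PolyFun t) : PolyFun fun n a => Alg.copy F m n (M n a) (t n a) :=
  all_const (fun a => all_const (fun b => (((ht.getD a).eq (ht.getD b)).beq_bool (bool _)).and
    ((adj hM (ht.getD a) (ht.getD b)).beq_bool (bool _))) _) _

theorem tuples {U : ℕ → α → List ℕ} (hU : PolyFun U) (m : ℕ) :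
    PolyFun fun n a => Alg.tuples n (U n a) m := by
  induction m with
  | zero => exact cons nil nil
  | succ m ih =>
    refine fold' (κ := List ℕ) rfl ih nil ?_ m
    refine fold' (κ := ℕ) rfl (hU.comp fst) (fst.comp snd)
      (g := fun _ (x : α × List (List ℕ) × List ℕ) s u => (u :: x.2.2) :: s) ?_ 1
    exact ((snd.comp snd).cons (snd.comp (snd.comp fst))).cons (fst.comp snd)

variable {F : ℕ → ℕ → Bool} {m : ℕ} {M : ℕ → α → List (List Bool)} {U t : ℕ → α → List ℕ}

theorem ext (hM : PolyFun M) (hU : PolyFun U) (ht : PolyFun t) :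
    PolyFun fun n a => Alg.ext F m n (M n a) (U n a) (t n a) :=
  filter rfl hU (copy F m (hM.comp fst) (cons snd (ht.comp fst))) 1

theorem coext (hM : PolyFun M) (hU : PolyFun U) (ht : PolyFun t) :
    PolyFun fun n a => Alg.coext F m n (M n a) (U n a) (t n a) :=
  filter rfl hU (copy F m (hM.comp fst) (cons snd (ht.comp fst))).not 1

theorem strip {k : ℕ → α → ℕ} {x : ℕ → α → List ℕ × List (List ℕ)} (hM : PolyFun M)
    (hk : PolyFun k) (hx : PolyFun x) (ht : PolyFun t) :
    PolyFun fun n a => Alg.strip F m n (M n a) (k n a) (x n a) (t n a) :=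
  ite (le hk (length rfl (ext hM (fst.comp hx) ht) 1))
    ((coext hM (fst.comp hx) ht).pair ((ext hM (fst.comp hx) ht).cons (snd.comp hx))) hx

theorem strips {k : ℕ → α → ℕ} (hM : PolyFun M) (hk : PolyFun k) :
    PolyFun fun n a => Alg.strips F m n (M n a) (k n a) :=
  fold' rfl (tuples range m) (range.pair nil) (g := fun n a x t => Alg.strip F m n (M n a) (k n a) x t)
    (strip (hM.comp fst) (hk.comp fst) (fst.comp snd) (snd.comp snd)) m

theorem free (hM : PolyFun M) (hU : PolyFun U) :
    PolyFun fun n a => Alg.free F m n (M n a) (U n a) :=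
  all rfl (tuples hU m) (ext (hM.comp fst) (hU.comp fst) snd).list_isEmpty m

theorem induced (hM : PolyFun M) (hU : PolyFun U) :
    PolyFun fun n a => Alg.induced n (M n a) (U n a) :=
  map rfl rfl hU (map rfl rfl (hU.comp fst) (adj (hM.comp (fst.comp fst)) (snd.comp fst) snd) 1) 1

open Classical in
theorem select {d : ℕ → α → Data} (hU : PolyFun U) (hd : PolyFun d) :
    PolyFun fun n a => Alg.select n (U n a) (d n a) := by
  refine fst.comp (fold' rfl hU (nil.pair hd) (g := fun _ _ (x : List ℕ × Data) w =>
    (if decide (x.2.hd ≠ Data.nil) then w :: x.1 else x.1, x.2.tl)) ?_ 1)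
  have h := snd.comp (fst.comp (snd (α := α) (β := (List ℕ × Data) × ℕ)))
  have h' := fst.comp (fst.comp (snd (α := α) (β := (List ℕ × Data) × ℕ)))
  exact (ite h.data_hd.data_ne_nil ((snd.comp snd).cons h') h').pair h.data_tl

theorem indep (hM : PolyFun M) (hU : PolyFun U) :
    PolyFun fun n a => Alg.indep n (M n a) (U n a) :=
  all rfl hU (all rfl (hU.comp fst) (adj (hM.comp (fst.comp fst)) (snd.comp fst) snd).not 1) 1

theorem better (hM : PolyFun M) (hU : PolyFun U) (ht : PolyFun t) :
    PolyFun fun n a => Alg.better n (M n a) (U n a) (t n a) :=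
  ite ((indep hM ht).and (le (length rfl hU 1) (length rfl ht 1))) ht hU

theorem mask (hU : PolyFun U) : PolyFun fun n a => Alg.mask n (U n a) :=
  map rfl rfl range (all rfl (hU.comp fst) (eq snd (snd.comp fst)).not 1).not 1

end PolyFun

/-! ### The randomized algorithm -/

namespace Alg

/-- Every entry of `S` is kept with probability `1 / 2`. -/
noncomputable def halve (n : ℕ) (S : List ℕ) : PMF (List ℕ) :=
  PMF.fold (fun s x => (PMF.uniformOfFintype Bool).bind fun b =>
    PMF.pure (if b then x :: s else s)) (S.take (n ^ 1)) []

/-- Halving the list `U` as often as there are numbers from `j` to `n - 1`. -/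
noncomputable def sample (n : ℕ) (U : List ℕ) (j : ℕ) : PMF (List ℕ) :=
  PMF.fold (fun S _ => halve n S) (((List.range n).drop (min j n)).take (n ^ 1)) U

/-- Replacement of `B` by the output of the algorithm `A` on the subgraph induced on `W` if it is
better. -/
noncomputable def improve (A : ℕ → Data → PMF Data) (n : ℕ) (M : List (List Bool)) (B W : List ℕ) :
    PMF (List ℕ) :=
  (A n (code (induced n M W))).bind fun d => PMF.pure (better n M B (select n W d))

/-- Improvement by the algorithm `A` on a random subset of `U`. -/
noncomputable def trial (F : ℕ → ℕ → Bool) (m : ℕ) (A : ℕ → Data → PMF Data) (n : ℕ)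
    (M : List (List Bool)) (U B : List ℕ) (j : ℕ) : PMF (List ℕ) :=
  (sample n U j).bind fun S => if free F m n M S then improve A n M B S else PMF.pure B

/-- Improvement with the threshold `k + 1`: first by `A₂` on the removed sets, then by `A₁` on
random subsets of the remaining set. -/
noncomputable def round (F : ℕ → ℕ → Bool) (m : ℕ) (A₁ A₂ : ℕ → Data → PMF Data) (n : ℕ)
    (M : List (List Bool)) (B : List ℕ) (k : ℕ) : PMF (List ℕ) :=
  (PMF.fold (improve A₂ n M) ((strips F m n M (k + 1)).2.take (n ^ m)) B).bind fun B =>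
    PMF.fold (trial F m A₁ n M (strips F m n M (k + 1)).1) ((List.range n).take (n ^ 1)) B

/-- The first candidate. -/
def first (n : ℕ) : List ℕ := if (List.range n).isEmpty then [] else [0]

/-- The best set that is found. -/
noncomputable def search (F : ℕ → ℕ → Bool) (m : ℕ) (A₁ A₂ : ℕ → Data → PMF Data) (n : ℕ)
    (M : List (List Bool)) : PMF (List ℕ) :=
  PMF.fold (round F m A₁ A₂ n M) ((List.range n).take (n ^ 1)) (first n)

end Alg

/-! ### Polynomial-time computability of the randomized algorithm -/

namespace PolyRand

theorem halve : PolyRand (fun _ _ => True) Alg.halve := by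
  have h : PolyRand (α := List ℕ × List ℕ × ℕ) (fun _ _ => True) fun _ x =>
      (PMF.uniformOfFintype Bool).bind fun b =>
        PMF.pure (if b then x.2.2 :: x.2.1 else x.2.1) := by
    refine PolyRand.bind (Q := fun _ _ => True) (G := fun _ (y : (List ℕ × List ℕ × ℕ) × Bool) =>
      PMF.pure (if y.2 then y.1.2.2 :: y.1.2.1 else y.1.2.1)) toss ?_ fun _ _ _ _ _ => trivial
    refine PolyRand.pure (PolyFun.snd.ite (PolyFun.cons ?_ ?_) ?_)
    · exact PolyFun.snd.comp (PolyFun.snd.comp PolyFun.fst)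
    all_goals exact PolyFun.fst.comp (PolyFun.snd.comp PolyFun.fst)
  exact PolyRand.fold rfl PolyFun.id PolyFun.nil h (fun _ _ _ _ _ _ => trivial) 1

theorem sample : PolyRand (fun _ _ => True) fun n (x : List ℕ × ℕ) => Alg.sample n x.1 x.2 := by
  have h : PolyRand (α := (List ℕ × ℕ) × List ℕ × ℕ) (fun _ _ => True) fun n x =>
      Alg.halve n x.2.1 :=
    PolyRand.comp (Q := fun _ _ => True) halve (PolyFun.fst.comp PolyFun.snd) fun _ _ _ => trivial
  exact PolyRand.fold rfl (PolyFun.drop PolyFun.snd PolyFun.range) PolyFun.fst h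
    (fun _ _ _ _ _ _ => trivial) 1

theorem improve {D : ℕ → Data → Prop} {A : ℕ → Data → PMF Data} (hA : PolyRand D A) :
    PolyRand (fun n (x : List (List Bool) × List ℕ × List ℕ) =>
      D n (code (Alg.induced n x.1 x.2.2))) fun n x => Alg.improve A n x.1 x.2.1 x.2.2 := by
  refine PolyRand.bind (Q := fun _ _ => True)
    (G := fun n (y : (List (List Bool) × List ℕ × List ℕ) × Data) =>
      PMF.pure (Alg.better n y.1.1 y.1.2.1 (Alg.select n y.1.2.2 y.2)))
    (PolyRand.comp hA ((PolyFun.induced PolyFun.fst (PolyFun.snd.comp PolyFun.snd)).to_data)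
      fun _ _ h => h) (PolyRand.pure ?_) fun _ _ _ _ _ => trivial
  exact PolyFun.better (PolyFun.fst.comp PolyFun.fst)
    (PolyFun.fst.comp (PolyFun.snd.comp PolyFun.fst))
    (PolyFun.select (PolyFun.snd.comp (PolyFun.snd.comp PolyFun.fst)) PolyFun.snd)

variable {F : ℕ → ℕ → Bool} {m : ℕ} {D₁ D₂ : ℕ → Data → Prop} {A₁ A₂ : ℕ → Data → PMF Data}

section

attribute [local irreducible] Alg.strips Alg.free Alg.induced Alg.sample Alg.improve PMF.bind PMF.pure

/-- The test `free` guards the call, so the promise of `A₁` is demanded only for samples that pass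
it. -/
theorem trial (hA : PolyRand D₁ A₁) :
    PolyRand (fun n (x : List (List Bool) × List ℕ × List ℕ × ℕ) =>
      ∀ S ∈ (Alg.sample n x.2.1 x.2.2.2).support, Alg.free F m n x.1 S = true →
        D₁ n (code (Alg.induced n x.1 S)))
      fun n x => Alg.trial F m A₁ n x.1 x.2.1 x.2.2.1 x.2.2.2 := by
  refine PolyRand.bind
    (Q := fun n (y : (List (List Bool) × List ℕ × List ℕ × ℕ) × List ℕ) =>
      Alg.free F m n y.1.1 y.2 = true → D₁ n (code (Alg.induced n y.1.1 y.2)))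
    (G := fun n y => if Alg.free F m n y.1.1 y.2 then Alg.improve A₁ n y.1.1 y.1.2.2.1 y.2 else
      PMF.pure y.1.2.2.1)
    (PolyRand.comp (Q := fun _ _ => True) sample ((PolyFun.fst.comp PolyFun.snd).pair
      (PolyFun.snd.comp (PolyFun.snd.comp PolyFun.snd))) fun _ _ _ => trivial) ?_
    fun n a h S hS hF => h S hS hF
  have hB : PolyFun fun _ (y : (List (List Bool) × List ℕ × List ℕ × ℕ) × List ℕ) => y.1.2.2.1 :=
    PolyFun.fst.comp (PolyFun.snd.comp (PolyFun.snd.comp PolyFun.fst))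
  have hM : PolyFun fun _ (y : (List (List Bool) × List ℕ × List ℕ × ℕ) × List ℕ) => y.1.1 :=
    PolyFun.fst.comp PolyFun.fst
  exact PolyRand.ite (PolyFun.free hM PolyFun.snd)
    (PolyRand.comp (improve hA) (hM.pair (hB.pair PolyFun.snd)) fun n a h => h.1 h.2)
    (PolyRand.pure hB)

theorem round (hA₁ : PolyRand D₁ A₁) (hA₂ : PolyRand D₂ A₂) :
    PolyRand (fun n (x : List (List Bool) × List ℕ × ℕ) =>
      (∀ W ∈ (Alg.strips F m n x.1 (x.2.2 + 1)).2, D₂ n (code (Alg.induced n x.1 W))) ∧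
      ∀ j, ∀ S ∈ (Alg.sample n (Alg.strips F m n x.1 (x.2.2 + 1)).1 j).support,
        Alg.free F m n x.1 S = true → D₁ n (code (Alg.induced n x.1 S)))
      fun n x => Alg.round F m A₁ A₂ n x.1 x.2.1 x.2.2 := by
  have hst : PolyFun fun n (x : List (List Bool) × List ℕ × ℕ) =>
      Alg.strips F m n x.1 (x.2.2 + 1) :=
    PolyFun.strips PolyFun.fst (PolyFun.snd.comp PolyFun.snd).succ
  have h₂ : PolyRand (fun n (x : List (List Bool) × List ℕ × ℕ) =>
      (∀ W ∈ (Alg.strips F m n x.1 (x.2.2 + 1)).2, D₂ n (code (Alg.induced n x.1 W))) ∧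
      ∀ j, ∀ S ∈ (Alg.sample n (Alg.strips F m n x.1 (x.2.2 + 1)).1 j).support,
        Alg.free F m n x.1 S = true → D₁ n (code (Alg.induced n x.1 S)))
      fun n x => PMF.fold (Alg.improve A₂ n x.1)
        ((Alg.strips F m n x.1 (x.2.2 + 1)).2.take (n ^ m)) x.2.1 := by
    refine PolyRand.fold
      (Q := fun n (y : (List (List Bool) × List ℕ × ℕ) × List ℕ × List ℕ) =>
        D₂ n (code (Alg.induced n y.1.1 y.2.2)))
      (g := fun n y => Alg.improve A₂ n y.1.1 y.2.1 y.2.2) rfl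
      (PolyFun.snd.comp hst) (PolyFun.fst.comp PolyFun.snd) ?_ (fun n a h s W hW => h.1 W hW) m
    exact PolyRand.comp (improve hA₂) ((PolyFun.fst.comp PolyFun.fst).pair PolyFun.snd)
      fun _ _ h => h
  refine PolyRand.bind
    (Q := fun n (y : (List (List Bool) × List ℕ × ℕ) × List ℕ) =>
      ∀ j, ∀ S ∈ (Alg.sample n (Alg.strips F m n y.1.1 (y.1.2.2 + 1)).1 j).support,
        Alg.free F m n y.1.1 S = true → D₁ n (code (Alg.induced n y.1.1 S)))
    (G := fun n y => PMF.fold (Alg.trial F m A₁ n y.1.1 (Alg.strips F m n y.1.1 (y.1.2.2 + 1)).1)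
      ((List.range n).take (n ^ 1)) y.2) h₂ ?_ fun n a h _ _ => h.2
  refine PolyRand.fold
    (Q := fun n (z : ((List (List Bool) × List ℕ × ℕ) × List ℕ) × List ℕ × ℕ) =>
      ∀ S ∈ (Alg.sample n (Alg.strips F m n z.1.1.1 (z.1.1.2.2 + 1)).1 z.2.2).support,
        Alg.free F m n z.1.1.1 S = true → D₁ n (code (Alg.induced n z.1.1.1 S)))
    (g := fun n z => Alg.trial F m A₁ n z.1.1.1 (Alg.strips F m n z.1.1.1 (z.1.1.2.2 + 1)).1
      z.2.1 z.2.2) rfl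
    PolyFun.range PolyFun.snd ?_ (fun n a h s j _ => h j) 1
  exact PolyRand.comp (trial hA₁) ((PolyFun.fst.comp (PolyFun.fst.comp PolyFun.fst)).pair
    ((PolyFun.fst.comp (hst.comp (PolyFun.fst.comp PolyFun.fst))).pair PolyFun.snd)) fun _ _ h => h

end

/-- All thresholds and all rates are tried, so the promises of both algorithms must hold for every
`k` and `j`, not only for those used in the analysis. -/
theorem search (hA₁ : PolyRand D₁ A₁) (hA₂ : PolyRand D₂ A₂) {P : ℕ → List (List Bool) → Prop}
    (h₂ : ∀ n M, P n M → ∀ k, ∀ W ∈ (Alg.strips F m n M (k + 1)).2,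
      D₂ n (code (Alg.induced n M W)))
    (h₁ : ∀ n M, P n M → ∀ k j, ∀ S ∈ (Alg.sample n (Alg.strips F m n M (k + 1)).1 j).support,
        Alg.free F m n M S = true → D₁ n (code (Alg.induced n M S))) :
    PolyRand P fun n M => (Alg.search F m A₁ A₂ n M).bind fun B => PMF.pure (Alg.mask n B) := by
  refine PolyRand.bind (Q := fun _ _ => True)
    (G := fun n (y : List (List Bool) × List ℕ) => PMF.pure (Alg.mask n y.2)) ?_
    (PolyRand.pure (PolyFun.mask PolyFun.snd)) fun _ _ _ _ _ => trivial
  refine PolyRand.fold (Q := fun n (y : List (List Bool) × List ℕ × ℕ) => P n y.1)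
    (g := fun n y => Alg.round F m A₁ A₂ n y.1 y.2.1 y.2.2) rfl PolyFun.range
    (PolyFun.range.list_isEmpty.ite PolyFun.nil (PolyFun.cons PolyFun.zero PolyFun.nil))
    ((round hA₁ hA₂).mono fun n y hy => ⟨h₂ n _ hy _, h₁ n _ hy _⟩) (fun _ _ h _ _ _ => h) 1

end PolyRand

/-! ### Correctness of the deterministic parts -/

section

variable {n : ℕ}

open Classical in
/-- The adjacency matrix. -/
noncomputable def SimpleGraph.matrix (G : SimpleGraph (Fin n)) : List (List Bool) :=
  List.ofFn fun i => List.ofFn fun j => decide (G.Adj i j)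

theorem SimpleGraph.code_matrix (G : SimpleGraph (Fin n)) : code G.matrix = encodeGraph G := by
  simp only [matrix, encodeGraph, code, List.map_ofFn, Function.comp_def]

/-- The graph as a graph on the natural numbers. -/
def SimpleGraph.onNat (G : SimpleGraph (Fin n)) : SimpleGraph ℕ := G.map Fin.valEmbedding

theorem SimpleGraph.onNat_adj (G : SimpleGraph (Fin n)) (u v : Fin n) :
    G.onNat.Adj u v ↔ G.Adj u v :=
  SimpleGraph.map_adj_apply (f := Fin.valEmbedding)

namespace Alg

variable {G : SimpleGraph (Fin n)}

theorem le_iff {u v : ℕ} (hv : v ≤ n) : le n u v = true ↔ u ≤ v := by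
  rw [le, min_eq_left hv, decide_eq_true_iff, Nat.sub_eq_zero_iff_le]

theorem eq_iff {u v : ℕ} (hu : u ≤ n) (hv : v ≤ n) : eq n u v = true ↔ u = v := by
  rw [eq, Bool.and_eq_true, le_iff hv, le_iff hu, le_antisymm_iff]

open Classical in
theorem adj_iff {u v : ℕ} (hu : u < n) (hv : v < n) :
    adj n G.matrix u v = true ↔ G.onNat.Adj u v := by
  rw [adj, min_eq_left hu.le, min_eq_left hv.le]
  have h1 : (G.matrix.drop u).headD [] = List.ofFn fun j => decide (G.Adj ⟨u, hu⟩ j) := by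
    rw [List.headD_eq_head?_getD, List.head?_drop, SimpleGraph.matrix, List.getElem?_ofFn, dif_pos hu]
    simp
  rw [h1, List.headD_eq_head?_getD, List.head?_drop, List.getElem?_ofFn, dif_pos hv,
    Option.getD_some, decide_eq_true_iff]
  exact (G.onNat_adj ⟨u, hu⟩ ⟨v, hv⟩).symm

/-- The list `t` is a copy of the graph with adjacency matrix `F`. -/
def IsCopy (F : ℕ → ℕ → Bool) (m : ℕ) (G : SimpleGraph ℕ) (t : List ℕ) : Prop :=
  ∀ a ≤ m, ∀ b ≤ m, (t.getD a 0 = t.getD b 0 ↔ a = b) ∧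
    (G.Adj (t.getD a 0) (t.getD b 0) ↔ F a b = true)

theorem copy_iff {F : ℕ → ℕ → Bool} {m : ℕ} {t : List ℕ} (ht : t.length = m + 1)
    (htn : ∀ u ∈ t, u < n) : copy F m n G.matrix t = true ↔ IsCopy F m G.onNat t := by
  have key : ∀ a, (t.drop a).headD 0 = t.getD a 0 := by
    intro a
    rw [List.headD_eq_head?_getD, List.head?_drop, List.getD_eq_getElem?_getD]
  have hlt : ∀ a ≤ m, t.getD a 0 < n := by
    intro a ha
    rw [List.getD_eq_getElem _ _ (by omega)]
    exact htn _ (List.getElem_mem _)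
  simp only [copy, List.all_eq_true, List.mem_range, Nat.lt_succ_iff, key, Bool.and_eq_true, beq_iff_eq]
  refine forall₂_congr fun a ha => forall₂_congr fun b hb => and_congr ?_ ?_
  · rw [Bool.eq_iff_iff, eq_iff (hlt a ha).le (hlt b hb).le, beq_iff_eq]
  · rw [Bool.eq_iff_iff, adj_iff (hlt a ha) (hlt b hb)]

theorem foldl_cons_length (U : List ℕ) (T : List (List ℕ)) (s : List (List ℕ)) :
    (T.foldl (fun s t => U.foldl (fun s u => (u :: t) :: s) s) s).length =
      s.length + T.length * U.length := by
  have h : ∀ (t : List ℕ) (U : List ℕ) (s : List (List ℕ)),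
      (U.foldl (fun s u => (u :: t) :: s) s).length = s.length + U.length := by
    intro t U
    induction U with
    | nil => simp
    | cons u U ih => intro s; rw [List.foldl_cons, ih]; simp; omega
  induction T generalizing s with
  | nil => simp
  | cons t T ih => rw [List.foldl_cons, ih, h, List.length_cons, Nat.succ_mul]; omega

theorem mem_foldl_cons (U : List ℕ) (T : List (List ℕ)) (s : List (List ℕ)) (x : List ℕ) :
    x ∈ T.foldl (fun s t => U.foldl (fun s u => (u :: t) :: s) s) s ↔
      x ∈ s ∨ ∃ t ∈ T, ∃ u ∈ U, x = u :: t := by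
  have h : ∀ (t : List ℕ) (U : List ℕ) (s : List (List ℕ)),
      x ∈ U.foldl (fun s u => (u :: t) :: s) s ↔ x ∈ s ∨ ∃ u ∈ U, x = u :: t := by
    intro t U
    induction U with
    | nil => simp
    | cons u U ih => intro s; rw [List.foldl_cons, ih]; simp; tauto
  induction T generalizing s with
  | nil => simp
  | cons t T ih => rw [List.foldl_cons]; refine (ih _).trans ?_; rw [h]; simp [or_assoc]

/-- A set of at most `n` vertices has at most `n ^ m` tuples of length `m`, so the truncation inside
`tuples` has no effect. -/
theorem length_tuples {U : List ℕ} (hU : U.length ≤ n) (m : ℕ) :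
    (tuples n U m).length = U.length ^ m := by
  induction m with
  | zero => rfl
  | succ m ih =>
    rw [tuples, foldl_cons_length, List.take_of_length_le (by rw [ih]; exact Nat.pow_le_pow_left hU m),
      List.take_of_length_le (by rwa [pow_one]), ih, pow_succ]
    simp

theorem length_tuples_le {U : List ℕ} (hU : U.length ≤ n) (m : ℕ) :
    (tuples n U m).length ≤ n ^ m := by
  rw [length_tuples hU]; exact Nat.pow_le_pow_left hU m

theorem mem_tuples {U : List ℕ} (hU : U.length ≤ n) (m : ℕ) (t : List ℕ) :
    t ∈ tuples n U m ↔ t.length = m ∧ ∀ u ∈ t, u ∈ U := by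
  induction m generalizing t with
  | zero =>
    rw [tuples, List.mem_singleton, List.length_eq_zero_iff]
    constructor
    · rintro rfl; simp
    · exact fun h => h.1
  | succ m ih =>
    rw [tuples, mem_foldl_cons, List.take_of_length_le (length_tuples_le hU m),
      List.take_of_length_le (by rwa [pow_one])]
    constructor
    · rintro (h | ⟨t, ht, u, hu, rfl⟩)
      · simp at h
      · rw [ih] at ht
        refine ⟨by simp [ht.1], fun v hv => ?_⟩
        rcases List.mem_cons.1 hv with rfl | hv
        · exact hu
        · exact ht.2 v hv
    · rintro ⟨h, hU⟩
      cases t with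
      | nil => simp at h
      | cons u t =>
        exact Or.inr ⟨t, (ih t).2 ⟨by simpa using h, fun v hv => hU v (List.mem_cons_of_mem _ hv)⟩,
          u, hU u List.mem_cons_self, rfl⟩

variable {F : ℕ → ℕ → Bool} {m : ℕ}

theorem ext_eq {M : List (List Bool)} {U : List ℕ} (hU : U.length ≤ n) (t : List ℕ) :
    ext F m n M U t = U.filter fun v => copy F m n M (v :: t) := by
  rw [ext, List.take_of_length_le (by rwa [pow_one])]

theorem coext_eq {M : List (List Bool)} {U : List ℕ} (hU : U.length ≤ n) (t : List ℕ) :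
    coext F m n M U t = U.filter fun v => !copy F m n M (v :: t) := by
  rw [coext, List.take_of_length_le (by rwa [pow_one])]

/-- A list of different vertices. -/
def IsSet (n : ℕ) (U : List ℕ) : Prop := U.Nodup ∧ ∀ u ∈ U, u < n

theorem IsSet.length_le {U : List ℕ} (h : IsSet n U) : U.length ≤ n := by
  have := (List.subperm_of_subset h.1 (fun u hu => List.mem_range.2 (h.2 u hu))).length_le
  simpa using this

theorem IsSet.filter {U : List ℕ} (h : IsSet n U) (p : ℕ → Bool) : IsSet n (U.filter p) :=
  ⟨h.1.filter p, fun u hu => h.2 u (List.mem_of_mem_filter hu)⟩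

theorem isSet_range : IsSet n (List.range n) := ⟨List.nodup_range, fun _ hu => List.mem_range.1 hu⟩

theorem free_iff {M : List (List Bool)} {S : List ℕ} (hS : S.length ≤ n) :
    free F m n M S = true ↔
      ∀ t : List ℕ, t.length = m → (∀ u ∈ t, u ∈ S) → ∀ v ∈ S, copy F m n M (v :: t) = false := by
  rw [free, List.take_of_length_le (length_tuples_le hS m), List.all_eq_true]
  simp only [mem_tuples hS, ext_eq hS, List.isEmpty_iff, List.filter_eq_nil_iff, Bool.not_eq_true,
    and_imp]

/-- What is true after removal for the tuples in `T`. -/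
structure Stripped (F : ℕ → ℕ → Bool) (m n : ℕ) (M : List (List Bool)) (k : ℕ) (T : List (List ℕ))
    (x : List ℕ × List (List ℕ)) : Prop where
  isSet : IsSet n x.1
  isSet_mem : ∀ W ∈ x.2, IsSet n W
  le_length : ∀ W ∈ x.2, k ≤ W.length
  exists_tuple : ∀ W ∈ x.2, ∃ t ∈ T, ∀ v ∈ W, copy F m n M (v :: t) = true
  sum : x.1.length + (x.2.map List.length).sum = n
  length_le : x.2.length ≤ T.length
  cover : ∀ v < n, v ∈ x.1 ∨ ∃ W ∈ x.2, v ∈ W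
  few : ∀ t ∈ T, (x.1.filter fun v => copy F m n M (v :: t)).length < k

/-- Induction along the order in which the tuples are treated. The remaining set only shrinks, so
what was achieved for earlier tuples persists. -/
theorem stripped_foldl (M : List (List Bool)) {k : ℕ} (hk : 0 < k) (T : List (List ℕ)) :
    Stripped F m n M k T (T.foldl (strip F m n M k) (List.range n, [])) := by
  induction T using List.reverseRecOn with
  | nil =>
    exact ⟨isSet_range, by simp, by simp, by simp, by simp, by simp,
      fun v hv => Or.inl (List.mem_range.2 hv), by simp⟩
  | append_singleton T t ih =>
    rw [List.foldl_append, List.foldl_cons, List.foldl_nil]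
    generalize T.foldl (strip F m n M k) (List.range n, []) = x at ih
    have hx := ih.isSet.length_le
    have he := (ih.isSet.filter fun v => copy F m n M (v :: t)).length_le
    rw [strip, ext_eq hx, coext_eq hx, List.take_of_length_le (by rwa [pow_one])]
    by_cases h : le n k (x.1.filter fun v => copy F m n M (v :: t)).length = true
    · rw [if_pos h]
      rw [le_iff he] at h
      refine ⟨ih.isSet.filter _, ?_, ?_, ?_, ?_, ?_, ?_, ?_⟩
      · intro W hW
        rcases List.mem_cons.1 hW with rfl | hW
        · exact ih.isSet.filter _
        · exact ih.isSet_mem W hW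
      · intro W hW
        rcases List.mem_cons.1 hW with rfl | hW
        · exact h
        · exact ih.le_length W hW
      · intro W hW
        rcases List.mem_cons.1 hW with rfl | hW
        · exact ⟨t, by simp, fun v hv => (List.mem_filter.1 hv).2⟩
        · obtain ⟨t', ht', h'⟩ := ih.exists_tuple W hW
          exact ⟨t', by simp [ht'], h'⟩
      · have := ih.sum
        have h2 := List.length_eq_length_filter_add (l := x.1) fun v => copy F m n M (v :: t)
        simp only [List.map_cons, List.sum_cons]
        omega
      · simpa using ih.length_le
      · intro v hv
        rcases ih.cover v hv with hv | ⟨W, hW, hv⟩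
        · by_cases hc : copy F m n M (v :: t) = true
          · exact Or.inr ⟨_, List.mem_cons_self, List.mem_filter.2 ⟨hv, hc⟩⟩
          · exact Or.inl (List.mem_filter.2 ⟨hv, by simpa using hc⟩)
        · exact Or.inr ⟨W, List.mem_cons_of_mem _ hW, hv⟩
      · intro t' ht'
        rcases List.mem_append.1 ht' with ht' | ht'
        -- For an earlier tuple, the extensions that remain form a sublist of the previous ones.
        · exact (List.Sublist.length_le (List.Sublist.filter _ List.filter_sublist)).trans_lt
            (ih.few t' ht')
        · rw [List.mem_singleton] at ht'
          subst ht'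
          -- The current tuple has lost all its extensions, and `0 < k`.
          rw [List.filter_filter]
          simpa using hk
    · rw [if_neg h]
      rw [le_iff he, not_le] at h
      refine ⟨ih.isSet, ih.isSet_mem, ih.le_length, fun W hW => ?_, ih.sum, ?_, ih.cover, ?_⟩
      · obtain ⟨t', ht', h'⟩ := ih.exists_tuple W hW
        exact ⟨t', by simp [ht'], h'⟩
      · have := ih.length_le
        simp
        omega
      · intro t' ht'
        rcases List.mem_append.1 ht' with ht' | ht'
        · exact ih.few t' ht'
        · rw [List.mem_singleton] at ht'
          exact ht' ▸ h

theorem stripped (M : List (List Bool)) {k : ℕ} (hk : 0 < k) :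
    Stripped F m n M k (tuples n (List.range n) m) (strips F m n M k) := by
  rw [strips, List.take_of_length_le (length_tuples_le (by simp) m)]
  exact stripped_foldl M hk _

/-- The subgraph induced on a list of vertices. -/
def sub (G : SimpleGraph (Fin n)) (W : List ℕ) : SimpleGraph (Fin W.length) :=
  G.onNat.comap W.get

open Classical in
-- Thus the given algorithms receive the encoding of a genuine graph, to which their guarantees
-- apply.
theorem code_induced {W : List ℕ} (hW : IsSet n W) :
    code (induced n G.matrix W) = encodeGraph (sub G W) := by
  rw [← SimpleGraph.code_matrix]
  congr 1
  rw [induced, List.take_of_length_le (by rw [pow_one]; exact hW.length_le), SimpleGraph.matrix.eq_1 (sub G W)]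
  have h : ∀ {β : Type} (f : ℕ → β), W.map f = List.ofFn fun i => f (W.get i) := by
    intro β f
    conv_lhs => rw [← List.ofFn_get W, List.map_ofFn]
    rfl
  rw [h]
  congr 1
  funext i
  rw [h]
  congr 1
  funext j
  rw [Bool.eq_iff_iff, adj_iff (hW.2 _ (List.get_mem _ _)) (hW.2 _ (List.get_mem _ _)),
    decide_eq_true_iff]
  rfl

open Classical in
theorem select_eq {W : List ℕ} (hW : W.length ≤ n) (d : Data) :
    select n W d = (((List.finRange W.length).filter fun i : Fin W.length => decide (d.bit i)).map W.get).reverse := by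
  rw [select, List.take_of_length_le (by rwa [pow_one])]
  clear hW
  suffices h : ∀ (s : List ℕ), (W.foldl (fun (x : List ℕ × Data) w =>
      (if decide (x.2.hd ≠ Data.nil) then w :: x.1 else x.1, x.2.tl)) (s, d)).1 =
      (((List.finRange W.length).filter fun i : Fin W.length => decide (d.bit i)).map W.get).reverse ++ s by
    rw [h, List.append_nil]
  induction W generalizing d with
  | nil => intro s; simp
  | cons w W ih =>
    intro s
    rw [List.foldl_cons, ih]
    have h0 : d.bit 0 ↔ d.hd ≠ Data.nil := Iff.rfl
    have hfr : ((List.finRange (w :: W).length).filter fun i : Fin (w :: W).length =>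
        decide (d.bit i)).map (w :: W).get = (if d.hd ≠ Data.nil then [w] else []) ++
          ((List.finRange W.length).filter fun i : Fin W.length => decide (d.tl.bit i)).map W.get := by
      change ((List.finRange (W.length + 1)).filter fun i : Fin (W.length + 1) =>
        decide (d.bit i)).map (fun i : Fin (W.length + 1) => (w :: W).get i) = _
      rw [List.finRange_succ, List.filter_cons, List.filter_map]
      by_cases hd : d.hd = Data.nil
      · rw [if_neg (by simpa [h0] using hd), if_neg (by simpa using hd), List.map_map]
        rfl
      · rw [if_pos (by simpa [h0] using hd), if_pos hd, List.map_cons, List.map_map]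
        rfl
    rw [hfr]
    by_cases hd : d.hd = Data.nil
    · rw [if_neg (by simpa using hd), if_neg (by simpa using hd)]
      rfl
    · rw [if_pos (by simpa using hd), if_pos hd]
      simp

theorem isSet_select {W : List ℕ} (hW : IsSet n W) (d : Data) : IsSet n (select n W d) := by
  rw [select_eq hW.length_le]
  refine ⟨List.nodup_reverse.2 ?_, fun u hu => ?_⟩
  · exact ((List.nodup_finRange _).filter _).map (List.nodup_iff_injective_get.1 hW.1)
  · rw [List.mem_reverse, List.mem_map] at hu
    obtain ⟨i, -, rfl⟩ := hu
    exact hW.2 _ (List.get_mem _ _)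

theorem indep_iff {C : List ℕ} (hC : IsSet n C) :
    indep n G.matrix C = true ↔ ∀ u ∈ C, ∀ v ∈ C, ¬ G.onNat.Adj u v := by
  rw [indep, List.take_of_length_le (by rw [pow_one]; exact hC.length_le), List.all_eq_true]
  refine forall₂_congr fun u hu => ?_
  rw [List.all_eq_true]
  refine forall₂_congr fun v hv => ?_
  rw [← adj_iff (hC.2 u hu) (hC.2 v hv), Bool.not_eq_true', Bool.not_eq_true]

/-- An independent set. -/
def IsIndep (G : SimpleGraph (Fin n)) (B : List ℕ) : Prop :=
  IsSet n B ∧ ∀ u ∈ B, ∀ v ∈ B, ¬ G.onNat.Adj u v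

theorem better_eq {B C : List ℕ} (hB : IsSet n B) (hC : IsSet n C) :
    better n G.matrix B C = B ∧ (IsIndep G C → C.length < B.length) ∨
      better n G.matrix B C = C ∧ IsIndep G C ∧ B.length ≤ C.length := by
  have hB' := hB.length_le
  have hC' := hC.length_le
  rw [better, List.take_of_length_le (by rwa [pow_one]), List.take_of_length_le (by rwa [pow_one])]
  split
  · rename_i h
    rw [Bool.and_eq_true, indep_iff hC, le_iff hC'] at h
    exact Or.inr ⟨rfl, ⟨hC, h.1⟩, h.2⟩
  · rename_i h
    rw [Bool.and_eq_true, indep_iff hC, le_iff hC', not_and, not_le] at h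
    exact Or.inl ⟨rfl, fun hI => h hI.2⟩

/-- A candidate is tested before it is accepted, so a failed call of a given algorithm can never
spoil the current set. -/
theorem isIndep_better {B C : List ℕ} (hB : IsIndep G B) (hC : IsSet n C) :
    IsIndep G (better n G.matrix B C) := by
  rcases better_eq (G := G) hB.1 hC with h | h
  · rw [h.1]; exact hB
  · rw [h.1]; exact h.2.1

theorem length_le_better {B C : List ℕ} (hB : IsSet n B) (hC : IsSet n C) :
    B.length ≤ (better n G.matrix B C).length := by
  rcases better_eq (G := G) hB hC with h | h
  · rw [h.1]
  · rw [h.1]; exact h.2.2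

theorem length_le_better_of_isIndep {B C : List ℕ} (hB : IsSet n B) (hC : IsIndep G C) :
    C.length ≤ (better n G.matrix B C).length := by
  rcases better_eq (G := G) hB hC.1 with h | h
  · rw [h.1]; exact (h.2 hC).le
  · rw [h.1]

theorem isIndep_first : IsIndep G (first n) := by
  cases n with
  | zero => exact ⟨⟨by simp [first], by simp [first]⟩, by simp [first]⟩
  | succ n =>
    refine ⟨⟨by simp [first], by simp [first]⟩, ?_⟩
    simp [first]

theorem bit_code (l : List Bool) (k : ℕ) : (code l).bit k ↔ l.getD k false = true := by
  induction l generalizing k with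
  | nil =>
    have : ∀ k, Data.tl^[k] Data.nil = Data.nil := by
      intro k
      induction k with
      | zero => rfl
      | succ k ih => rw [Function.iterate_succ_apply]; exact ih
    rw [code_nil, Data.bit, this]
    simp [Data.hd]
  | cons b l ih =>
    cases k with
    | zero => cases b <;> simp [Data.bit, Data.hd, code, Data.ofBool, Data.ofList]
    | succ k =>
      rw [Data.bit, Function.iterate_succ_apply]
      exact ih k

theorem bit_mask {B : List ℕ} (hB : IsSet n B) (v : Fin n) : (code (mask n B)).bit v ↔ (v : ℕ) ∈ B := by
  rw [bit_code, mask, List.take_of_length_le (l := B) (by rw [pow_one]; exact hB.length_le),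
    List.take_of_length_le (by simp), List.getD_eq_getElem _ _ (by simp)]
  simp only [List.getElem_map, List.getElem_range, Bool.not_eq_true', List.all_eq_false,
    Bool.not_eq_false]
  constructor
  · rintro ⟨u, hu, h⟩
    rw [eq_iff (hB.2 u hu).le v.2.le] at h
    exact h ▸ hu
  · intro hv
    exact ⟨v, hv, (eq_iff v.2.le v.2.le).2 rfl⟩

end Alg

end

/-! ### Copies, induced subgraphs and independent sets -/

namespace Alg

section

variable {n : ℕ} {G : SimpleGraph (Fin n)}

open Classical in
/-- The adjacency matrix of a graph whose vertices are numbered. -/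
noncomputable def pattern {V : Type*} {m : ℕ} (H : SimpleGraph V) (e : V ≃ Fin (m + 1)) (a b : ℕ) :
    Bool :=
  decide (∃ (ha : a < m + 1) (hb : b < m + 1), H.Adj (e.symm ⟨a, ha⟩) (e.symm ⟨b, hb⟩))

theorem pattern_iff {V : Type*} {m : ℕ} (H : SimpleGraph V) (e : V ≃ Fin (m + 1)) (x y : V) :
    pattern H e (e x) (e y) = true ↔ H.Adj x y := by
  have h := fun z => Nat.le_of_lt_succ (e z).2
  simp [pattern, h]

theorem isCopy_pattern {V : Type*} {m : ℕ} {H : SimpleGraph V} {e : V ≃ Fin (m + 1)}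
    {G : SimpleGraph ℕ} {t : List ℕ} :
    IsCopy (pattern H e) m G t ↔ ∀ x y : V, (t.getD (e x) 0 = t.getD (e y) 0 ↔ x = y) ∧
      (G.Adj (t.getD (e x) 0) (t.getD (e y) 0) ↔ H.Adj x y) := by
  constructor
  · intro h x y
    have := h (e x) (by omega) (e y) (by omega)
    rwa [pattern_iff, Fin.val_inj, e.apply_eq_iff_eq] at this
  · intro h a ha b hb
    have := h (e.symm ⟨a, by omega⟩) (e.symm ⟨b, by omega⟩)
    rw [← pattern_iff H e, ← e.apply_eq_iff_eq, ← Fin.val_inj] at this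
    simpa using this

/-- An induced `H` in the subgraph, listed in the order of `e`, is a tuple that passes the test
`copy`. Its first entry then extends the rest, which `free` excludes. -/
theorem isFreeOf_of_free {V : Type*} {m : ℕ} {H : SimpleGraph V} {e : V ≃ Fin (m + 1)} {S : List ℕ}
    (hS : IsSet n S) (hF : free (pattern H e) m n G.matrix S = true) : (sub G S).IsFreeOf H := by
  rintro ⟨f⟩
  rw [free_iff hS.length_le] at hF
  set t : List ℕ := List.ofFn fun i : Fin (m + 1) => S.get (f (e.symm i)) with ht
  have hmem : ∀ u ∈ t, u ∈ S := by
    intro u hu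
    rw [ht, List.mem_ofFn] at hu
    obtain ⟨i, rfl⟩ := hu
    exact List.get_mem _ _
  have hcopy : copy (pattern H e) m n G.matrix t = true := by
    rw [copy_iff (by simp [ht]) (fun u hu => hS.2 u (hmem u hu)), isCopy_pattern]
    have hget : ∀ x, t.getD (e x) 0 = S.get (f x) := by
      intro x
      rw [ht, List.getD_eq_getElem _ _ (by rw [List.length_ofFn]; exact (e x).2), List.getElem_ofFn]
      simp
    intro x y
    rw [hget, hget, List.Nodup.get_inj_iff hS.1, f.injective.eq_iff]
    exact ⟨Iff.rfl, f.map_rel_iff⟩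
  rw [ht, List.ofFn_succ] at hcopy hmem
  have := hF _ (by simp) (fun u hu => hmem u (List.mem_cons_of_mem _ hu)) _
    (hmem _ List.mem_cons_self)
  rw [this] at hcopy
  exact absurd hcopy (by simp)

/-- All vertices of `W` are attached to `t` exactly as `v₀` is attached to `H₁ - v₀`. An induced
`H₂` inside `W` therefore completes `t` to the substituted graph, which is what the substitution was
made for. -/
theorem isFreeOf_of_copy {V V₁ V₂ : Type*} {m : ℕ} {H : SimpleGraph V} {H₁ : SimpleGraph V₁}
    {H₂ : SimpleGraph V₂} {v₀ : V₁} {e : V₁ ≃ Fin (m + 1)} (he : e v₀ = 0)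
    (hH : Nonempty (H ≃g H₁.substitute v₀ H₂)) (hG : G.IsFreeOf H) {W t : List ℕ}
    (hW : IsSet n W) (hW0 : 0 < W.length) (ht : t.length = m) (htn : ∀ u ∈ t, u < n)
    (hc : ∀ v ∈ W, copy (pattern H₁ e) m n G.matrix (v :: t) = true) :
    (sub G W).IsFreeOf H₂ := by
  rintro ⟨g⟩
  obtain ⟨i⟩ := hH
  have hcopy : ∀ v ∈ W, ∀ x y : V₁, ((v :: t).getD (e x) 0 = (v :: t).getD (e y) 0 ↔ x = y) ∧
      (G.onNat.Adj ((v :: t).getD (e x) 0) ((v :: t).getD (e y) 0) ↔ H₁.Adj x y) := by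
    intro v hv
    rw [← isCopy_pattern, ← copy_iff (by simp [ht])]
    · exact hc v hv
    · intro u hu
      rcases List.mem_cons.1 hu with rfl | hu
      · exact hW.2 u hv
      · exact htn u hu
  -- Since `e v₀ = 0`, the extending vertex is the head of the list and every other `x` sits in `t`
  -- at position `e x - 1`.
  have hpos : ∀ v (x : V₁), x ≠ v₀ → (v :: t).getD (e x) 0 = t.getD ((e x : ℕ) - 1) 0 := by
    intro v x hx
    have : (e x : ℕ) ≠ 0 := by
      intro h
      exact hx (e.injective (by rw [he]; exact Fin.ext h))
    obtain ⟨k, hk⟩ := Nat.exists_eq_succ_of_ne_zero this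
    rw [hk]
    rfl
  have hzero : ∀ v, (v :: t).getD (e v₀) 0 = v := by
    intro v
    rw [he]
    rfl
  have hlt : ∀ x : V₁, x ≠ v₀ → t.getD ((e x : ℕ) - 1) 0 < n := by
    intro x hx
    have : (e x : ℕ) ≠ 0 := by
      intro h
      exact hx (e.injective (by rw [he]; exact Fin.ext h))
    rw [List.getD_eq_getElem _ _ (by have := (e x).2; omega)]
    exact htn _ (List.getElem_mem _)
  have hWget : ∀ w : V₂, W.get (g w) ∈ W := fun w => List.get_mem _ _
  -- A single vertex of `W` is enough to see that `t` itself is a placement of `H₁ - v₀`.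
  obtain ⟨v, hv⟩ := List.exists_mem_of_length_pos hW0
  let φ : {x : V₁ // x ≠ v₀} ⊕ V₂ → Fin n
    | .inl x => ⟨t.getD ((e x.1 : ℕ) - 1) 0, hlt x.1 x.2⟩
    | .inr w => ⟨W.get (g w), hW.2 _ (hWget w)⟩
  have hφ : ∀ x y, (φ x = φ y ↔ x = y) ∧ (G.Adj (φ x) (φ y) ↔ (H₁.substitute v₀ H₂).Adj x y) := by
    intro x y
    rw [← G.onNat_adj, ← Fin.val_inj]
    rcases x with x | w <;> rcases y with y | w'
    · have := hcopy v hv x.1 y.1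
      rw [hpos v _ x.2, hpos v _ y.2] at this
      rw [Sum.inl.injEq, Subtype.ext_iff]
      exact this
    -- Pairs between the two sides are read off from the copy in which the vertex of `W` itself
    -- plays `v₀`; this also shows that it differs from all entries of `t`.
    · have := hcopy _ (hWget w') x.1 v₀
      rw [hpos _ _ x.2, hzero] at this
      refine ⟨?_, this.2⟩
      simp only [reduceCtorEq, iff_false]
      exact fun h => x.2 (this.1.1 h)
    · have := hcopy _ (hWget w) v₀ y.1
      rw [hpos _ _ y.2, hzero] at this
      refine ⟨?_, this.2.trans ⟨fun h => H₁.adj_symm h, fun h => H₁.adj_symm h⟩⟩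
      simp only [reduceCtorEq, iff_false]
      exact fun h => y.2 (this.1.1 h).symm
    · rw [Sum.inr.injEq]
      refine ⟨(List.Nodup.get_inj_iff hW.1).trans g.injective.eq_iff, ?_⟩
      exact g.map_rel_iff
  refine hG ⟨i.toEmbedding.trans ⟨⟨φ, fun x y h => (hφ x y).1.1 h⟩, (hφ _ _).2⟩⟩

open Classical in
/-- The set of positions that is described by a tree. -/
noncomputable def positions (k : ℕ) (d : Data) : Finset (Fin k) :=
  Finset.univ.filter fun i => d.bit i

theorem length_select {W : List ℕ} (hW : W.length ≤ n) (d : Data) :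
    (select n W d).length = (positions W.length d).card := by
  classical
  rw [select_eq hW, List.length_reverse, List.length_map]
  rw [positions, ← List.toFinset_card_of_nodup ((List.nodup_finRange _).filter _)]
  congr 1
  ext i
  simp

theorem mem_select {W : List ℕ} (hW : W.length ≤ n) (d : Data) (u : ℕ) :
    u ∈ select n W d ↔ ∃ i ∈ positions W.length d, W.get i = u := by
  classical
  rw [select_eq hW]
  simp [positions]

theorem isIndep_select {W : List ℕ} (hW : IsSet n W) {d : Data}
    (hd : (sub G W).IsIndepSet (positions W.length d : Set (Fin W.length))) :
    IsIndep G (select n W d) := by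
  refine ⟨isSet_select hW d, fun u hu v hv huv => ?_⟩
  rw [mem_select hW.length_le] at hu hv
  obtain ⟨i, hi, rfl⟩ := hu
  obtain ⟨j, hj, rfl⟩ := hv
  exact hd (Finset.mem_coe.2 hi) (Finset.mem_coe.2 hj) (fun h => huv.ne (by rw [h])) huv

theorem card_inter_le_indepNum {W : List ℕ} (hW : IsSet n W) {I : Finset ℕ}
    (hI : ∀ u ∈ I, ∀ v ∈ I, ¬ G.onNat.Adj u v) :
    (I.filter fun u => u ∈ W).card ≤ (sub G W).indepNum := by
  classical
  have h1 : (sub G W).IsIndepSet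
      ((Finset.univ.filter fun i : Fin W.length => W.get i ∈ I : Finset (Fin W.length)) :
        Set (Fin W.length)) := by
    intro i hi j hj _ hij
    simp only [Finset.coe_filter, Finset.mem_univ, true_and] at hi hj
    exact hI _ hi _ hj hij
  refine le_trans (le_of_eq ?_) h1.card_le_indepNum
  rw [← Finset.card_image_of_injective _ (List.nodup_iff_injective_get.1 hW.1)]
  congr 1
  ext u
  simp only [Finset.mem_filter, Finset.mem_image, Finset.mem_univ, true_and]
  constructor
  · rintro ⟨hu, huW⟩
    obtain ⟨i, rfl⟩ := List.get_of_mem huW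
    exact ⟨i, hu, rfl⟩
  · rintro ⟨i, hi, rfl⟩
    exact ⟨hi, List.get_mem _ _⟩

theorem exists_max_indep (G : SimpleGraph (Fin n)) :
    ∃ I : Finset ℕ, (∀ u ∈ I, u < n) ∧ (∀ u ∈ I, ∀ v ∈ I, ¬ G.onNat.Adj u v) ∧
      I.card = G.indepNum := by
  obtain ⟨s, hs⟩ := G.exists_isNIndepSet_indepNum
  refine ⟨s.map Fin.valEmbedding, ?_, ?_, by rw [Finset.card_map, hs.2]⟩
  · intro u hu
    obtain ⟨i, -, rfl⟩ := Finset.mem_map.1 hu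
    exact i.2
  · intro u hu v hv
    obtain ⟨i, hi, rfl⟩ := Finset.mem_map.1 hu
    obtain ⟨j, hj, rfl⟩ := Finset.mem_map.1 hv
    intro h
    have h' := (G.onNat_adj i j).1 h
    exact hs.1 hi hj h'.ne h'

theorem isApproxMIS_mask {B : List ℕ} (hB : IsIndep G B) {ρ : ℝ}
    (h : (G.indepNum : ℝ) ≤ ρ * B.length) :
    G.IsApproxMIS ρ (positions n (code (mask n B))) := by
  classical
  have hmem : ∀ v : Fin n, v ∈ positions n (code (mask n B)) ↔ (v : ℕ) ∈ B := by
    intro v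
    simp only [positions, Finset.mem_filter, Finset.mem_univ, true_and]
    exact bit_mask hB.1 v
  refine ⟨fun u hu v hv _ huv => ?_, ?_⟩
  · exact hB.2 _ ((hmem u).1 hu) _ ((hmem v).1 hv) ((G.onNat_adj u v).2 huv)
  · convert h using 3
    rw [← List.toFinset_card_of_nodup hB.1.1, ← Finset.card_map Fin.valEmbedding]
    congr 1
    ext u
    simp only [Finset.mem_map, hmem, List.mem_toFinset]
    constructor
    · rintro ⟨v, hv, rfl⟩
      exact hv
    · exact fun hu => ⟨⟨u, hB.1.2 u hu⟩, hu, rfl⟩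

/-- If the algorithm `A` is successful on the subgraph induced on `W` with probability at
least `c`, then so is the improvement step. -/
theorem le_improve {A : ℕ → Data → PMF Data} {W B : List ℕ} (hW : IsSet n W) (hB : IsIndep G B)
    {ρ : ℝ} (hρ : 0 ≤ ρ) {c : ENNReal}
    (hc : c ≤ (A n (encodeGraph (sub G W))).toOuterMeasure
      {d | (sub G W).IsApproxMIS ρ (positions W.length d)}) :
    c ≤ (improve A n G.matrix B W).toOuterMeasure
      {B' | ((sub G W).indepNum : ℝ) ≤ ρ * B'.length} := by
  rw [improve, code_induced hW]
  refine hc.trans ?_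
  refine (mul_one _).symm.trans_le (PMF.mul_le_toOuterMeasure_bind _ _ _ _ 1 fun d _ hd => ?_)
  rw [PMF.toOuterMeasure_eq_one]
  intro B' hB'
  rw [PMF.support_pure, Set.mem_singleton_iff] at hB'
  subst hB'
  refine hd.2.trans (mul_le_mul_of_nonneg_left ?_ hρ)
  rw [← length_select hW.length_le]
  exact_mod_cast length_le_better_of_isIndep hB.1 (isIndep_select hW hd.1)

theorem improve_mem {A : ℕ → Data → PMF Data} {W B : List ℕ} (hW : IsSet n W) (hB : IsIndep G B) :
    ∀ B' ∈ (improve A n G.matrix B W).support, IsIndep G B' ∧ B.length ≤ B'.length := by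
  intro B' hB'
  rw [improve, PMF.mem_support_bind_iff] at hB'
  obtain ⟨d, -, hd⟩ := hB'
  rw [PMF.support_pure, Set.mem_singleton_iff] at hd
  subst hd
  exact ⟨isIndep_better hB (isSet_select hW d), length_le_better hB.1 (isSet_select hW d)⟩

end

end Alg

/-! ### Calls of the given algorithms -/

theorem Polynomial.eval_nat_mono (T : Polynomial ℕ) {a b : ℕ} (h : a ≤ b) : T.eval a ≤ T.eval b := by
  rw [Polynomial.eval_eq_sum, Polynomial.eval_eq_sum]
  exact Finset.sum_le_sum fun i _ => Nat.mul_le_mul_left _ (Nat.pow_le_pow_left h i)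

/-- The ruler has the length `n` of the whole graph, while calls are made on subgraphs with `k ≤ n`
vertices. Monotonicity of `T` makes the budget `T n` sufficient, and after halting the success
probability no longer changes. -/
theorem SimpleGraph.PolyTimeOnFree.exists_output {V : Type*} {H : SimpleGraph V} {p : Prog}
    (hp : H.PolyTimeOnFree p) : ∃ T : Polynomial ℕ,
    ∀ (n k : ℕ) (G : SimpleGraph (Fin k)), k ≤ n → G.IsFreeOf H →
      (∀ c ∈ (Config.run (T.eval n) (p.start (encodeGraph G))).support, c.Halted) ∧
      ∀ (ρ : ℝ) (t : ℕ), (Config.run t (p.start (encodeGraph G))).toOuterMeasure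
          {c | c.Halted ∧ G.IsApproxMIS ρ (c.output k)} ≤
        (p.output T n (encodeGraph G)).toOuterMeasure {d | G.IsApproxMIS ρ (Alg.positions k d)} := by
  obtain ⟨T, hT⟩ := hp
  refine ⟨T, fun n k G hk hG => ?_⟩
  have h := Config.run_eq_of_halted (T.eval_nat_mono hk) (hT k G hG)
  have hh : ∀ c ∈ (Config.run (T.eval n) (p.start (encodeGraph G))).support, c.Halted := by
    rw [h]; exact hT k G hG
  refine ⟨hh, fun ρ t => ?_⟩
  refine (Config.toOuterMeasure_run_le_of_halted t hh _ fun d hd => hd.1).trans ?_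
  rw [Prog.output, PMF.toOuterMeasure_map_apply]
  exact (PMF.toOuterMeasure _).mono fun c hc => hc.2

theorem SimpleGraph.IsApproxMIS.mono {n : ℕ} {G : SimpleGraph (Fin n)} {ρ ρ' : ℝ} {S : Finset (Fin n)}
    (h : G.IsApproxMIS ρ S) (hρ : ρ ≤ ρ') : G.IsApproxMIS ρ' S :=
  ⟨h.1, h.2.trans (mul_le_mul_of_nonneg_right hρ (Nat.cast_nonneg _))⟩

/-- The limit `f → 1` is traded for a threshold `N` for each `c < 1`, uniformly in the size `n` of
the surrounding graph. -/
theorem SimpleGraph.ImprovedApproximationProperty.exists_output {V : Type*} {H : SimpleGraph V}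
    (h : H.ImprovedApproximationProperty) : ∃ ε : ℝ, 0 < ε ∧ ε < 1 ∧
      ∃ (p : Prog) (T : Polynomial ℕ),
        (∀ (n k : ℕ) (G : SimpleGraph (Fin k)), k ≤ n → G.IsFreeOf H →
          ∀ c ∈ (Config.run (T.eval n) (p.start (encodeGraph G))).support, c.Halted) ∧
        ∀ c : ENNReal, c < 1 → ∃ N, ∀ (n k : ℕ) (G : SimpleGraph (Fin k)), N ≤ k → k ≤ n →
          G.IsFreeOf H → c ≤ (p.output T n (encodeGraph G)).toOuterMeasure
            {d | G.IsApproxMIS ((k : ℝ) ^ (1 - ε)) (Alg.positions k d)} := by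
  obtain ⟨ε, hε, p, hp, f, hf, hfp⟩ := h
  obtain ⟨T, hT⟩ := hp.exists_output
  -- Decreasing `ε` weakens the guarantee once `k ≥ 1`, so `ε < 1` may be assumed.
  refine ⟨min ε (1 / 2), by positivity, by linarith [min_le_right ε (1 / 2)], p, T,
    fun n k G hk hG => (hT n k G hk hG).1, fun c hc => ?_⟩
  obtain ⟨N, hN⟩ := eventually_atTop.1 (hf.eventually (lt_mem_nhds hc))
  refine ⟨max N 1, fun n k G hNk hk hG => ?_⟩
  obtain ⟨t, ht⟩ := hfp k G hG
  refine (hN k ((le_max_left _ _).trans hNk)).le.trans (ht.trans (((hT n k G hk hG).2 _ t).trans ?_))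
  refine (PMF.toOuterMeasure _).mono fun d hd => SimpleGraph.IsApproxMIS.mono hd ?_
  refine Real.rpow_le_rpow_of_exponent_le ?_ (by linarith [min_le_left ε (1 / 2)])
  exact_mod_cast (le_max_right _ _).trans hNk

/-! ### Random subsets -/

namespace Alg

variable {n : ℕ}

/-- The lists that contain all elements of `A`. -/
def Above (A : Finset ℕ) : Set (List ℕ) := {r | A ⊆ r.toFinset}

theorem toOuterMeasure_bind_of_ite {α β : Type*} (p : PMF α) (q : α → PMF β) (t : Set α) (s : Set β)
    (c : ENNReal) (h₁ : ∀ a ∈ p.support, a ∈ t → (q a).toOuterMeasure s = c)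
    (h₀ : ∀ a ∈ p.support, a ∉ t → (q a).toOuterMeasure s = 0) :
    (p.bind q).toOuterMeasure s = p.toOuterMeasure t * c := by
  classical
  rw [PMF.toOuterMeasure_bind_apply, PMF.toOuterMeasure_apply, ← ENNReal.tsum_mul_right]
  refine tsum_congr fun a => ?_
  by_cases ha : a ∈ p.support
  · by_cases hat : a ∈ t
    · rw [Set.indicator_of_mem hat, h₁ a ha hat]
    · rw [Set.indicator_of_notMem hat, h₀ a ha hat, mul_zero, zero_mul]
  · have := (p.apply_eq_zero_iff a).2 ha
    by_cases hat : a ∈ t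
    · rw [Set.indicator_of_mem hat, this, zero_mul, zero_mul]
    · rw [Set.indicator_of_notMem hat, this, zero_mul, zero_mul]

theorem toOuterMeasure_pure_above (A : Finset ℕ) (s : List ℕ) :
    (PMF.pure s).toOuterMeasure (Above A) = if A ⊆ s.toFinset then 1 else 0 := by
  classical
  rw [PMF.toOuterMeasure_pure_apply]
  exact if_congr Iff.rfl rfl rfl

/-- Success means that every element of `A` not yet in `s` is still to come and that its coin shows
heads; the other coins do not matter. -/
theorem toOuterMeasure_fold_coin (A : Finset ℕ) (l : List ℕ) :
    ∀ s : List ℕ, l.Nodup → (∀ x ∈ l, x ∉ s) →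
      (PMF.fold (fun s x => (PMF.uniformOfFintype Bool).bind fun b =>
        PMF.pure (if b then x :: s else s)) l s).toOuterMeasure (Above A) =
        if A ⊆ s.toFinset ∪ l.toFinset then (2⁻¹ : ENNReal) ^ (A \ s.toFinset).card else 0 := by
  induction l with
  | nil =>
    intro s _ _
    rw [PMF.fold, toOuterMeasure_pure_above]
    by_cases h : A ⊆ s.toFinset
    · rw [if_pos h, if_pos (by simpa using h), Finset.sdiff_eq_empty_iff_subset.2 h]
      simp
    · rw [if_neg h, if_neg (by simpa using h)]
  | cons x l ih =>
    intro s hl hs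
    have hl' := (List.nodup_cons.1 hl)
    have hxs : x ∉ s.toFinset := by simpa using hs x List.mem_cons_self
    have hxl : x ∉ l.toFinset := by simpa using hl'.1
    have i₁ := ih (x :: s) hl'.2 fun y hy hys => by
      rcases List.mem_cons.1 hys with rfl | hys
      · exact hl'.1 hy
      · exact hs y (List.mem_cons_of_mem _ hy) hys
    have i₀ := ih s hl'.2 fun y hy => hs y (List.mem_cons_of_mem _ hy)
    rw [PMF.fold, PMF.bind_bind, PMF.toOuterMeasure_bind_apply, tsum_bool]
    simp only [PMF.pure_bind, if_true, Bool.false_eq_true, if_false]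
    rw [i₀, i₁, PMF.uniformOfFintype_apply, PMF.uniformOfFintype_apply, Fintype.card_bool, Nat.cast_two,
      ← mul_add]
    have e1 : (x :: s).toFinset ∪ l.toFinset = s.toFinset ∪ (x :: l).toFinset := by
      ext y; simp
    rw [e1]
    by_cases hxA : x ∈ A
    -- For `x ∈ A` the outcome tails loses `x` for good, because `x` occurs neither in `s` nor in
    -- `l`.
    · have h0 : ¬ A ⊆ s.toFinset ∪ l.toFinset := fun h => by
        rcases Finset.mem_union.1 (h hxA) with h | h
        · exact hxs h
        · exact hxl h
      rw [if_neg h0, zero_add]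
      split
      · have hc : (A \ s.toFinset).card = (A \ (x :: s).toFinset).card + 1 := by
          rw [List.toFinset_cons, Finset.sdiff_insert, Finset.card_erase_of_mem
            (Finset.mem_sdiff.2 ⟨hxA, hxs⟩)]
          have : 0 < (A \ s.toFinset).card := Finset.card_pos.2 ⟨x, Finset.mem_sdiff.2 ⟨hxA, hxs⟩⟩
          omega
        rw [hc, pow_succ, mul_comm]
      · rw [mul_zero]
    -- For `x ∉ A` both outcomes have the same success probability, and their average is this value.
    · have h1 : A ⊆ s.toFinset ∪ l.toFinset ↔ A ⊆ s.toFinset ∪ (x :: l).toFinset := by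
        rw [List.toFinset_cons, Finset.union_insert, Finset.subset_insert_iff_of_notMem hxA]
      have h2 : A \ (x :: s).toFinset = A \ s.toFinset := by
        rw [List.toFinset_cons, Finset.sdiff_insert, Finset.erase_eq_of_notMem]
        exact fun h => hxA (Finset.mem_sdiff.1 h).1
      rw [h2, if_congr h1 rfl rfl, ← two_mul, ← mul_assoc,
        ENNReal.inv_mul_cancel two_ne_zero ENNReal.ofNat_ne_top, one_mul]

theorem fold_coin_mem (l : List ℕ) : ∀ s : List ℕ, (l ++ s).Nodup →
    ∀ r ∈ (PMF.fold (fun s x => (PMF.uniformOfFintype Bool).bind fun b =>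
      PMF.pure (if b then x :: s else s)) l s).support, r.Nodup ∧ ∀ u ∈ r, u ∈ l ++ s := by
  induction l with
  | nil =>
    intro s hs r hr
    rw [PMF.fold, PMF.support_pure, Set.mem_singleton_iff] at hr
    subst hr
    exact ⟨hs, fun u hu => hu⟩
  | cons x l ih =>
    intro s hs r hr
    rw [PMF.fold, PMF.bind_bind, PMF.mem_support_bind_iff] at hr
    obtain ⟨b, -, hr⟩ := hr
    rw [PMF.pure_bind] at hr
    cases b with
    | false =>
      obtain ⟨h1, h2⟩ := ih s (List.nodup_cons.1 hs).2 r hr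
      exact ⟨h1, fun u hu => List.mem_cons_of_mem _ (h2 u hu)⟩
    | true =>
      obtain ⟨h1, h2⟩ := ih (x :: s) (List.perm_middle.nodup_iff.2 hs) r hr
      exact ⟨h1, fun u hu => List.perm_middle.mem_iff.1 (h2 u hu)⟩

theorem halve_mem {S : List ℕ} (hS : IsSet n S) : ∀ r ∈ (halve n S).support,
    IsSet n r ∧ ∀ u ∈ r, u ∈ S := by
  intro r hr
  rw [halve, List.take_of_length_le (by rw [pow_one]; exact hS.length_le)] at hr
  obtain ⟨h1, h2⟩ := fold_coin_mem S [] (by simpa using hS.1) r hr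
  rw [List.append_nil] at h2
  exact ⟨⟨h1, fun u hu => hS.2 u (h2 u hu)⟩, h2⟩

theorem toOuterMeasure_halve {S : List ℕ} (hS : IsSet n S) (A : Finset ℕ) :
    (halve n S).toOuterMeasure (Above A) =
      if A ⊆ S.toFinset then (2⁻¹ : ENNReal) ^ A.card else 0 := by
  rw [halve, List.take_of_length_le (by rw [pow_one]; exact hS.length_le),
    toOuterMeasure_fold_coin A S [] hS.1 (by simp)]
  simp

theorem sample_mem {U : List ℕ} (hU : IsSet n U) (j : ℕ) : ∀ r ∈ (sample n U j).support,
    IsSet n r ∧ ∀ u ∈ r, u ∈ U := by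
  refine PMF.fold_mem (I := fun r => IsSet n r ∧ ∀ u ∈ r, u ∈ U) (fun _ _ S hS r hr => ?_)
    ⟨hU, fun _ hu => hu⟩
  obtain ⟨h1, h2⟩ := halve_mem hS.1 r hr
  exact ⟨h1, fun u hu => hS.2 u (h2 u hu)⟩

/-- Each of the `n - j` halvings keeps `A` with probability `2⁻¹ ^ A.card`. These inclusion
probabilities are all that the analysis uses about the sample. -/
theorem toOuterMeasure_sample {U : List ℕ} (hU : IsSet n U) {j : ℕ} (hj : j ≤ n) {A : Finset ℕ}
    (hA : A ⊆ U.toFinset) :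
    (sample n U j).toOuterMeasure (Above A) = ((2⁻¹ : ENNReal) ^ (n - j)) ^ A.card := by
  have key : ∀ (l : List ℕ) (U : List ℕ), IsSet n U →
      (PMF.fold (fun S (_ : ℕ) => halve n S) l U).toOuterMeasure (Above A) =
        if A ⊆ U.toFinset then ((2⁻¹ : ENNReal) ^ l.length) ^ A.card else 0 := by
    intro l
    induction l with
    | nil =>
      intro U _
      rw [PMF.fold, toOuterMeasure_pure_above]
      simp
    | cons x l ih =>
      intro U hU
      rw [PMF.fold, toOuterMeasure_bind_of_ite (halve n U) _ (Above A) (Above A)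
        (((2⁻¹ : ENNReal) ^ l.length) ^ A.card)
        (fun a ha haA => by rw [ih a (halve_mem hU a ha).1]; exact if_pos haA)
        (fun a ha haA => by rw [ih a (halve_mem hU a ha).1]; exact if_neg haA),
        toOuterMeasure_halve hU]
      split
      · rw [← mul_pow, List.length_cons, pow_succ, mul_comm]
      · rw [zero_mul]
  have hlen : (((List.range n).drop (min j n)).take (n ^ 1)).length = n - j := by
    simp; omega
  rw [sample, key _ _ hU, if_pos hA, hlen]

end Alg

/-! ### Moments of random subsets -/

section Moments

variable {U : Finset ℕ} {w : Finset ℕ → ℝ} {q : ℝ}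

theorem sum_weight_mul_card_inter
    (hw : ∀ A ⊆ U, ∑ T ∈ U.powerset with A ⊆ T, w T = q ^ A.card) {I : Finset ℕ} (hI : I ⊆ U) :
    ∑ T ∈ U.powerset, w T * ((T ∩ I).card : ℝ) = q * I.card := by
  have h1 : ∀ T : Finset ℕ, w T * ((T ∩ I).card : ℝ) = ∑ v ∈ I, if {v} ⊆ T then w T else 0 := by
    intro T
    rw [Finset.inter_comm, ← Finset.filter_mem_eq_inter, Finset.card_filter, Nat.cast_sum,
      Finset.mul_sum]
    refine Finset.sum_congr rfl fun v _ => ?_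
    by_cases h : v ∈ T <;> simp [h]
  rw [Finset.sum_congr rfl fun T _ => h1 T, Finset.sum_comm]
  simp only [← Finset.sum_filter]
  rw [Finset.sum_congr rfl fun v hv => hw {v} (by simpa using hI hv)]
  simp [mul_comm]

/-- The square is a sum over ordered pairs. Diagonal pairs contribute `q` and the others `q ^ 2`;
counting the latter `I.card` times per point is where the inequality comes from. -/
theorem sum_weight_mul_card_inter_sq
    (hw : ∀ A ⊆ U, ∑ T ∈ U.powerset with A ⊆ T, w T = q ^ A.card) {I : Finset ℕ} (hI : I ⊆ U) :
    ∑ T ∈ U.powerset, w T * ((T ∩ I).card : ℝ) ^ 2 ≤ q * I.card + (q * I.card) ^ 2 := by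
  have h1 : ∀ T : Finset ℕ, w T * ((T ∩ I).card : ℝ) ^ 2 =
      ∑ u ∈ I, ∑ v ∈ I, if {u, v} ⊆ T then w T else 0 := by
    intro T
    rw [Finset.inter_comm, ← Finset.filter_mem_eq_inter, Finset.card_filter, Nat.cast_sum, sq,
      Finset.sum_mul_sum, Finset.mul_sum]
    refine Finset.sum_congr rfl fun u _ => ?_
    rw [Finset.mul_sum]
    refine Finset.sum_congr rfl fun v _ => ?_
    by_cases h : u ∈ T <;> by_cases h' : v ∈ T <;> simp [h, h', Finset.insert_subset_iff]
  rw [Finset.sum_congr rfl fun T _ => h1 T, Finset.sum_comm]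
  have h2 : ∀ u ∈ I, ∑ T ∈ U.powerset, ∑ v ∈ I, (if {u, v} ⊆ T then w T else 0) ≤
      q + I.card * q ^ 2 := by
    intro u hu
    rw [Finset.sum_comm]
    simp only [← Finset.sum_filter]
    rw [Finset.sum_congr rfl fun v hv => hw {u, v} (by
      rw [Finset.insert_subset_iff]; exact ⟨hI hu, by simpa using hI hv⟩)]
    rw [← Finset.add_sum_erase _ _ hu]
    refine add_le_add (by simp) ?_
    rw [Finset.sum_congr rfl fun v hv => by
      rw [Finset.card_pair (Finset.ne_of_mem_erase hv).symm], Finset.sum_const, nsmul_eq_mul]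
    gcongr
    exact Finset.erase_subset _ _
  refine (Finset.sum_le_sum h2).trans ?_
  rw [Finset.sum_const, nsmul_eq_mul]
  nlinarith

/-- A random subset of `U` that contains a set `A` with probability `q ^ A.card` is, with high
probability, not too large, contains no member of a family of few sets, and meets `I` in as many points as
expected, up to a factor of two. -/
theorem one_sub_le_sum_weight (hq : 0 < q) (hw0 : ∀ T, 0 ≤ w T)
    (hw : ∀ A ⊆ U, ∑ T ∈ U.powerset with A ⊆ T, w T = q ^ A.card) {I : Finset ℕ} (hI : I ⊆ U)
    (hI0 : 0 < I.card) {C : Finset (Finset ℕ)} {h : ℕ} (hC : ∀ A ∈ C, A ⊆ U ∧ A.card = h) {b : ℝ}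
    (hb : 0 < b) :
    1 - (C.card * q ^ h + q * U.card / b + 4 / (q * I.card)) ≤
      ∑ T ∈ U.powerset with ((∀ A ∈ C, ¬ A ⊆ T) ∧ (T.card : ℝ) ≤ b ∧
        q * I.card / 2 ≤ ((T ∩ I).card : ℝ)), w T := by
  classical
  set μ : ℝ := q * I.card with hμ
  have hμ0 : 0 < μ := by positivity
  have htot : ∑ T ∈ U.powerset, w T = 1 := by
    have := hw ∅ (by simp)
    simpa using this
  -- The expected number of members of `C` that survive, for Markov's inequality.
  have e1 : ∑ T ∈ U.powerset, w T * ∑ A ∈ C, (if A ⊆ T then (1 : ℝ) else 0) = C.card * q ^ h := by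
    simp only [Finset.mul_sum, mul_ite, mul_one, mul_zero]
    rw [Finset.sum_comm]
    simp only [← Finset.sum_filter]
    rw [Finset.sum_congr rfl fun A hA => (hw A (hC A hA).1).trans (by rw [(hC A hA).2]),
      Finset.sum_const, nsmul_eq_mul]
  have e2 : ∑ T ∈ U.powerset, w T * ((T.card : ℝ) / b) = q * U.card / b := by
    rw [← sum_weight_mul_card_inter hw subset_rfl, Finset.sum_div]
    refine Finset.sum_congr rfl fun T hT => ?_
    rw [Finset.inter_eq_left.2 (Finset.mem_powerset.1 hT), mul_div_assoc]
  -- Chebyshev: the variance is at most the mean `μ`, and the factor `4 / μ ^ 2` makes a deviation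
  -- by `μ / 2` count as one.
  have e3 : ∑ T ∈ U.powerset, w T * (4 * ((T ∩ I).card - μ) ^ 2 / μ ^ 2) ≤ 4 / μ := by
    have : ∀ T, w T * (4 * ((T ∩ I).card - μ) ^ 2 / μ ^ 2) = 4 / μ ^ 2 *
        (w T * ((T ∩ I).card : ℝ) ^ 2 - 2 * μ * (w T * ((T ∩ I).card : ℝ)) + μ ^ 2 * w T) := by
      intro T; ring
    simp only [this]
    rw [← Finset.mul_sum, Finset.sum_add_distrib, Finset.sum_sub_distrib, ← Finset.mul_sum,
      ← Finset.mul_sum, htot, sum_weight_mul_card_inter hw hI, ← hμ]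
    have h2 := sum_weight_mul_card_inter_sq hw hI
    rw [← hμ] at h2
    have : 4 / μ = 4 / μ ^ 2 * μ := by field_simp
    rw [this]
    refine mul_le_mul_of_nonneg_left ?_ (by positivity)
    linarith
  -- On a bad set one of the three penalties is at least one. Summation of this pointwise bound is
  -- the union bound.
  have hpt : ∀ T, w T ≤ (if ((∀ A ∈ C, ¬ A ⊆ T) ∧ (T.card : ℝ) ≤ b ∧
        μ / 2 ≤ ((T ∩ I).card : ℝ)) then w T else 0) +
      (w T * ∑ A ∈ C, (if A ⊆ T then (1 : ℝ) else 0) + w T * ((T.card : ℝ) / b) +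
        w T * (4 * ((T ∩ I).card - μ) ^ 2 / μ ^ 2)) := by
    intro T
    have p1 : 0 ≤ ∑ A ∈ C, (if A ⊆ T then (1 : ℝ) else 0) :=
      Finset.sum_nonneg fun A _ => by split <;> norm_num
    have p2 : 0 ≤ (T.card : ℝ) / b := by positivity
    have p3 : 0 ≤ 4 * (((T ∩ I).card : ℝ) - μ) ^ 2 / μ ^ 2 := by positivity
    by_cases hg : (∀ A ∈ C, ¬ A ⊆ T) ∧ (T.card : ℝ) ≤ b ∧ μ / 2 ≤ ((T ∩ I).card : ℝ)
    · rw [if_pos hg]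
      have := hw0 T
      have := mul_nonneg this p1
      have := mul_nonneg (hw0 T) p2
      have := mul_nonneg (hw0 T) p3
      linarith
    · rw [if_neg hg, zero_add, ← mul_add, ← mul_add]
      refine le_mul_of_one_le_right (hw0 T) ?_
      by_cases g1 : ∀ A ∈ C, ¬ A ⊆ T
      · by_cases g2 : (T.card : ℝ) ≤ b
        · have g3 : ((T ∩ I).card : ℝ) < μ / 2 := by
            by_contra hh
            exact hg ⟨g1, g2, not_lt.1 hh⟩
          have : 1 ≤ 4 * (((T ∩ I).card : ℝ) - μ) ^ 2 / μ ^ 2 := by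
            rw [le_div_iff₀ (by positivity)]
            nlinarith
          linarith
        · have : 1 ≤ (T.card : ℝ) / b := by
            rw [le_div_iff₀ hb]; linarith
          linarith
      · push Not at g1
        obtain ⟨A, hA, hAT⟩ := g1
        have : (1 : ℝ) ≤ ∑ A ∈ C, (if A ⊆ T then (1 : ℝ) else 0) := by
          refine le_trans (by rw [if_pos hAT]) (Finset.single_le_sum
            (f := fun A => if A ⊆ T then (1 : ℝ) else 0) (fun A _ => ?_) hA)
          split <;> norm_num
        linarith
  have hsum := Finset.sum_le_sum fun T (_ : T ∈ U.powerset) => hpt T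
  rw [htot, Finset.sum_add_distrib, Finset.sum_add_distrib, Finset.sum_add_distrib, e1, e2,
    ← Finset.sum_filter] at hsum
  linarith

end Moments

/-! ### Success on a random subset -/

namespace Alg

variable {n : ℕ} {G : SimpleGraph (Fin n)} {F : ℕ → ℕ → Bool} {m : ℕ}

theorem nodup_of_isCopy {G : SimpleGraph ℕ} {t : List ℕ} (ht : t.length = m + 1)
    (h : IsCopy F m G t) : t.Nodup := by
  rw [List.nodup_iff_injective_get]
  intro a b hab
  have := (h a (by omega) b (by omega)).1.1
  rw [List.getD_eq_getElem _ _ a.2, List.getD_eq_getElem _ _ b.2] at this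
  exact Fin.ext (this hab)

/-- The vertex sets of the copies in `U`. -/
def copies (F : ℕ → ℕ → Bool) (m n : ℕ) (M : List (List Bool)) (U : List ℕ) : Finset (Finset ℕ) :=
  (tuples n U m).toFinset.biUnion fun t =>
    (U.filter fun v => copy F m n M (v :: t)).toFinset.image fun v => (v :: t).toFinset

/-- A copy is determined by its tail and its head: there are at most `n ^ m` tails, each with fewer
than `k` heads left in `U`. -/
theorem card_copies_le {U : List ℕ} (hU : IsSet n U) {M : List (List Bool)} {k : ℕ}
    (hk : ∀ t ∈ tuples n (List.range n) m, (U.filter fun v => copy F m n M (v :: t)).length < k) :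
    (copies F m n M U).card ≤ n ^ m * k := by
  have h1 : (tuples n U m).toFinset.card ≤ n ^ m :=
    (List.toFinset_card_le _).trans (length_tuples_le hU.length_le m)
  refine (Finset.card_biUnion_le_card_mul _ _ k fun t ht => ?_).trans (Nat.mul_le_mul_right k h1)
  refine Finset.card_image_le.trans ((List.toFinset_card_le _).trans (hk t ?_).le)
  rw [List.mem_toFinset, mem_tuples hU.length_le] at ht
  rw [mem_tuples (by simp)]
  exact ⟨ht.1, fun u hu => List.mem_range.2 (hU.2 u (ht.2 u hu))⟩

theorem mem_copies {U : List ℕ} (hU : IsSet n U) {A : Finset ℕ}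
    (hA : A ∈ copies F m n G.matrix U) : A ⊆ U.toFinset ∧ A.card = m + 1 := by
  simp only [copies, Finset.mem_biUnion, Finset.mem_image, List.mem_toFinset, List.mem_filter,
    mem_tuples hU.length_le] at hA
  obtain ⟨t, ⟨ht, htU⟩, v, ⟨hv, hc⟩, rfl⟩ := hA
  have hU' : ∀ u ∈ v :: t, u ∈ U := by
    intro u hu
    rcases List.mem_cons.1 hu with rfl | hu
    · exact hv
    · exact htU u hu
  refine ⟨fun u hu => by simpa using hU' u (by simpa using hu), ?_⟩
  rw [copy_iff (by simp [ht]) (fun u hu => hU.2 u (hU' u hu))] at hc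
  rw [List.toFinset_card_of_nodup (nodup_of_isCopy (by simp [ht]) hc)]
  simp [ht]

theorem free_of_copies {U S : List ℕ} (hU : IsSet n U) (hS : IsSet n S) (hSU : ∀ u ∈ S, u ∈ U)
    {M : List (List Bool)} (h : ∀ A ∈ copies F m n M U, ¬ A ⊆ S.toFinset) :
    free F m n M S = true := by
  rw [free_iff hS.length_le]
  intro t ht htS v hv
  by_contra hc
  rw [Bool.not_eq_false] at hc
  refine h (v :: t).toFinset ?_ ?_
  · simp only [copies, Finset.mem_biUnion, Finset.mem_image, List.mem_toFinset, List.mem_filter,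
      mem_tuples hU.length_le]
    exact ⟨t, ⟨ht, fun u hu => hSU u (htS u hu)⟩, v, ⟨hSU v hv, hc⟩, rfl⟩
  · intro u hu
    rw [List.mem_toFinset] at hu ⊢
    rcases List.mem_cons.1 hu with rfl | hu
    · exact hv
    · exact htS u hu

theorem toReal_toOuterMeasure_eq_sum {ν : PMF (Finset ℕ)} {U : Finset ℕ}
    (h : ∀ T ∈ ν.support, T ⊆ U) (P : Finset ℕ → Prop) [DecidablePred P] :
    (ν.toOuterMeasure {T | P T}).toReal = ∑ T ∈ U.powerset with P T, (ν T).toReal := by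
  rw [← ENNReal.toReal_sum fun T _ => ν.apply_ne_top T, ← PMF.toOuterMeasure_apply_finset]
  congr 1
  apply PMF.toOuterMeasure_apply_eq_of_inter_support_eq
  ext T
  simp only [Set.mem_inter_iff, Set.mem_ofPred_eq, Finset.coe_filter, Finset.mem_powerset]
  exact ⟨fun hT => ⟨⟨h T hT.2, hT.1⟩, hT.2⟩, fun hT => ⟨hT.1.2, hT.2⟩⟩

/-- The probability that a random subset is good. -/
theorem le_toOuterMeasure_sample {U : List ℕ} (hU : IsSet n U) {j : ℕ} (hj : j ≤ n) {I : Finset ℕ}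
    (hI : I ⊆ U.toFinset) (hI0 : 0 < I.card) {b : ℝ} (hb : 0 < b) {q : ℝ} (hq : q = 2⁻¹ ^ (n - j)) :
    ENNReal.ofReal (1 - ((copies F m n G.matrix U).card * q ^ (m + 1) + q * U.length / b +
      4 / (q * I.card))) ≤ (sample n U j).toOuterMeasure
        {S | free F m n G.matrix S = true ∧ (S.length : ℝ) ≤ b ∧
          q * I.card / 2 ≤ ((S.toFinset ∩ I).card : ℝ)} := by
  classical
  -- Forgetting the order of the list turns the sample into weights on the subsets of `U`.
  set ν := (sample n U j).map List.toFinset with hν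
  have hsupp : ∀ T ∈ ν.support, T ⊆ U.toFinset := by
    intro T hT
    obtain ⟨S, hS, rfl⟩ := (PMF.mem_support_map_iff _ _ _).1 hT
    intro u hu
    rw [List.mem_toFinset] at hu ⊢
    exact (sample_mem hU j S hS).2 u hu
  have hw : ∀ A ⊆ U.toFinset, ∑ T ∈ U.toFinset.powerset with A ⊆ T, (ν T).toReal = q ^ A.card := by
    intro A hA
    rw [← toReal_toOuterMeasure_eq_sum hsupp, hν, PMF.toOuterMeasure_map_apply]
    have := toOuterMeasure_sample hU hj hA
    rw [Above] at this
    rw [Set.preimage_ofPred_eq, this, hq]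
    simp
  have hq0 : 0 < q := by rw [hq]; positivity
  have key := one_sub_le_sum_weight hq0 (fun T => ENNReal.toReal_nonneg) hw hI hI0
    (C := copies F m n G.matrix U) (fun A hA => mem_copies hU hA) hb
  rw [← toReal_toOuterMeasure_eq_sum hsupp, hν, PMF.toOuterMeasure_map_apply,
    List.toFinset_card_of_nodup hU.1] at key
  refine (ENNReal.ofReal_le_ofReal key).trans ?_
  rw [ENNReal.ofReal_toReal (ne_top_of_le_ne_top ENNReal.one_ne_top (PMF.toOuterMeasure_le_one _ _))]
  refine PMF.toOuterMeasure_mono _ fun S hS => ?_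
  have hS' := sample_mem hU j S hS.2
  have h := hS.1
  rw [Set.mem_preimage, Set.mem_ofPred_eq] at h
  refine ⟨free_of_copies hU hS'.1 hS'.2 h.1, ?_, h.2.2⟩
  rw [← List.toFinset_card_of_nodup hS'.1.1]
  exact h.2.1

theorem trial_mem {A : ℕ → Data → PMF Data} {U B : List ℕ} (hU : IsSet n U) (hB : IsIndep G B)
    (j : ℕ) : ∀ B' ∈ (trial F m A n G.matrix U B j).support, IsIndep G B' ∧ B.length ≤ B'.length := by
  intro B' hB'
  rw [trial, PMF.mem_support_bind_iff] at hB'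
  obtain ⟨S, hS, hB'⟩ := hB'
  split at hB'
  · exact improve_mem (sample_mem hU j S hS).1 hB B' hB'
  · rw [PMF.support_pure, Set.mem_singleton_iff] at hB'
    subst hB'
    exact ⟨hB, le_rfl⟩

variable {A₁ A₂ : ℕ → Data → PMF Data}

theorem round_mem {B : List ℕ} (hB : IsIndep G B) (k : ℕ) :
    ∀ B' ∈ (round F m A₁ A₂ n G.matrix B k).support, IsIndep G B' ∧ B.length ≤ B'.length := by
  have hst := stripped (F := F) (m := m) (n := n) G.matrix k.succ_pos
  intro B' hB'
  rw [round, PMF.mem_support_bind_iff] at hB'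
  obtain ⟨B₁, hB₁, hB'⟩ := hB'
  have h1 := PMF.fold_mem (I := fun C => IsIndep G C ∧ B.length ≤ C.length)
    (fun W hW C hC C' hC' => ?_) ⟨hB, le_rfl⟩ B₁ hB₁
  · refine PMF.fold_mem (I := fun C => IsIndep G C ∧ B.length ≤ C.length)
      (fun j _ C hC C' hC' => ?_) h1 B' hB'
    obtain ⟨h, h'⟩ := trial_mem hst.isSet hC.1 j C' hC'
    exact ⟨h, hC.2.trans h'⟩
  · obtain ⟨h, h'⟩ := improve_mem (hst.isSet_mem W (List.mem_of_mem_take hW)) hC.1 C' hC'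
    exact ⟨h, hC.2.trans h'⟩

theorem search_mem : ∀ B ∈ (search F m A₁ A₂ n G.matrix).support,
    IsIndep G B ∧ (first n).length ≤ B.length := by
  refine PMF.fold_mem (I := fun C => IsIndep G C ∧ (first n).length ≤ C.length)
    (fun k _ C hC C' hC' => ?_) ⟨isIndep_first, le_rfl⟩
  obtain ⟨h, h'⟩ := round_mem hC.1 k C' hC'
  exact ⟨h, hC.2.trans h'⟩

/-- The search is successful if one of its rounds is. -/
theorem le_search {r : ℕ} {c : ENNReal} {k : ℕ} (hk : k < n)
    (h : ∀ B, IsIndep G B → c ≤ (round F m A₁ A₂ n G.matrix B k).toOuterMeasure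
      {B' | r ≤ B'.length}) :
    c ≤ (search F m A₁ A₂ n G.matrix).toOuterMeasure {B | r ≤ B.length} := by
  refine PMF.le_fold (I := IsIndep G) (J := fun B => r ≤ B.length) (x := k)
    (fun k _ B hB B' hB' => (round_mem hB k B' hB').1)
    (fun k _ B hB hr B' hB' => hr.trans (round_mem hB k B' hB').2) ?_ h isIndep_first
  rw [List.take_of_length_le (by simp), List.mem_range]
  exact hk

theorem length_take_strips (M : List (List Bool)) (k : ℕ) :
    (strips F m n M (k + 1)).2.take (n ^ m) = (strips F m n M (k + 1)).2 :=
  List.take_of_length_le (((stripped M k.succ_pos).length_le).trans (length_tuples_le (by simp) m))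

/-- A round is successful if one of the calls of `A₂` is. -/
theorem le_round_of_improve {r : ℕ} {c : ENNReal} {k : ℕ} {W : List ℕ}
    (hW : W ∈ (strips F m n G.matrix (k + 1)).2)
    (h : ∀ B, IsIndep G B → c ≤ (improve A₂ n G.matrix B W).toOuterMeasure {B' | r ≤ B'.length})
    {B : List ℕ} (hB : IsIndep G B) :
    c ≤ (round F m A₁ A₂ n G.matrix B k).toOuterMeasure {B' | r ≤ B'.length} := by
  have hst := stripped (F := F) (m := m) (n := n) G.matrix k.succ_pos
  have hI : ∀ W ∈ (strips F m n G.matrix (k + 1)).2.take (n ^ m), ∀ B, IsIndep G B →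
      ∀ B' ∈ (improve A₂ n G.matrix B W).support, IsIndep G B' ∧ B.length ≤ B'.length :=
    fun W hW B hB => improve_mem (hst.isSet_mem W (List.mem_of_mem_take hW)) hB
  have h1 : c ≤ (PMF.fold (improve A₂ n G.matrix)
      ((strips F m n G.matrix (k + 1)).2.take (n ^ m)) B).toOuterMeasure {B' | r ≤ B'.length} :=
    PMF.le_fold (I := IsIndep G) (J := fun B => r ≤ B.length)
      (fun W hW B hB B' hB' => (hI W hW B hB B' hB').1)
      (fun W hW B hB hr B' hB' => hr.trans (hI W hW B hB B' hB').2)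
      (by rw [length_take_strips]; exact hW) h hB
  rw [round]
  refine h1.trans ((mul_one _).symm.trans_le (PMF.mul_le_toOuterMeasure_bind _ _ _ _ 1
    fun B₁ hB₁ hr => ?_))
  rw [PMF.toOuterMeasure_eq_one]
  have hB₁' := PMF.fold_mem (I := IsIndep G) (fun W hW B hB B' hB' => (hI W hW B hB B' hB').1) hB
    B₁ hB₁
  intro B' hB'
  have := PMF.fold_mem (I := fun C => IsIndep G C ∧ r ≤ C.length) (fun j _ C hC C' hC' => ?_)
    ⟨hB₁', hr⟩ B' hB'
  · exact this.2
  · have := trial_mem hst.isSet hC.1 j C' hC'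
    exact ⟨this.1, hC.2.trans this.2⟩

/-- A round is successful if one of the trials is. -/
theorem le_round_of_trial {r : ℕ} {c : ENNReal} {k j : ℕ} (hj : j < n)
    (h : ∀ B, IsIndep G B → c ≤ (trial F m A₁ n G.matrix (strips F m n G.matrix (k + 1)).1 B
      j).toOuterMeasure {B' | r ≤ B'.length})
    {B : List ℕ} (hB : IsIndep G B) :
    c ≤ (round F m A₁ A₂ n G.matrix B k).toOuterMeasure {B' | r ≤ B'.length} := by
  have hst := stripped (F := F) (m := m) (n := n) G.matrix k.succ_pos
  rw [round]
  refine PMF.le_toOuterMeasure_bind _ _ _ _ fun B₁ hB₁ => ?_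
  have hB₁' := PMF.fold_mem (I := IsIndep G) (fun W hW B hB B' hB' =>
    (improve_mem (hst.isSet_mem W (List.mem_of_mem_take hW)) hB B' hB').1) hB B₁ hB₁
  refine PMF.le_fold (I := IsIndep G) (J := fun B => r ≤ B.length) (x := j)
    (fun j _ B hB B' hB' => (trial_mem hst.isSet hB j B' hB').1)
    (fun j _ B hB hr B' hB' => hr.trans (trial_mem hst.isSet hB j B' hB').2) ?_ h hB₁'
  rw [List.take_of_length_le (by simp), List.mem_range]
  exact hj

/-- A trial is successful if the call of `A₁` on a good random subset is. -/
theorem le_trial {r : ℕ} {U B : List ℕ} (hU : IsSet n U) {j : ℕ} (hj : j ≤ n) {I : Finset ℕ}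
    (hI : I ⊆ U.toFinset) (hI0 : 0 < I.card) {b : ℝ} (hb : 0 < b) {q : ℝ} (hq : q = 2⁻¹ ^ (n - j))
    {c : ENNReal}
    (h : ∀ S, IsSet n S → free F m n G.matrix S = true → (S.length : ℝ) ≤ b →
      q * I.card / 2 ≤ ((S.toFinset ∩ I).card : ℝ) →
      c ≤ (improve A₁ n G.matrix B S).toOuterMeasure {B' | r ≤ B'.length}) :
    ENNReal.ofReal (1 - ((copies F m n G.matrix U).card * q ^ (m + 1) + q * U.length / b +
      4 / (q * I.card))) * c ≤
      (trial F m A₁ n G.matrix U B j).toOuterMeasure {B' | r ≤ B'.length} := by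
  refine (mul_le_mul_left (le_toOuterMeasure_sample (F := F) (m := m) (G := G) hU hj hI hI0 hb hq) c).trans ?_
  rw [trial]
  refine PMF.mul_le_toOuterMeasure_bind _ _ _ _ c fun S hS hg => ?_
  rw [if_pos hg.1]
  exact h S (sample_mem hU j S hS).1 hg.1 hg.2.1 hg.2.2

end Alg

/-! ### The success probability -/

/-- Only powers of two are available as sampling rates, and they hit `x⁻¹` up to a factor of two.
The exponent is positive since `2 ≤ x`, and at most `n` since `i < 2 ^ i ≤ x ≤ n`. -/
theorem exists_pow_two_inv {n : ℕ} {x : ℝ} (h2 : 2 ≤ x) (hn : x ≤ n) :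
    ∃ j < n, x⁻¹ ≤ (2⁻¹ : ℝ) ^ (n - j) ∧ (2⁻¹ : ℝ) ^ (n - j) ≤ 2 * x⁻¹ := by
  have hf : 2 ≤ ⌊x⌋₊ := Nat.le_floor (by exact_mod_cast h2)
  set i := Nat.log 2 ⌊x⌋₊ with hi
  have hi0 : 0 < i := Nat.log_pos (by norm_num) hf
  have h1 : 2 ^ i ≤ ⌊x⌋₊ := Nat.pow_log_le_self 2 (by omega)
  have h1' : (2 : ℝ) ^ i ≤ x := le_trans (by exact_mod_cast h1) (Nat.floor_le (by linarith))
  have h3 : ⌊x⌋₊ + 1 ≤ 2 ^ (i + 1) := Nat.lt_pow_succ_log_self (by norm_num) _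
  have h3' : x ≤ (2 : ℝ) ^ (i + 1) := (Nat.lt_floor_add_one x).le.trans (by exact_mod_cast h3)
  have hin : i < n := by
    have : i < 2 ^ i := Nat.lt_two_pow_self
    have : ⌊x⌋₊ ≤ n := Nat.floor_le_of_le hn
    omega
  refine ⟨n - i, by omega, ?_⟩
  rw [show n - (n - i) = i by omega, inv_pow]
  refine ⟨inv_anti₀ (by positivity) h1', ?_⟩
  rw [← div_eq_mul_inv, le_div_iff₀ (by linarith), inv_mul_le_iff₀ (by positivity)]
  rw [pow_succ] at h3'
  exact h3'

/-! ### The exponents and the analysis of the search -/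

namespace Alg

variable {n : ℕ} {G : SimpleGraph (Fin n)} {F : ℕ → ℕ → Bool} {m : ℕ}
  {A₁ A₂ : ℕ → Data → PMF Data}

/-- The sets are peeled off one at a time: points of `W` are charged to `W`, all others to the rest
of the family. -/
theorem card_le_card_inter_add {U : List ℕ} {Ws : List (List ℕ)} {I : Finset ℕ}
    (hcov : ∀ v ∈ I, v ∈ U ∨ ∃ W ∈ Ws, v ∈ W) {a : ℝ}
    (ha : ∀ W ∈ Ws, ((I.filter fun v => v ∈ W).card : ℝ) ≤ a) :
    (I.card : ℝ) ≤ ((I.filter fun v => v ∈ U).card : ℝ) + Ws.length * a := by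
  induction Ws generalizing I with
  | nil =>
    rw [Finset.filter_true_of_mem fun v hv => by simpa using hcov v hv]
    simp
  | cons W Ws ih =>
    have h := ih (I := I.filter fun v => v ∉ W) (fun v hv => ?_) fun W' hW' => ?_
    · have h1 := Finset.card_filter_add_card_filter_not (s := I) fun v => v ∈ W
      have h2 : ((I.filter fun v => v ∉ W).filter fun v => v ∈ U).card ≤
          (I.filter fun v => v ∈ U).card :=
        Finset.card_le_card (Finset.filter_subset_filter _ (Finset.filter_subset _ _))
      have h3 := ha W List.mem_cons_self
      have h1' : ((I.filter fun v => v ∈ W).card : ℝ) + ((I.filter fun v => v ∉ W).card : ℝ) =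
        I.card := by exact_mod_cast h1
      have h2' : (((I.filter fun v => v ∉ W).filter fun v => v ∈ U).card : ℝ) ≤
          (I.filter fun v => v ∈ U).card := by exact_mod_cast h2
      rw [List.length_cons]
      push_cast
      linarith
    · rw [Finset.mem_filter] at hv
      rcases hcov v hv.1 with h | ⟨W', hW', h⟩
      · exact Or.inl h
      · rcases List.mem_cons.1 hW' with rfl | hW'
        · exact absurd h hv.2
        · exact Or.inr ⟨W', hW', h⟩
    · refine le_trans ?_ (ha W' (List.mem_cons_of_mem _ hW'))
      exact_mod_cast Finset.card_le_card
        (Finset.filter_subset_filter _ (Finset.filter_subset _ _))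

/-- The sizes of the removed sets sum to at most `n`, and each size is at least `k`. -/
theorem length_mul_le {M : List (List Bool)} {k : ℕ} {T : List (List ℕ)}
    {x : List ℕ × List (List ℕ)} (h : Stripped F m n M k T x) : x.2.length * k ≤ n := by
  have h1 : (x.2.map List.length).length • k ≤ (x.2.map List.length).sum :=
    List.card_nsmul_le_sum _ _ fun l hl => by
      obtain ⟨W, hW, rfl⟩ := List.mem_map.1 hl
      exact h.le_length W hW
  rw [List.length_map, smul_eq_mul] at h1
  have := h.sum
  omega

/-- A call of `A` on a subgraph whose independence number is within a factor `s` of the target is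
successful. -/
theorem le_improve_of_indepNum {A : ℕ → Data → PMF Data} {W B : List ℕ} (hW : IsSet n W)
    (hB : IsIndep G B) {ε : ℝ} {c : ENNReal}
    (hc : c ≤ (A n (encodeGraph (sub G W))).toOuterMeasure
      {d | (sub G W).IsApproxMIS ((W.length : ℝ) ^ (1 - ε)) (positions W.length d)})
    {r : ℕ} {s : ℝ} (hs : 0 ≤ s) {R : ℝ} (hr : ∀ b : ℕ, R ≤ b → r ≤ b)
    (h : R ≤ s * (sub G W).indepNum) (h' : s * (W.length : ℝ) ^ (1 - ε) ≤ 1) :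
    c ≤ (improve A n G.matrix B W).toOuterMeasure {B' | r ≤ B'.length} := by
  refine (le_improve hW hB (by positivity) hc).trans ((PMF.toOuterMeasure _).mono fun B' hB' => ?_)
  rw [Set.mem_ofPred_eq] at hB'
  refine hr _ (h.trans ?_)
  refine (mul_le_mul_of_nonneg_left hB' hs).trans ?_
  rw [← mul_assoc]
  exact mul_le_of_le_one_left (Nat.cast_nonneg _) h'

/-- The trial on a large remaining set with few copies is successful. -/
theorem le_trial_of_exponents {n : ℕ} {G : SimpleGraph (Fin n)} {ε₁ γ δ ε κ : ℝ} {N₁ : ℕ}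
    (hε₁ : 0 < ε₁) (hε₁' : ε₁ < 1) (hδ : δ * (2 * (m + 1)) = γ) (hδ0 : 0 < δ)
    (hε : ε = δ * ε₁ / 4) {X : ℝ} (hX : X = n) (hX1 : 1 ≤ X)
    (hd : 2 ≤ X ^ (1 - δ)) (hN₁ : (N₁ : ℝ) ≤ X ^ (δ - ε) / 4)
    (herr : 2 ^ (m + 2) * X ^ (-γ / 2) + X ^ (-ε) + 8 * X ^ (-(δ - ε)) ≤ κ)
    (hf : 8 * X ^ (-(δ * ε₁ / 2)) ≤ 1) {c : ENNReal}
    (hA₁ : ∀ S, IsSet n S → free F m n G.matrix S = true → N₁ ≤ S.length →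
      c ≤ (A₁ n (encodeGraph (sub G S))).toOuterMeasure
        {d | (sub G S).IsApproxMIS ((S.length : ℝ) ^ (1 - ε₁)) (positions S.length d)})
    {U : List ℕ} (hU : IsSet n U) {a : ℝ} (ha : X ^ (1 - ε) ≤ a) {I : Finset ℕ}
    (hI : ∀ u ∈ I, ∀ v ∈ I, ¬ G.onNat.Adj u v) (hIU : I ⊆ U.toFinset) (haI : a ≤ 2 * I.card)
    (hcop : ((copies F m n G.matrix U).card : ℝ) ≤ X ^ m * (2 * X ^ (1 - γ)))
    {r : ℕ} (hr : ∀ b : ℕ, a / X ^ (1 - ε) ≤ b → r ≤ b) :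
    ∃ j < n, ∀ B, IsIndep G B → ENNReal.ofReal (1 - κ) * c ≤
      (trial F m A₁ n G.matrix U B j).toOuterMeasure {B' | r ≤ B'.length} := by
  have hX0 : 0 < X := by linarith
  have hadd : ∀ s t : ℝ, X ^ s * X ^ t = X ^ (s + t) := fun s t => (Real.rpow_add hX0 s t).symm
  have hpos : ∀ s : ℝ, 0 < X ^ s := fun s => Real.rpow_pos_of_pos hX0 s
  obtain ⟨j, hj, hq1, hq2⟩ := exists_pow_two_inv (n := n) hd (by
    rw [← hX]
    calc X ^ (1 - δ) ≤ X ^ (1 : ℝ) := Real.rpow_le_rpow_of_exponent_le hX1 (by linarith)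
      _ = X := Real.rpow_one X)
  refine ⟨j, hj, fun B hB => ?_⟩
  set q : ℝ := 2⁻¹ ^ (n - j) with hq
  rw [← Real.rpow_neg hX0.le] at hq1 hq2
  have hq0 : 0 < q := (hpos _).trans_le hq1
  have hI1 : X ^ (1 - ε) / 2 ≤ I.card := by linarith
  have hI0 : (0 : ℝ) < I.card := lt_of_lt_of_le (by have := hpos (1 - ε); positivity) hI1
  -- The size cap exceeds `q * X`, a bound for the expected size, by the factor `X ^ ε`; Markov's
  -- inequality then has error `X ^ (-ε)`.
  set b : ℝ := X ^ ε * (q * X) with hb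
  have hb0 : 0 < b := by have := hpos ε; positivity
  have hqI : X ^ (δ - ε) / 2 ≤ q * I.card := by
    calc X ^ (δ - ε) / 2 = X ^ (-(1 - δ)) * (X ^ (1 - ε) / 2) := by
          rw [← mul_div_assoc, hadd]; congr 2; ring
      _ ≤ q * I.card := mul_le_mul hq1 hI1 (by have := hpos (1 - ε); positivity) hq0.le
  have hbX : b ≤ 2 * X ^ (ε + δ) := by
    calc b ≤ X ^ ε * (2 * X ^ (-(1 - δ)) * X) := by
          rw [hb]; gcongr
      _ = 2 * (X ^ ε * (X ^ (-(1 - δ)) * X ^ (1 : ℝ))) := by rw [Real.rpow_one]; ring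
      _ = 2 * X ^ (ε + δ) := by rw [hadd, hadd]; congr 2; ring
  -- The exponents add up to `m + (1 - γ) - (1 - δ) (m + 1) = δ (m + 1) - γ = -γ / 2`, by the choice
  -- of `δ`.
  have e1 : (copies F m n G.matrix U).card * q ^ (m + 1) ≤ 2 ^ (m + 2) * X ^ (-γ / 2) := by
    calc (copies F m n G.matrix U).card * q ^ (m + 1)
        ≤ X ^ m * (2 * X ^ (1 - γ)) * (2 * X ^ (-(1 - δ))) ^ (m + 1) := by
          gcongr
      _ = 2 ^ (m + 2) * (X ^ (m : ℝ) * X ^ (1 - γ) * X ^ (-(1 - δ) * ((m + 1 : ℕ) : ℝ))) := by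
          rw [mul_pow, Real.rpow_mul_natCast hX0.le, Real.rpow_natCast]
          ring
      _ = 2 ^ (m + 2) * X ^ (-γ / 2) := by
          rw [hadd, hadd]
          congr 2
          push_cast
          linarith
  have e2 : q * U.length / b ≤ X ^ (-ε) := by
    rw [div_le_iff₀ hb0, hb, ← mul_assoc, hadd, neg_add_cancel, Real.rpow_zero, one_mul, hX]
    gcongr
    exact_mod_cast hU.length_le
  have e3 : 4 / (q * I.card) ≤ 8 * X ^ (-(δ - ε)) := by
    rw [div_le_iff₀ (by positivity)]
    calc (4 : ℝ) = 8 * X ^ (-(δ - ε)) * (X ^ (δ - ε) / 2) := by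
          rw [mul_assoc, ← mul_div_assoc, hadd, neg_add_cancel, Real.rpow_zero]; norm_num
      _ ≤ _ := mul_le_mul_of_nonneg_left hqI (by have := hpos (-(δ - ε)); positivity)
  refine le_trans ?_ (le_trial (G := G) (F := F) (m := m) (A₁ := A₁) (B := B) (r := r) (c := c) hU hj.le
    hIU (by exact_mod_cast hI0) hb0 hq fun S hS hfree hSb hSI => ?_)
  · refine mul_le_mul_left (ENNReal.ofReal_le_ofReal ?_) c
    linarith
  have hind : q * I.card / 2 ≤ (sub G S).indepNum := by
    refine hSI.trans ?_
    have := card_inter_le_indepNum (G := G) hS hI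
    rw [Finset.inter_comm, ← Finset.filter_mem_eq_inter]
    simp only [List.mem_toFinset]
    exact_mod_cast this
  have hlen : ((S.toFinset ∩ I).card : ℝ) ≤ S.length := by
    exact_mod_cast (Finset.card_le_card Finset.inter_subset_left).trans (List.toFinset_card_le S)
  have hSN : N₁ ≤ S.length := by
    -- The sample contains at least `q * I.card / 2 ≥ X ^ (δ - ε) / 4` vertices of `I`, so it is
    -- large enough for the guarantee of `A₁`.
    have : (N₁ : ℝ) ≤ S.length := by linarith
    exact_mod_cast this
  -- The factor `s` compares the target `a / X ^ (1 - ε)` with the independence number of the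
  -- sample, which is at least `q * a / 4`, where `q ≥ X ^ (δ - 1)`.
  refine le_improve_of_indepNum hS hB (hA₁ S hS hfree hSN) (s := 4 * X ^ (ε - δ))
    (by have := hpos (ε - δ); positivity) hr ?_ ?_
  · rw [div_le_iff₀ (hpos _)]
    have h1 : 4 * X ^ (ε - δ) * (sub G S).indepNum * X ^ (1 - ε) =
        4 * X ^ (1 - δ) * (sub G S).indepNum := by
      rw [mul_right_comm, mul_assoc 4, hadd]
      congr 3
      ring
    rw [h1]
    have h2 : 1 ≤ X ^ (1 - δ) * q := by
      calc 1 = X ^ (1 - δ) * X ^ (-(1 - δ)) := by rw [hadd, add_neg_cancel, Real.rpow_zero]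
        _ ≤ _ := mul_le_mul_of_nonneg_left hq1 (hpos _).le
    calc a ≤ 2 * I.card := haI
      _ ≤ 2 * (I.card * (X ^ (1 - δ) * q)) := by
          have := mul_le_mul_of_nonneg_left h2 hI0.le
          linarith
      _ = 4 * X ^ (1 - δ) * (q * I.card / 2) := by ring
      _ ≤ _ := mul_le_mul_of_nonneg_left hind (by have := hpos (1 - δ); positivity)
  · have h1 : (S.length : ℝ) ^ (1 - ε₁) ≤ 2 * X ^ ((ε + δ) * (1 - ε₁)) := by
      calc (S.length : ℝ) ^ (1 - ε₁) ≤ (2 * X ^ (ε + δ)) ^ (1 - ε₁) :=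
            Real.rpow_le_rpow (Nat.cast_nonneg _) (hSb.trans hbX) (by linarith)
        _ = 2 ^ (1 - ε₁) * X ^ ((ε + δ) * (1 - ε₁)) := by
            rw [Real.mul_rpow (by norm_num) (hpos _).le, ← Real.rpow_mul hX0.le]
        _ ≤ 2 * X ^ ((ε + δ) * (1 - ε₁)) := by
            refine mul_le_mul_of_nonneg_right ?_ (hpos _).le
            calc (2 : ℝ) ^ (1 - ε₁) ≤ 2 ^ (1 : ℝ) :=
                  Real.rpow_le_rpow_of_exponent_le (by norm_num) (by linarith)
              _ = 2 := Real.rpow_one 2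
    calc 4 * X ^ (ε - δ) * (S.length : ℝ) ^ (1 - ε₁)
        ≤ 4 * X ^ (ε - δ) * (2 * X ^ ((ε + δ) * (1 - ε₁))) :=
          mul_le_mul_of_nonneg_left h1 (by have := hpos (ε - δ); positivity)
      _ = 8 * X ^ (ε - δ + (ε + δ) * (1 - ε₁)) := by rw [← hadd]; ring
      _ ≤ 8 * X ^ (-(δ * ε₁ / 2)) := by
          -- The exponent equals `2 ε - δ ε₁ - ε ε₁`, and `2 ε = δ ε₁ / 2`: this is the reason for
          -- `ε = δ ε₁ / 4`.
          refine mul_le_mul_of_nonneg_left (Real.rpow_le_rpow_of_exponent_le hX1 ?_) (by norm_num)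
          have : 0 ≤ ε * ε₁ := by rw [hε]; positivity
          nlinarith
      _ ≤ 1 := hf

/-- The search is successful with high probability. -/
theorem le_search_of_exponents {n : ℕ} {G : SimpleGraph (Fin n)} {ε₁ ε₂ γ δ ε κ : ℝ} {N₁ N₂ : ℕ}
    (hε₁ : 0 < ε₁) (hε₁' : ε₁ < 1) (hε₂ : 0 < ε₂) (hε₂' : ε₂ < 1) (hγ : γ = ε₂ / 2)
    (hδ : δ * (2 * (m + 1)) = γ) (hε : ε = δ * ε₁ / 4) (hκ : 0 ≤ κ)
    {X : ℝ} (hX : X = n) (hX1 : 1 ≤ X)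
    (hlost : X ^ (γ + ε - ε₂) ≤ 1 / 2) (hN₂ : (N₂ : ℝ) ≤ X ^ (1 - γ))
    (hd : 2 ≤ X ^ (1 - δ)) (hN₁ : (N₁ : ℝ) ≤ X ^ (δ - ε) / 4)
    (herr : 2 ^ (m + 2) * X ^ (-γ / 2) + X ^ (-ε) + 8 * X ^ (-(δ - ε)) ≤ κ)
    (hf : 8 * X ^ (-(δ * ε₁ / 2)) ≤ 1) {c : ENNReal} (hc : c ≤ 1)
    (hA₁ : ∀ S, IsSet n S → free F m n G.matrix S = true → N₁ ≤ S.length →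
      c ≤ (A₁ n (encodeGraph (sub G S))).toOuterMeasure
        {d | (sub G S).IsApproxMIS ((S.length : ℝ) ^ (1 - ε₁)) (positions S.length d)})
    (hA₂ : ∀ k, 0 < k → ∀ W ∈ (strips F m n G.matrix k).2, N₂ ≤ W.length →
      c ≤ (A₂ n (encodeGraph (sub G W))).toOuterMeasure
        {d | (sub G W).IsApproxMIS ((W.length : ℝ) ^ (1 - ε₂)) (positions W.length d)}) :
    ENNReal.ofReal (1 - κ) * c ≤ (search F m A₁ A₂ n G.matrix).toOuterMeasure
      {B | IsIndep G B ∧ (G.indepNum : ℝ) ≤ X ^ (1 - ε) * B.length} := by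
  have hX0 : 0 < X := by linarith
  have hn : 0 < n := by
    have : (0 : ℝ) < n := hX ▸ hX0
    exact_mod_cast this
  have hadd : ∀ s t : ℝ, X ^ s * X ^ t = X ^ (s + t) := fun s t => (Real.rpow_add hX0 s t).symm
  have hpos : ∀ s : ℝ, 0 < X ^ s := fun s => Real.rpow_pos_of_pos hX0 s
  have hκ1 : ENNReal.ofReal (1 - κ) ≤ 1 := by
    rw [← ENNReal.ofReal_one]
    exact ENNReal.ofReal_le_ofReal (by linarith)
  have hκc : ENNReal.ofReal (1 - κ) * c ≤ c := mul_le_of_le_one_left' hκ1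
  have hδ0 : 0 < δ := by
    have h1 : (0 : ℝ) < 2 * (m + 1) := by positivity
    have h2 : 0 < δ * (2 * (m + 1)) := by rw [hδ, hγ]; positivity
    exact (pos_iff_pos_of_mul_pos h2).2 h1
  have hδγ : δ ≤ γ / 2 := by
    have : (0 : ℝ) ≤ m := Nat.cast_nonneg m
    nlinarith
  set a : ℝ := (G.indepNum : ℝ) with ha
  -- Lengths are integers, so rounding up the target costs nothing.
  set r : ℕ := ⌈a / X ^ (1 - ε)⌉₊ with hrdef
  have hr : ∀ b : ℕ, a / X ^ (1 - ε) ≤ b → r ≤ b := fun b hb => Nat.ceil_le.2 hb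
  suffices h : ENNReal.ofReal (1 - κ) * c ≤ (search F m A₁ A₂ n G.matrix).toOuterMeasure
      {B | r ≤ B.length} by
    refine h.trans (PMF.toOuterMeasure_mono _ fun B hB => ⟨(search_mem B hB.2).1, ?_⟩)
    have h1 : a / X ^ (1 - ε) ≤ B.length := Nat.ceil_le.1 hB.1
    rw [div_le_iff₀ (hpos _)] at h1
    linarith
  -- A small independence number is matched by the single vertex of `first`, with certainty.
  by_cases ha1 : a ≤ X ^ (1 - ε)
  · refine (hκc.trans hc).trans (PMF.toOuterMeasure_eq_one _ _ fun B hB => ?_).ge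
    refine le_trans (hr 1 ?_) (le_trans ?_ (search_mem B hB).2)
    · rw [div_le_iff₀ (hpos _)]; simpa using ha1
    · rw [first, if_neg (by simp; omega)]
      simp
  have hγ1 : 1 ≤ X ^ (1 - γ) := Real.one_le_rpow hX1 (by linarith)
  set k : ℕ := ⌈X ^ (1 - γ)⌉₊ with hk
  have hk0 : 0 < k := Nat.ceil_pos.2 (hpos _)
  have hkn : k ≤ n := by
    refine Nat.ceil_le.2 ?_
    calc X ^ (1 - γ) ≤ X ^ (1 : ℝ) := Real.rpow_le_rpow_of_exponent_le hX1 (by linarith)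
      _ = n := by rw [Real.rpow_one, hX]
  have hk1 : X ^ (1 - γ) ≤ k := Nat.le_ceil _
  have hk2 : (k : ℝ) ≤ 2 * X ^ (1 - γ) := by
    have := (Nat.ceil_lt_add_one (hpos (1 - γ)).le).le
    linarith
  -- The round with number `k'` uses the threshold `k' + 1`, so thresholds from `1` to `n` are
  -- covered.
  obtain ⟨k', hk'⟩ : ∃ k', k = k' + 1 := ⟨k - 1, by omega⟩
  have hst := stripped (F := F) (m := m) (n := n) G.matrix hk0
  refine le_search (k := k') (by omega) fun B hB => ?_
  by_cases hW : ∃ W ∈ (strips F m n G.matrix k).2, a ≤ X ^ (ε₂ - ε) * (sub G W).indepNum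
  · obtain ⟨W, hW, haW⟩ := hW
    have hWk := hst.le_length W hW
    refine le_round_of_improve (W := W) (by rw [← hk']; exact hW) (fun B hB => hκc.trans ?_) hB
    have hWN : N₂ ≤ W.length := by
      have : (N₂ : ℝ) ≤ k := hN₂.trans hk1
      exact le_trans (by exact_mod_cast this) hWk
    refine le_improve_of_indepNum (hst.isSet_mem W hW) hB (hA₂ k hk0 W hW hWN)
      -- The factor `X ^ (ε₂ - ε)` between the independence numbers, divided by the allowed ratio `X
      -- ^ (1 - ε)`.
      (s := X ^ (ε₂ - 1)) (hpos _).le hr ?_ ?_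
    · rw [div_le_iff₀ (hpos _)]
      refine haW.trans (le_of_eq ?_)
      rw [mul_right_comm, hadd]
      congr 2
      ring
    · calc X ^ (ε₂ - 1) * (W.length : ℝ) ^ (1 - ε₂) ≤ X ^ (ε₂ - 1) * X ^ (1 - ε₂) := by
            refine mul_le_mul_of_nonneg_left (Real.rpow_le_rpow (Nat.cast_nonneg _) ?_ (by linarith))
              (hpos _).le
            rw [hX]
            exact_mod_cast (hst.isSet_mem W hW).length_le
        _ = 1 := by rw [hadd, sub_add_sub_cancel, sub_self, Real.rpow_zero]
  · push Not at hW
    obtain ⟨I, hIn, hI, hIa⟩ := exists_max_indep G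
    have hlen : ((strips F m n G.matrix k).2.length : ℝ) ≤ X ^ γ := by
      have h1 : ((strips F m n G.matrix k).2.length : ℝ) * k ≤ X := by
        rw [hX]; exact_mod_cast length_mul_le hst
      have h2 : ((strips F m n G.matrix k).2.length : ℝ) * X ^ (1 - γ) ≤ X ^ γ * X ^ (1 - γ) := by
        rw [hadd, add_sub_cancel, Real.rpow_one]
        exact (mul_le_mul_of_nonneg_left hk1 (Nat.cast_nonneg _)).trans h1
      exact le_of_mul_le_mul_right h2 (hpos _)
    have ha0 : 0 ≤ a := Nat.cast_nonneg _
    have hcard := card_le_card_inter_add (I := I) (fun v hv => hst.cover v (hIn v hv))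
      (a := a * X ^ (ε - ε₂)) fun W hWm => by
        have h1 := hW W hWm
        have h2 : ((I.filter fun v => v ∈ W).card : ℝ) ≤ (sub G W).indepNum := by
          exact_mod_cast card_inter_le_indepNum (hst.isSet_mem W hWm) hI
        refine h2.trans ?_
        calc ((sub G W).indepNum : ℝ) =
              X ^ (ε₂ - ε) * (sub G W).indepNum * X ^ (ε - ε₂) := by
              rw [mul_right_comm, hadd, sub_add_sub_cancel, sub_self, Real.rpow_zero, one_mul]
          _ ≤ a * X ^ (ε - ε₂) := mul_le_mul_of_nonneg_right h1.le (hpos _).le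
    -- At most `X ^ γ` sets are removed, and each contains at most `a * X ^ (ε - ε₂)` points of `I`;
    -- for large `n` this is at most half of `I`.
    have hhalf : a ≤ 2 * ((I.filter fun v => v ∈ (strips F m n G.matrix k).1).card : ℝ) := by
      have h1 : ((strips F m n G.matrix k).2.length : ℝ) * (a * X ^ (ε - ε₂)) ≤ a * (1 / 2) := by
        calc ((strips F m n G.matrix k).2.length : ℝ) * (a * X ^ (ε - ε₂))
            ≤ X ^ γ * (a * X ^ (ε - ε₂)) :=
              mul_le_mul_of_nonneg_right hlen (mul_nonneg ha0 (hpos _).le)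
          _ = a * X ^ (γ + ε - ε₂) := by
              rw [mul_left_comm, hadd]; congr 2; ring
          _ ≤ a * (1 / 2) := mul_le_mul_of_nonneg_left hlost ha0
      rw [hIa, ← ha] at hcard
      linarith
    obtain ⟨j, hj, h⟩ := le_trial_of_exponents (F := F) (m := m) (A₁ := A₁) (G := G)
      (I := I.filter fun v => v ∈ (strips F m n G.matrix k).1) hε₁ hε₁' hδ hδ0
      hε hX hX1 hd hN₁ herr hf hA₁ hst.isSet (not_le.1 ha1).le
      (fun u hu v hv => hI u (Finset.mem_filter.1 hu).1 v (Finset.mem_filter.1 hv).1)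
      (fun u hu => by simpa using (Finset.mem_filter.1 hu).2) hhalf
      (by
        have h1 := card_copies_le (m := m) (F := F) hst.isSet hst.few
        have h2 : ((copies F m n G.matrix (strips F m n G.matrix k).1).card : ℝ) ≤ n ^ m * k := by
          exact_mod_cast h1
        refine h2.trans ?_
        rw [hX]
        exact mul_le_mul_of_nonneg_left (hX ▸ hk2) (by positivity)) hr
    exact le_round_of_trial hj (by rw [← hk']; exact h) hB

end Alg

/-! ### Large graphs, and the theorem -/

namespace Alg

variable {F : ℕ → ℕ → Bool} {m : ℕ} {A₁ A₂ : ℕ → Data → PMF Data}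

theorem tendsto_natCast_rpow_atTop {s : ℝ} (hs : 0 < s) :
    Tendsto (fun n : ℕ => (n : ℝ) ^ s) atTop atTop :=
  (tendsto_rpow_atTop hs).comp tendsto_natCast_atTop_atTop

theorem tendsto_natCast_rpow_zero {s : ℝ} (hs : s < 0) :
    Tendsto (fun n : ℕ => (n : ℝ) ^ s) atTop (𝓝 0) := by
  have := (tendsto_rpow_neg_atTop (neg_pos.2 hs)).comp (tendsto_natCast_atTop_atTop (R := ℝ))
  simpa only [neg_neg, Function.comp_def] using this

/-- The search is successful with high probability on all large graphs. -/
theorem eventually_le_search {ε₁ ε₂ κ : ℝ} (hε₁ : 0 < ε₁) (hε₁' : ε₁ < 1) (hε₂ : 0 < ε₂)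
    (hε₂' : ε₂ < 1) (hκ : 0 < κ) {c : ENNReal} (hc : c ≤ 1) (N₁ N₂ : ℕ) :
    ∀ᶠ n : ℕ in atTop, ∀ G : SimpleGraph (Fin n),
      (∀ S, IsSet n S → free F m n G.matrix S = true → N₁ ≤ S.length →
        c ≤ (A₁ n (encodeGraph (sub G S))).toOuterMeasure
          {d | (sub G S).IsApproxMIS ((S.length : ℝ) ^ (1 - ε₁)) (positions S.length d)}) →
      (∀ k, 0 < k → ∀ W ∈ (strips F m n G.matrix k).2, N₂ ≤ W.length →
        c ≤ (A₂ n (encodeGraph (sub G W))).toOuterMeasure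
          {d | (sub G W).IsApproxMIS ((W.length : ℝ) ^ (1 - ε₂)) (positions W.length d)}) →
      ENNReal.ofReal (1 - κ) * c ≤ (search F m A₁ A₂ n G.matrix).toOuterMeasure
        {B | IsIndep G B ∧
          (G.indepNum : ℝ) ≤ (n : ℝ) ^ (1 - ε₁ * ε₂ / (16 * (m + 1))) * B.length} := by
  -- With `γ = ε₂ / 2` the loss `γ + ε - ε₂` is negative, as `ε < δ < ε₂ / 2`; the denominator of
  -- `δ` leaves half of `γ` for the expected number of copies.
  obtain ⟨γ, hγ⟩ : ∃ γ, γ = ε₂ / 2 := ⟨_, rfl⟩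
  have hm : (0 : ℝ) < m + 1 := by positivity
  obtain ⟨δ, hδ⟩ : ∃ δ, δ = γ / (2 * (m + 1)) := ⟨_, rfl⟩
  obtain ⟨ε, hε⟩ : ∃ ε, ε = δ * ε₁ / 4 := ⟨_, rfl⟩
  have hδ' : δ * (2 * (m + 1)) = γ := by rw [hδ]; field_simp
  have hεeq : ε₁ * ε₂ / (16 * (m + 1)) = ε := by rw [hε, hδ, hγ]; field_simp; norm_num
  have hγ0 : 0 < γ := by rw [hγ]; positivity
  have hδ0 : 0 < δ := by rw [hδ]; positivity
  have hδγ : δ ≤ γ / 2 := by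
    have : (0 : ℝ) ≤ m := Nat.cast_nonneg m
    nlinarith
  have hε0 : 0 < ε := by rw [hε]; positivity
  have hεδ : ε < δ := by
    rw [hε]
    nlinarith
  have hlost : ∀ᶠ n : ℕ in atTop, (n : ℝ) ^ (γ + ε - ε₂) ≤ 1 / 2 :=
    (tendsto_natCast_rpow_zero (by linarith)).eventually_le_const (by norm_num)
  have hN₂ : ∀ᶠ n : ℕ in atTop, (N₂ : ℝ) ≤ (n : ℝ) ^ (1 - γ) :=
    (tendsto_natCast_rpow_atTop (by linarith)).eventually_ge_atTop _
  have hd : ∀ᶠ n : ℕ in atTop, 2 ≤ (n : ℝ) ^ (1 - δ) :=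
    (tendsto_natCast_rpow_atTop (by linarith)).eventually_ge_atTop _
  have hN₁ : ∀ᶠ n : ℕ in atTop, 4 * (N₁ : ℝ) ≤ (n : ℝ) ^ (δ - ε) :=
    (tendsto_natCast_rpow_atTop (by linarith)).eventually_ge_atTop _
  have herr : ∀ᶠ n : ℕ in atTop, 2 ^ (m + 2) * (n : ℝ) ^ (-γ / 2) + (n : ℝ) ^ (-ε) +
      8 * (n : ℝ) ^ (-(δ - ε)) ≤ κ := by
    refine Tendsto.eventually_le_const hκ ?_
    have := (((tendsto_natCast_rpow_zero (s := -γ / 2) (by linarith)).const_mul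
      ((2 : ℝ) ^ (m + 2))).add (tendsto_natCast_rpow_zero (s := -ε) (by linarith))).add
      ((tendsto_natCast_rpow_zero (s := -(δ - ε)) (by linarith)).const_mul 8)
    simpa using this
  have hf : ∀ᶠ n : ℕ in atTop, 8 * (n : ℝ) ^ (-(δ * ε₁ / 2)) ≤ 1 := by
    refine Tendsto.eventually_le_const one_pos ?_
    have h : -(δ * ε₁ / 2) < 0 := neg_neg_of_pos (by positivity)
    simpa using (tendsto_natCast_rpow_zero h).const_mul 8
  rw [hεeq]
  filter_upwards [hlost, hN₂, hd, hN₁, herr, hf, eventually_ge_atTop 1] with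
    n hlost hN₂ hd hN₁ herr hf hn G hA₁ hA₂
  exact le_search_of_exponents hε₁ hε₁' hε₂ hε₂' hγ hδ' hε hκ.le rfl (by exact_mod_cast hn) hlost
    hN₂ hd (by linarith) herr hf hc hA₁ hA₂

end Alg

theorem exists_equiv_fin_succ {V : Type*} [Finite V] (v : V) :
    ∃ (m : ℕ) (e : V ≃ Fin (m + 1)), e v = 0 := by
  obtain ⟨k, ⟨e⟩⟩ := Finite.exists_equiv_fin V
  obtain _ | m := k
  · exact (e v).elim0
  · exact ⟨m, e.trans (Equiv.swap (e v) 0), by simp⟩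

/-- A randomized function of the adjacency matrix that is computed in polynomial time and
outputs good approximations with high probability yields the improved approximation property. -/
theorem SimpleGraph.improvedApproximationProperty_of_polyRand {V : Type*} {H : SimpleGraph V}
    {R : ℕ → List (List Bool) → PMF (List Bool)}
    (hR : PolyRand (fun n M => ∃ G : SimpleGraph (Fin n), G.IsFreeOf H ∧ M = G.matrix) R)
    {ε : ℝ} (hε : 0 < ε)
    (h : ∀ c : ENNReal, c < 1 → ∀ᶠ n : ℕ in atTop, ∀ G : SimpleGraph (Fin n), G.IsFreeOf H →
      c ≤ (R n G.matrix).toOuterMeasure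
        {x | G.IsApproxMIS ((n : ℝ) ^ (1 - ε)) (Alg.positions n (code x))}) :
    H.ImprovedApproximationProperty := by
  obtain ⟨k, hk⟩ := hR
  obtain ⟨p, T, hp⟩ := k.exists_prog
  have hev : ∀ (n : ℕ) (G : SimpleGraph (Fin n)), G.IsFreeOf H →
      Config.Eventually (p.start (encodeGraph G)) (T.eval n)
        (((R n G.matrix).map code).map some) := by
    intro n G hG
    obtain ⟨h1, h2⟩ := hk n _ ⟨G, hG, rfl⟩
    rw [SimpleGraph.code_matrix] at h1 h2
    have h3 := hp (List.ofFn fun i => Data.ofList (List.ofFn fun j =>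
      Data.ofBool (@decide (G.Adj i j) (Classical.propDecidable _))))
    rw [List.length_ofFn] at h3
    rw [← h2]
    exact h3 h1
  -- The worst success probability over all `H`-free graphs with `n` vertices. The cap by `1` is
  -- needed for those `n` without such a graph, where the infimum is `⊤`.
  set f : ℕ → ENNReal := fun n => min 1 (⨅ (G : SimpleGraph (Fin n)) (_ : G.IsFreeOf H),
    (R n G.matrix).toOuterMeasure
      {x | G.IsApproxMIS ((n : ℝ) ^ (1 - ε)) (Alg.positions n (code x))}) with hf
  refine ⟨ε, hε, p, ⟨T, fun n G hG => (hev n G hG).halted_of_eq_map_some⟩, f, ?_,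
    fun n G hG => ⟨T.eval n, ?_⟩⟩
  · refine tendsto_order.2 ⟨fun c hc => ?_, fun c hc =>
      Eventually.of_forall fun n => (min_le_left _ _).trans_lt hc⟩
    obtain ⟨c', hc, hc'⟩ := exists_between hc
    filter_upwards [h c' hc'] with n hn
    exact hc.trans_le (le_min hc'.le (le_iInf₂ hn))
  · have h1 := (hev n G hG).toOuterMeasure_eq
      {d | G.IsApproxMIS ((n : ℝ) ^ (1 - ε)) (Alg.positions n d)}
    have h2 : f n ≤ ((R n G.matrix).map code).toOuterMeasure
        {d | G.IsApproxMIS ((n : ℝ) ^ (1 - ε)) (Alg.positions n d)} := by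
      rw [PMF.toOuterMeasure_map_apply]
      exact (min_le_right _ _).trans (iInf₂_le G hG)
    exact h2.trans h1.ge

theorem theorem3 {V₁ V₂ V : Type*} [Finite V₁] [Finite V₂]
    (H₁ : SimpleGraph V₁) (H₂ : SimpleGraph V₂) (H : SimpleGraph V)
    (h₁ : H₁.ImprovedApproximationProperty) (h₂ : H₂.ImprovedApproximationProperty)
    (hH : H.IsSubstitution H₁ H₂) : H.ImprovedApproximationProperty := by
  obtain ⟨v₀, hH⟩ := hH
  obtain ⟨m, e, he⟩ := exists_equiv_fin_succ v₀
  obtain ⟨ε₁, hε₁, hε₁', p₁, T₁, hp₁, hap₁⟩ := h₁.exists_output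
  obtain ⟨ε₂, hε₂, hε₂', p₂, T₂, hp₂, hap₂⟩ := h₂.exists_output
  have hfree : ∀ {n k : ℕ} {G : SimpleGraph (Fin n)}, G.IsFreeOf H → 0 < k →
      ∀ W ∈ (Alg.strips (Alg.pattern H₁ e) m n G.matrix k).2, (Alg.sub G W).IsFreeOf H₂ := by
    intro n k G hG hk W hW
    have hst := Alg.stripped (F := Alg.pattern H₁ e) (m := m) (n := n) G.matrix hk
    obtain ⟨t, ht, hc⟩ := hst.exists_tuple W hW
    obtain ⟨ht, htn⟩ := (Alg.mem_tuples (by simp) m t).1 ht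
    exact Alg.isFreeOf_of_copy he hH hG (hst.isSet_mem W hW) (hk.trans_le (hst.le_length W hW)) ht
      (fun u hu => List.mem_range.1 (htn u hu)) hc
  refine SimpleGraph.improvedApproximationProperty_of_polyRand
    (PolyRand.search (F := Alg.pattern H₁ e) (m := m) (PolyRand.call p₁ T₁) (PolyRand.call p₂ T₂)
      ?_ ?_) (ε := ε₁ * ε₂ / (16 * (m + 1))) (by positivity) ?_
  · rintro n _ ⟨G, hG, rfl⟩ k W hW
    have hst := Alg.stripped (F := Alg.pattern H₁ e) (m := m) (n := n) G.matrix k.succ_pos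
    have hWs := hst.isSet_mem W hW
    rw [Alg.code_induced hWs]
    exact hp₂ n _ _ hWs.length_le (hfree hG k.succ_pos W hW)
  · rintro n _ ⟨G, hG, rfl⟩ k j S hS hF
    have hst := Alg.stripped (F := Alg.pattern H₁ e) (m := m) (n := n) G.matrix k.succ_pos
    have hSs := (Alg.sample_mem hst.isSet j S hS).1
    rw [Alg.code_induced hSs]
    exact hp₁ n _ _ hSs.length_le (Alg.isFreeOf_of_free hSs hF)
  · intro c hc
    -- The sample has to be good and the call on it has to succeed. Each gets probability at least
    -- `x = √c`, so that the product reaches `c`.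
    obtain ⟨x, hcx, hx1⟩ : ∃ x : ℝ, c ≤ ENNReal.ofReal (x * x) ∧ 0 ≤ x ∧ x < 1 := by
      refine ⟨√c.toReal, ?_, Real.sqrt_nonneg _, ?_⟩
      · rw [Real.mul_self_sqrt ENNReal.toReal_nonneg, ENNReal.ofReal_toReal hc.ne_top]
      · rw [Real.sqrt_lt' one_pos, one_pow]
        exact ENNReal.toReal_lt_of_lt_ofReal (by simpa using hc)
    have hxc : ENNReal.ofReal x < 1 := by
      rw [← ENNReal.ofReal_one]
      exact (ENNReal.ofReal_lt_ofReal_iff one_pos).2 hx1.2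
    obtain ⟨N₁, hN₁⟩ := hap₁ _ hxc
    obtain ⟨N₂, hN₂⟩ := hap₂ _ hxc
    filter_upwards [Alg.eventually_le_search (F := Alg.pattern H₁ e) (m := m)
      (A₁ := p₁.output T₁) (A₂ := p₂.output T₂) hε₁ hε₁' hε₂ hε₂' (κ := 1 - x) (by linarith)
      hxc.le N₁ N₂] with n hn G hG
    have h := hn G (fun S hS hF hSN => hN₁ n _ _ hSN hS.length_le (Alg.isFreeOf_of_free hS hF))
      fun k hk W hW hWN => hN₂ n _ _ hWN
        ((Alg.stripped (F := Alg.pattern H₁ e) (m := m) G.matrix hk).isSet_mem W hW).length_le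
        (hfree hG hk W hW)
    rw [sub_sub_cancel, ← ENNReal.ofReal_mul hx1.1] at h
    refine (hcx.trans h).trans ?_
    refine le_of_le_of_eq ?_ (PMF.toOuterMeasure_map_apply (Alg.mask n) _ _).symm
    exact (PMF.toOuterMeasure _).mono fun B hB => Alg.isApproxMIS_mask hB.1 hB.2
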